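/- Let $n\ge 1$, $\tau>0$, $m\in\mathbb R$; write $x=(x',x_n)$, $\overline{\mathbb R^n_+}=\{x\in\mathbb R^n:x_n\ge 0\}$, $\mathbb R_+=(0,\infty)$, $\langle\xi'\rangle=(1+|\xi'|^2)^{1/2}$, $\hat v(\xi')=\int_{\mathbb R^{n-1}}e^{-iy'\cdot\xi'}v(y')\,dy'$ and $\bar d\xi'=(2\pi)^{-(n-1)}d\xi'$. For a Banach space $F$, $C^\tau(U;F)$ is the H\"older space of functions on $U$ that are $[\tau]$ times continuously differentiable with bounded derivatives, those of order $[\tau]$ being H\"older continuous of degree $\tau-[\tau]$, with its usual norm; $C^\tau(U)=C^\tau(U;\mathbb C)$. $C_b^\infty(U)$ is the space of complex-valued smooth functions on $U$ that are bounded with all derivatives, and $\mathcal S(\overline{\mathbb R^n_+})$ is the space of smooth functions on $\overline{\mathbb R^n_+}$ that are rapidly decreasing with all derivatives. *Symbol-kernels.* Let $U$ be $\mathbb R^{n-1}$ or $\overline{\mathbb R^n_+}$, $q\in\{1,2\}$ and $\mathcal S_{(1)}=\mathcal S_+$, $\mathcal S_{(2)}=\mathcal S_{++}$. $C^\tau S^m_{1,0}(U\times\mathbb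 R^{n-1};\mathcal S_{(q)})$ is the set of functions $h(x,\xi',Y)$ that are smooth in $(\xi',Y)\in\mathbb R^{n-1}\times[0,\infty)^q$ and in $C^\tau(U)$ with respect to $x$, such that for all $\alpha\in\mathbb N^{n-1}$, $k,k'\in\mathbb N^q$ there is $C_{\alpha,k,k'}$ with $$\big\|Y^k\partial_Y^{k'}\partial_{\xi'}^\alpha h(\cdot,\xi',\cdot)\big\|_{C^\tau(U;L^2(\mathbb R_+^q))}\le C_{\alpha,k,k'}\langle\xi'\rangle^{m+\frac q2-|k|+|k'|-|\alpha|}\qquad\text{for all }\xi'\in\mathbb R^{n-1}.$$ *Operators.* For $k\in C^\tau S^{m-1}_{1,0}(\overline{\mathbb R^n_+}\times\mathbb R^{n-1};\mathcal S_+)$, $t\in C^\tau S^m_{1,0}(\mathbb R^{n-1}\times\mathbb R^{n-1};\mathcal S_+)$, $g\in C^\tau S^m_{1,0}(\overline{\mathbb R^n_+}\times\mathbb R^{n-1};\mathcal S_{++})$, $v\in\mathcal S(\mathbb R^{n-1})$ and $u\in\mathcal S(\overline{\mathbb R^n_+})$ the Poisson operator, the trace operator (of class 0) and the singular Green operator (of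 class 0) are $$k(x,D_{x'})v(x)=\int e^{ix'\cdot\xi'}k(x,\xi',x_n)\hat v(\xi')\,\bar d\xi',\qquad t(x',D_x)u(x')=\int e^{ix'\cdot\xi'}\int_0^\infty t(x',\xi',y_n)\,\widehat{u(\cdot,y_n)}(\xi')\,dy_n\,\bar d\xi',$$ $$g(x,D_x)u(x)=\int e^{ix'\cdot\xi'}\int_0^\infty g(x,\xi',x_n,w_n)\,\widehat{u(\cdot,w_n)}(\xi')\,dw_n\,\bar d\xi'.$$ *Kernels.* Call $K(x,z',Y)$, $x\in U$, $z'\in\mathbb R^{n-1}$, $Y\in[0,\infty)^q$, *admissible on $U$* if it is smooth in $(z',Y)$ and for all $\alpha,\beta\in\mathbb N^{n-1}$, $k,k'\in\mathbb N^q$ $$\sup_{z'\in\mathbb R^{n-1},\,Y\in[0,\infty)^q}\big\|(z')^\beta\partial_{z'}^\alpha Y^k\partial_Y^{k'}K(\cdot,z',Y)\big\|_{C^\tau(U)}<\infty .$$ An operator $A$ has a $C^\tau$--$C^\infty$-kernel if there is an admissible $K$ such that, respectively, - (Poisson type; $U=\overline{\mathbb R^n_+}$, $q=1$) $Av(x)=\int_{\mathbb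 R^{n-1}}K(x,x'-y',x_n)v(y')\,dy'$ for all $v\in\mathcal S(\mathbb R^{n-1})$, $x\in\overline{\mathbb R^n_+}$; - (trace type; $U=\mathbb R^{n-1}$, $q=1$) $Au(x')=\int_{\mathbb R^{n-1}}\int_0^\infty K(x',x'-y',y_n)u(y',y_n)\,dy_n\,dy'$ for all $u\in\mathcal S(\overline{\mathbb R^n_+})$, $x'\in\mathbb R^{n-1}$; - (singular Green type; $U=\overline{\mathbb R^n_+}$, $q=2$) $Au(x)=\int_{\mathbb R^{n-1}}\int_0^\infty K(x,x'-w',x_n,w_n)u(w',w_n)\,dw_n\,dw'$ for all $u\in\mathcal S(\overline{\mathbb R^n_+})$, $x\in\overline{\mathbb R^n_+}$. **Theorem.** 1. Let $\varphi\in C_b^\infty(\overline{\mathbb R^n_+})$, $\psi\in C_b^\infty(\mathbb R^{n-1})$ with $\operatorname{supp}\varphi\cap(\operatorname{supp}\psi\times\{0\})=\emptyset$, and let $k\in C^\tau S^{m-1}_{1,0}(\overline{\mathbb R^n_+}\times\mathbb R^{n-1};\mathcal S_+)$. Then the operator $v\mapsto\varphi\,k(x,D_{x'})(\psi v)$ has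 a $C^\tau$--$C^\infty$-kernel. 2. Let $\varphi,\psi$ be as in 1 and let $t\in C^\tau S^m_{1,0}(\mathbb R^{n-1}\times\mathbb R^{n-1};\mathcal S_+)$. Then the operator $u\mapsto\psi\,t(x',D_x)(\varphi u)$ has a $C^\tau$--$C^\infty$-kernel. 3. Let $\varphi,\psi\in C_b^\infty(\overline{\mathbb R^n_+})$ with $\operatorname{supp}\varphi\cap\operatorname{supp}\psi\cap(\mathbb R^{n-1}\times\{0\})=\emptyset$, and let $g\in C^\tau S^m_{1,0}(\overline{\mathbb R^n_+}\times\mathbb R^{n-1};\mathcal S_{++})$. Then the operator $u\mapsto\varphi\,g(x,D_x)(\psi u)$ has a $C^\tau$--$C^\infty$-kernel. -/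

import Mathlib

open scoped ContDiff SchwartzMap

noncomputable section

namespace NonsmoothGreen

open MeasureTheory Set

/-! ### Function spaces -/

/-- `HolderBound τ U f C` says that `f` belongs to the Hölder space `C^τ(U; F)` with norm
controlled by `C`: `f` is `[τ]` times continuously differentiable on `U`, its derivatives of order
at most `[τ]` are bounded by `C` on `U`, and the derivatives of order `[τ]` are Hölder continuous
of degree `τ - [τ]` on `U` with constant `C`. (Collecting the partial derivatives of order `j` in
the `j`-th Fréchet derivative changes the norm by a constant factor depending on the dimension
and on `τ` only.) -/
structure HolderBound {E F : Type*} [NormedAddCommGroup E] [NormedSpace ℝ E]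
    [NormedAddCommGroup F] [NormedSpace ℝ F]
    (τ : ℝ) (U : Set E) (f : E → F) (C : ℝ) : Prop where
  contDiffOn : ContDiffOn ℝ (⌊τ⌋₊ : ℕ) f U
  bound : ∀ j : ℕ, j ≤ ⌊τ⌋₊ → ∀ x ∈ U, ‖iteratedFDerivWithin ℝ j f U x‖ ≤ C
  holder : ∀ x ∈ U, ∀ y ∈ U,
    ‖iteratedFDerivWithin ℝ ⌊τ⌋₊ f U x - iteratedFDerivWithin ℝ ⌊τ⌋₊ f U y‖
      ≤ C * ‖x - y‖ ^ (τ - (⌊τ⌋₊ : ℝ))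

/-- `C_b^∞(U)`: complex-valued functions that are smooth on `U` and bounded there with all their
derivatives. -/
structure IsCbInfty {E : Type*} [NormedAddCommGroup E] [NormedSpace ℝ E]
    (U : Set E) (φ : E → ℂ) : Prop where
  contDiffOn : ContDiffOn ℝ ∞ φ U
  bound : ∀ j : ℕ, ∃ C : ℝ, ∀ x ∈ U, ‖iteratedFDerivWithin ℝ j φ U x‖ ≤ C

/-- `𝒮(U)` for a closed set `U` (here the closed half-space): complex-valued functions that are
smooth on `U` and rapidly decreasing there with all their derivatives. -/
structure IsSchwartzOn {E : Type*} [NormedAddCommGroup E] [NormedSpace ℝ E]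
    (U : Set E) (u : E → ℂ) : Prop where
  contDiffOn : ContDiffOn ℝ ∞ u U
  decay : ∀ k j : ℕ, ∃ C : ℝ, ∀ x ∈ U, ‖x‖ ^ k * ‖iteratedFDerivWithin ℝ j u U x‖ ≤ C

/-- The support of a function that is given on the closed set `U`. -/
def suppOn {E : Type*} [TopologicalSpace E] (U : Set E) (φ : E → ℂ) : Set E :=
  closure {x ∈ U | φ x ≠ 0}

/-! ### The spaces `ℝ^{n-1}`, the closed half-space in `ℝ^n`, and the closed orthants

We write `d = n - 1`, so that a point `x = (x', x_n)` of `ℝ^n` is an element of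
`EuclideanSpace ℝ (Fin d) × ℝ`. -/

/-- The closed half-space `{x = (x', x_n) | x_n ≥ 0}`. -/
def halfSpace (d : ℕ) : Set (EuclideanSpace ℝ (Fin d) × ℝ) := {x | 0 ≤ x.2}

/-- The closed orthant `[0, ∞)^q`; it is the half-line for `q = 1` and the quadrant for `q = 2`. -/
def orthant (q : ℕ) : Set (Fin q → ℝ) := {Y | ∀ j, 0 ≤ Y j}

/-- The domain `ℝ^d × [0, ∞)^q` of the variables `(ξ', Y)` or `(z', Y)`, where `Y = y_n` for
`q = 1` and `Y = (y_n, w_n)` for `q = 2`. -/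
def domVY (d q : ℕ) : Set (EuclideanSpace ℝ (Fin d) × (Fin q → ℝ)) := univ ×ˢ orthant q

/-- The monomial `z^β`. -/
def monomial {d : ℕ} (β : Fin d → ℕ) (z : Fin d → ℝ) : ℝ := ∏ i, z i ^ β i

/-- The directional derivative along `v` of a function on `ℝ^d × [0, ∞)^q` (one-sided at the
boundary points). -/
def pd {d q : ℕ} (v : EuclideanSpace ℝ (Fin d) × (Fin q → ℝ))
    (f : EuclideanSpace ℝ (Fin d) × (Fin q → ℝ) → ℂ) :
    EuclideanSpace ℝ (Fin d) × (Fin q → ℝ) → ℂ :=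
  fun p => fderivWithin ℝ f (domVY d q) p v

/-- The mixed partial derivative `∂_{z'}^α ∂_Y^{k'}` of a function of
`(z', Y) ∈ ℝ^d × [0, ∞)^q`. -/
def mixedDeriv {d q : ℕ} (α : Fin d → ℕ) (k' : Fin q → ℕ)
    (f : EuclideanSpace ℝ (Fin d) × (Fin q → ℝ) → ℂ) :
    EuclideanSpace ℝ (Fin d) × (Fin q → ℝ) → ℂ :=
  (List.finRange d).foldr (fun i g => (pd (EuclideanSpace.single i (1 : ℝ), 0))^[α i] g)
    ((List.finRange q).foldr (fun j g => (pd (0, Pi.single j (1 : ℝ)))^[k' j] g) f)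

/-- `⟨ξ⟩ = (1 + |ξ|²)^{1/2}`. -/
def japanese {d : ℕ} (ξ : EuclideanSpace ℝ (Fin d)) : ℝ := Real.sqrt (1 + ‖ξ‖ ^ 2)

/-! ### Symbol-kernels -/

/-- The symbol-kernel class `C^τ S^m_{1,0}(U × ℝ^d; 𝒮_+)` for `q = 1` and
`C^τ S^m_{1,0}(U × ℝ^d; 𝒮_{++})` for `q = 2`: functions `h(x, ξ', Y)`, smooth in
`(ξ', Y) ∈ ℝ^d × [0, ∞)^q` and in `C^τ(U)` with respect to `x`, such that
`‖Y^k ∂_Y^{k'} ∂_{ξ'}^α h(·, ξ', ·)‖_{C^τ(U; L²_Y)} ≤ C_{α,k,k'} ⟨ξ'⟩^{m + q/2 - |k| + |k'| - |α|}`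
for all `ξ'`. In `bound`, `G` is the map that sends `x ∈ U` to the class of
`Y^k ∂_Y^{k'} ∂_{ξ'}^α h(x, ξ', ·)` in `L²`. -/
structure IsSymbolKernel {E : Type*} [NormedAddCommGroup E] [NormedSpace ℝ E] {d q : ℕ}
    (τ m : ℝ) (U : Set E) (h : E → EuclideanSpace ℝ (Fin d) × (Fin q → ℝ) → ℂ) : Prop where
  smooth : ∀ x ∈ U, ContDiffOn ℝ ∞ (h x) (domVY d q)
  holder : ∀ p ∈ domVY d q, ∃ C : ℝ, HolderBound τ U (fun x => h x p) C
  bound : ∀ (α : Fin d → ℕ) (k k' : Fin q → ℕ), ∃ C : ℝ, ∀ ξ : EuclideanSpace ℝ (Fin d),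
    ∃ G : E → Lp ℂ 2 (volume.restrict (orthant q)),
      (∀ x ∈ U, (G x : (Fin q → ℝ) → ℂ) =ᵐ[volume.restrict (orthant q)]
        fun Y => (monomial k Y : ℂ) * mixedDeriv α k' (h x) (ξ, Y)) ∧
      HolderBound τ U G
        (C * japanese ξ ^ (m + (q : ℝ) / 2 - (∑ j, k j : ℕ) + (∑ j, k' j : ℕ)
          - (∑ i, α i : ℕ)))

/-! ### The operators -/

/-- The Fourier transform `û(ξ) = ∫ e^{-i y·ξ} u(y) dy` on `ℝ^d`. -/
def fourierHat {d : ℕ} (u : EuclideanSpace ℝ (Fin d) → ℂ) (ξ : EuclideanSpace ℝ (Fin d)) : ℂ :=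
  ∫ y, Complex.exp (-Complex.I * (inner ℝ y ξ : ℝ)) * u y

/-- `∫ e^{i x'·ξ'} a(ξ') đξ'` with `đξ' = (2π)^{-d} dξ'`. -/
def invFourierHat {d : ℕ} (a : EuclideanSpace ℝ (Fin d) → ℂ) (x' : EuclideanSpace ℝ (Fin d)) : ℂ :=
  ((2 * Real.pi : ℝ) ^ d : ℝ)⁻¹ * ∫ ξ, Complex.exp (Complex.I * (inner ℝ x' ξ : ℝ)) * a ξ

/-- The Poisson operator `k(x, D_{x'})`. -/
def poissonOp {d : ℕ}
    (k : EuclideanSpace ℝ (Fin d) × ℝ → EuclideanSpace ℝ (Fin d) × (Fin 1 → ℝ) → ℂ)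
    (v : EuclideanSpace ℝ (Fin d) → ℂ) (x : EuclideanSpace ℝ (Fin d) × ℝ) : ℂ :=
  invFourierHat (fun ξ => k x (ξ, ![x.2]) * fourierHat v ξ) x.1

/-- The trace operator `t(x', D_x)` of class `0`. -/
def traceOp {d : ℕ}
    (t : EuclideanSpace ℝ (Fin d) → EuclideanSpace ℝ (Fin d) × (Fin 1 → ℝ) → ℂ)
    (u : EuclideanSpace ℝ (Fin d) × ℝ → ℂ) (x' : EuclideanSpace ℝ (Fin d)) : ℂ :=
  invFourierHat (fun ξ => ∫ y in Ioi (0 : ℝ), t x' (ξ, ![y]) * fourierHat (fun y' => u (y', y)) ξ) x'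

/-- The singular Green operator `g(x, D_x)` of class `0`. -/
def singularGreenOp {d : ℕ}
    (g : EuclideanSpace ℝ (Fin d) × ℝ → EuclideanSpace ℝ (Fin d) × (Fin 2 → ℝ) → ℂ)
    (u : EuclideanSpace ℝ (Fin d) × ℝ → ℂ) (x : EuclideanSpace ℝ (Fin d) × ℝ) : ℂ :=
  invFourierHat
    (fun ξ => ∫ w in Ioi (0 : ℝ), g x (ξ, ![x.2, w]) * fourierHat (fun w' => u (w', w)) ξ) x.1

/-! ### `C^τ`–`C^∞` kernels -/

/-- `K(x, z', Y)` is smooth in `(z', Y) ∈ ℝ^d × [0, ∞)^q` and, for all multi-indices,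
`sup_{z', Y} ‖(z')^β ∂_{z'}^α Y^k ∂_Y^{k'} K(·, z', Y)‖_{C^τ(U)} < ∞`. -/
structure IsCtauCinftyKernel {E : Type*} [NormedAddCommGroup E] [NormedSpace ℝ E] {d q : ℕ}
    (τ : ℝ) (U : Set E) (K : E → EuclideanSpace ℝ (Fin d) × (Fin q → ℝ) → ℂ) : Prop where
  smooth : ∀ x ∈ U, ContDiffOn ℝ ∞ (K x) (domVY d q)
  bound : ∀ (α β : Fin d → ℕ) (k k' : Fin q → ℕ), ∃ C : ℝ, ∀ p ∈ domVY d q,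
    HolderBound τ U
      (fun x => (monomial β p.1 : ℂ) * (monomial k p.2 : ℂ) * mixedDeriv α k' (K x) p) C

/-- An operator `A` from functions on `ℝ^d` to functions on the closed half-space has a
`C^τ`–`C^∞` kernel (of Poisson type). -/
def PoissonHasKernel {d : ℕ} (τ : ℝ)
    (A : (EuclideanSpace ℝ (Fin d) → ℂ) → EuclideanSpace ℝ (Fin d) × ℝ → ℂ) : Prop :=
  ∃ K : EuclideanSpace ℝ (Fin d) × ℝ → EuclideanSpace ℝ (Fin d) × (Fin 1 → ℝ) → ℂ,
    IsCtauCinftyKernel τ (halfSpace d) K ∧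
    ∀ v : 𝓢(EuclideanSpace ℝ (Fin d), ℂ), ∀ x ∈ halfSpace d,
      A v x = ∫ y', K x (x.1 - y', ![x.2]) * v y'

/-- An operator `A` from functions on the closed half-space to functions on `ℝ^d` has a
`C^τ`–`C^∞` kernel (of trace type). -/
def TraceHasKernel {d : ℕ} (τ : ℝ)
    (A : (EuclideanSpace ℝ (Fin d) × ℝ → ℂ) → EuclideanSpace ℝ (Fin d) → ℂ) : Prop :=
  ∃ K : EuclideanSpace ℝ (Fin d) → EuclideanSpace ℝ (Fin d) × (Fin 1 → ℝ) → ℂ,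
    IsCtauCinftyKernel τ univ K ∧
    ∀ u : EuclideanSpace ℝ (Fin d) × ℝ → ℂ, IsSchwartzOn (halfSpace d) u →
      ∀ x' : EuclideanSpace ℝ (Fin d),
        A u x' = ∫ y', ∫ y in Ioi (0 : ℝ), K x' (x' - y', ![y]) * u (y', y)

/-- An operator `A` on functions on the closed half-space has a `C^τ`–`C^∞` kernel (of singular
Green type). -/
def SingularGreenHasKernel {d : ℕ} (τ : ℝ)
    (A : (EuclideanSpace ℝ (Fin d) × ℝ → ℂ) → EuclideanSpace ℝ (Fin d) × ℝ → ℂ) : Prop :=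
  ∃ K : EuclideanSpace ℝ (Fin d) × ℝ → EuclideanSpace ℝ (Fin d) × (Fin 2 → ℝ) → ℂ,
    IsCtauCinftyKernel τ (halfSpace d) K ∧
    ∀ u : EuclideanSpace ℝ (Fin d) × ℝ → ℂ, IsSchwartzOn (halfSpace d) u →
      ∀ x ∈ halfSpace d,
        A u x = ∫ w', ∫ w in Ioi (0 : ℝ), K x (x.1 - w', ![x.2, w]) * u (w', w)

end NonsmoothGreen

end

open NonsmoothGreen

/-! Write z' for x' minus the integration variable. Formally each operator has the kernel K(x, z',
Y) = W(x', z', Y) · (F⁻¹h)(x, z', Y). Here F⁻¹h (`fiberInv`) is the inverse Fourier transform of the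
symbol-kernel in ξ', and W is the product of the two cutoffs, for instance φ(x', Y) ψ(x' - z') for
Poisson operators. The normal variable of φ is read as the variable Y, so W depends on x through x'
only. Disjointness of the supports says that for each x' the function W(x', ·) vanishes near (z', Y)
= 0, which is the only place where F⁻¹h can be singular.

Two facts make K smoothing. First, multiplication of F⁻¹h by z_i or by Y_j lowers the order of the
symbol by one: z_i becomes i∂_{ξ_i} by integration by parts (`SymClass.fiberInv_pd_dirZ`), and Y_j
is built into the symbol estimates. Second, Hadamard's lemma (`IsCutoff.eq_sum_avg`) writes W = ∑
z_i W_i + ∑ Y_j W_j, where the W_i and W_j are averages of derivatives of W along segments from 0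
and are cutoffs of the same kind. Hence W F⁻¹h is a sum of terms of the same form and of order lower
by one (`KernelClass.exists_lower`), and this can be iterated. The supports may come arbitrarily
close at infinity, so dividing by a power of |(z', Y)| would give no uniform bound. Hadamard's
coefficients are bounded with all derivatives whatever the distance.

At very negative order the integral over ξ' converges absolutely in C^τ. Pointwise bounds in Y come
from the L² bounds by a Sobolev-type averaging formula (`SymClass.exists_bound`). It costs a fixed
number of orders, which is harmless because the order can be lowered at will. Derivatives in z' or Y
raise the order by one and coordinates lower it or can be treated without raising it, so functions
that have representations of every order (`IsSmoothingKernel`) form a class closed under derivatives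
and coordinates, and all seminorms are finite (`IsSmoothingKernel.isCtauCinftyKernel`).

At Y = 0 the integral defining F⁻¹h may diverge, whereas for Y ≠ 0 it converges at every order,
powers of Y_j giving decay in ξ'. The representations of different orders are therefore compared on
Y ≠ 0 and extended by continuity (`exists_smoothingKernel`). The operators are finally rewritten
with K by Fubini's theorem, plus one more limit x_n → 0 in the Poisson case. -/

noncomputable section

namespace NonsmoothGreen

open MeasureTheory Set Filter Topology

/-! ### Integrals depending on a parameter in a convex set -/

/-- Differentiation under the integral sign within a convex set. -/
theorem hasFDerivWithinAt_integral_of_convex {Ω E F : Type*} [MeasurableSpace Ω] {μ : Measure Ω}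
    [NormedAddCommGroup E] [NormedSpace ℝ E] [NormedAddCommGroup F] [NormedSpace ℝ F]
    {s : Set E} (hs : Convex ℝ s) {f : Ω → E → F} {f' : Ω → E → E →L[ℝ] F} {B : Ω → ℝ} {x₀ : E}
    (hx₀ : x₀ ∈ s) (hf : ∀ x ∈ s, Integrable (fun a => f a x) μ)
    (hf' : AEStronglyMeasurable (fun a => f' a x₀) μ)
    (hd : ∀ a, ∀ x ∈ s, HasFDerivWithinAt (f a) (f' a x) s x)
    (hB : ∀ a, ∀ x ∈ s, ‖f' a x‖ ≤ B a) (hBi : Integrable B μ) :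
    HasFDerivWithinAt (fun x => ∫ a, f a x ∂μ) (∫ a, f' a x₀ ∂μ) s x₀ := by
  have hf'i : Integrable (fun a => f' a x₀) μ :=
    hBi.mono' hf' (Eventually.of_forall fun a => hB a x₀ hx₀)
  by_cases hF : CompleteSpace F
  swap
  -- For an incomplete target the Bochner integral is 0 by convention, and the claim is trivial.
  · have h0 : ∀ x, (∫ a, f a x ∂μ) = 0 := fun x => by simp [integral, hF]
    have h1 : (∫ a, f' a x₀ ∂μ) = 0 := by
      by_cases hE : CompleteSpace (E →L[ℝ] F)
      · ext v
        rw [ContinuousLinearMap.integral_apply hf'i]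
        simp [integral, hF]
      · simp [integral, hE]
    simp only [h0, h1]
    exact hasFDerivWithinAt_const _ _ _
  -- Dominated convergence for the normalized Taylor remainders. Convexity enters through the mean
  -- value inequality, which bounds the increment of f by B a, and the linear term contributes
  -- another B a.
  have key : Tendsto (fun x => ∫ a, ‖x - x₀‖⁻¹ • (f a x - f a x₀ - f' a x₀ (x - x₀)) ∂μ)
      (𝓝[s] x₀) (𝓝 (∫ _, (0 : F) ∂μ)) := by
    refine tendsto_integral_filter_of_dominated_convergence (fun a => 2 * B a) ?_ ?_
      (hBi.const_mul 2) ?_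
    · filter_upwards [self_mem_nhdsWithin] with x hx
      exact ((((hf x hx).sub (hf x₀ hx₀)).aestronglyMeasurable).sub
        (hf'.apply_continuousLinearMap _)).const_smul _
    · filter_upwards [self_mem_nhdsWithin] with x hx
      refine Eventually.of_forall fun a => ?_
      have h1 : ‖f a x - f a x₀‖ ≤ B a * ‖x - x₀‖ :=
        hs.norm_image_sub_le_of_norm_hasFDerivWithin_le (hd a) (hB a) hx₀ hx
      have h2 : ‖f' a x₀ (x - x₀)‖ ≤ B a * ‖x - x₀‖ :=
        (ContinuousLinearMap.le_opNorm _ _).trans (by gcongr; exact hB a x₀ hx₀)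
      have h3 : 0 ≤ B a := (norm_nonneg _).trans (hB a x₀ hx₀)
      rw [norm_smul, norm_inv, norm_norm]
      rcases eq_or_ne (‖x - x₀‖) 0 with h | h
      · simp only [h, inv_zero, zero_mul]; positivity
      · rw [inv_mul_le_iff₀ (by positivity)]
        calc _ ≤ ‖f a x - f a x₀‖ + ‖f' a x₀ (x - x₀)‖ := norm_sub_le _ _
          _ ≤ ‖x - x₀‖ * (2 * B a) := by linarith
    · refine Eventually.of_forall fun a => ?_
      have := (hasFDerivWithinAt_iff_tendsto.1 (hd a x₀ hx₀))
      rw [tendsto_zero_iff_norm_tendsto_zero]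
      refine this.congr fun x => ?_
      rw [norm_smul, norm_inv, norm_norm]
  rw [hasFDerivWithinAt_iff_tendsto]
  rw [integral_zero, tendsto_zero_iff_norm_tendsto_zero] at key
  refine (tendsto_congr' ?_).1 key
  filter_upwards [self_mem_nhdsWithin] with x hx
  have e1 : ∫ a, f a x - f a x₀ - f' a x₀ (x - x₀) ∂μ
      = ∫ a, f a x - f a x₀ ∂μ - ∫ a, f' a x₀ (x - x₀) ∂μ :=
    integral_sub ((hf x hx).sub (hf x₀ hx₀)) (hf'i.apply_continuousLinearMap _)
  rw [integral_smul, norm_smul, norm_inv, norm_norm, e1, integral_sub (hf x hx) (hf x₀ hx₀),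
    ContinuousLinearMap.integral_apply hf'i]

/-! ### Hölder bounds -/

/-- `HolderBound` with the integer part `r` and the fractional part `θ` of the exponent as separate
arguments. -/
structure HolderCtrl {E F : Type*} [NormedAddCommGroup E] [NormedSpace ℝ E]
    [NormedAddCommGroup F] [NormedSpace ℝ F]
    (r : ℕ) (θ : ℝ) (U : Set E) (f : E → F) (C : ℝ) : Prop where
  contDiffOn : ContDiffOn ℝ r f U
  bound : ∀ j : ℕ, j ≤ r → ∀ x ∈ U, ‖iteratedFDerivWithin ℝ j f U x‖ ≤ C
  holder : ∀ x ∈ U, ∀ y ∈ U,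
    ‖iteratedFDerivWithin ℝ r f U x - iteratedFDerivWithin ℝ r f U y‖ ≤ C * ‖x - y‖ ^ θ

/-- With r and θ decoupled, induction on r can keep θ fixed, and θ = 0 becomes available for mere
boundedness of derivatives. -/
theorem holderBound_iff {E F : Type*} [NormedAddCommGroup E] [NormedSpace ℝ E]
    [NormedAddCommGroup F] [NormedSpace ℝ F] {τ : ℝ} {U : Set E} {f : E → F} {C : ℝ} :
    HolderBound τ U f C ↔ HolderCtrl ⌊τ⌋₊ (τ - (⌊τ⌋₊ : ℝ)) U f C :=
  ⟨fun h => ⟨h.1, h.2, h.3⟩, fun h => ⟨h.1, h.2, h.3⟩⟩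

/-- Convex sets with unique differentiation that are invariant under translation along the
nonnegative multiples of spanning directions. -/
structure IsCornerDomain {E : Type*} [NormedAddCommGroup E] [NormedSpace ℝ E] (U : Set E) :
    Prop where
  convex : Convex ℝ U
  uniqueDiffOn : UniqueDiffOn ℝ U
  span : ⊤ ≤ Submodule.span ℝ {v : E | ∀ x ∈ U, ∀ t : ℝ, 0 ≤ t → x + t • v ∈ U}

namespace HolderCtrl

variable {E F G H : Type} [NormedAddCommGroup E] [NormedSpace ℝ E]
  [NormedAddCommGroup F] [NormedSpace ℝ F] [NormedAddCommGroup G] [NormedSpace ℝ G]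
  [NormedAddCommGroup H] [NormedSpace ℝ H]
  {r : ℕ} {θ : ℝ} {U : Set E} {f g : E → F} {C D : ℝ}

theorem norm_le (h : HolderCtrl r θ U f C) {x : E} (hx : x ∈ U) : ‖f x‖ ≤ C := by
  simpa using h.bound 0 (Nat.zero_le _) x hx

theorem mono (h : HolderCtrl r θ U f C) (hCD : C ≤ D) : HolderCtrl r θ U f D :=
  ⟨h.1, fun j hj x hx => (h.2 j hj x hx).trans hCD, fun x hx y hy => (h.3 x hx y hy).trans (by
    gcongr)⟩

theorem congr (h : HolderCtrl r θ U f C) (hfg : EqOn g f U) : HolderCtrl r θ U g C := by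
  refine ⟨h.1.congr hfg, fun j hj x hx => ?_, fun x hx y hy => ?_⟩
  · rw [iteratedFDerivWithin_congr hfg hx]; exact h.2 j hj x hx
  · rw [iteratedFDerivWithin_congr hfg hx, iteratedFDerivWithin_congr hfg hy]; exact h.3 x hx y hy

theorem norm_iteratedFDerivWithin_succ_sub (hU : UniqueDiffOn ℝ U) {x y : E} (hx : x ∈ U)
    (hy : y ∈ U) :
    ‖iteratedFDerivWithin ℝ (r + 1) f U x - iteratedFDerivWithin ℝ (r + 1) f U y‖ =
      ‖iteratedFDerivWithin ℝ r (fderivWithin ℝ f U) U x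
        - iteratedFDerivWithin ℝ r (fderivWithin ℝ f U) U y‖ := by
  rw [iteratedFDerivWithin_succ_eq_comp_right hU hx, iteratedFDerivWithin_succ_eq_comp_right hU hy,
    ← dist_eq_norm, ← dist_eq_norm]
  exact LinearIsometryEquiv.dist_map _ _ _

/-- This drives every induction on r below. The target changes from F to E →L[ℝ] F, so those
inductions must be uniform in the target space. -/
theorem succ_iff (hU : UniqueDiffOn ℝ U) :
    HolderCtrl (r + 1) θ U f C ↔ (∀ x ∈ U, ‖f x‖ ≤ C) ∧ DifferentiableOn ℝ f U ∧
      HolderCtrl r θ U (fderivWithin ℝ f U) C := by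
  constructor
  · intro h
    have h1 := h.1
    rw [Nat.cast_add, Nat.cast_one, contDiffOn_succ_iff_fderivWithin hU] at h1
    refine ⟨fun x hx => h.norm_le hx, h1.1, h1.2.2, fun j hj x hx => ?_, fun x hx y hy => ?_⟩
    · rw [norm_iteratedFDerivWithin_fderivWithin hU hx]
      exact h.2 (j + 1) (by omega) x hx
    · rw [← norm_iteratedFDerivWithin_succ_sub hU hx hy]
      exact h.3 x hx y hy
  · rintro ⟨h0, h1, h2⟩
    refine ⟨?_, fun j hj x hx => ?_, fun x hx y hy => ?_⟩
    · rw [Nat.cast_add, Nat.cast_one, contDiffOn_succ_iff_fderivWithin hU]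
      exact ⟨h1, by simp, h2.1⟩
    · cases j with
      | zero => simpa using h0 x hx
      | succ j =>
        rw [← norm_iteratedFDerivWithin_fderivWithin hU hx]
        exact h2.2 j (by omega) x hx
    · rw [norm_iteratedFDerivWithin_succ_sub hU hx hy]
      exact h2.3 x hx y hy

theorem zero_iff : HolderCtrl 0 θ U f C ↔ ContinuousOn f U ∧ (∀ x ∈ U, ‖f x‖ ≤ C) ∧
    ∀ x ∈ U, ∀ y ∈ U, ‖f x - f y‖ ≤ C * ‖x - y‖ ^ θ := by
  have e : ∀ x y, ‖iteratedFDerivWithin ℝ 0 f U x - iteratedFDerivWithin ℝ 0 f U y‖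
      = ‖f x - f y‖ := fun x y => by
    rw [iteratedFDerivWithin_zero_eq_comp, Function.comp_apply, Function.comp_apply, ← map_sub,
      LinearIsometryEquiv.norm_map]
  constructor
  · intro h
    exact ⟨h.1.continuousOn, fun x hx => h.norm_le hx, fun x hx y hy => e x y ▸ h.3 x hx y hy⟩
  · rintro ⟨h0, h1, h2⟩
    refine ⟨by simpa using h0, fun j hj x hx => ?_, fun x hx y hy => (e x y).symm ▸ h2 x hx y hy⟩
    obtain rfl : j = 0 := by omega
    simpa using h1 x hx

theorem add (hU : UniqueDiffOn ℝ U) (hf : HolderCtrl r θ U f C) (hg : HolderCtrl r θ U g D) :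
    HolderCtrl r θ U (fun x => f x + g x) (C + D) := by
  have e : ∀ j ≤ r, ∀ x ∈ U, iteratedFDerivWithin ℝ j (fun x => f x + g x) U x
      = iteratedFDerivWithin ℝ j f U x + iteratedFDerivWithin ℝ j g U x := fun j hj x hx =>
    iteratedFDerivWithin_add_apply ((hf.1.of_le (by exact_mod_cast hj)) x hx)
      ((hg.1.of_le (by exact_mod_cast hj)) x hx) hU hx
  refine ⟨hf.1.add hg.1, fun j hj x hx => ?_, fun x hx y hy => ?_⟩
  · rw [e j hj x hx]
    exact norm_add_le_of_le (hf.2 j hj x hx) (hg.2 j hj x hx)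
  · rw [e r le_rfl x hx, e r le_rfl y hy, add_sub_add_comm, add_mul]
    exact norm_add_le_of_le (hf.3 x hx y hy) (hg.3 x hx y hy)

theorem clm_comp (hU : UniqueDiffOn ℝ U) (hf : HolderCtrl r θ U f C) (L : F →L[ℝ] G) :
    HolderCtrl r θ U (fun x => L (f x)) (‖L‖ * C) := by
  have e : ∀ j ≤ r, ∀ x ∈ U, iteratedFDerivWithin ℝ j (fun x => L (f x)) U x
      = L.compContinuousMultilinearMap (iteratedFDerivWithin ℝ j f U x) := fun j hj x hx =>
    L.iteratedFDerivWithin_comp_left (hf.1 x hx) hU hx (by exact_mod_cast hj)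
  refine ⟨L.contDiff.comp_contDiffOn hf.1, fun j hj x hx => ?_, fun x hx y hy => ?_⟩
  · rw [e j hj x hx]
    exact (L.norm_compContinuousMultilinearMap_le _).trans (by gcongr; exact hf.2 j hj x hx)
  · have e2 : L.compContinuousMultilinearMap (iteratedFDerivWithin ℝ r f U x)
        - L.compContinuousMultilinearMap (iteratedFDerivWithin ℝ r f U y)
        = L.compContinuousMultilinearMap
          (iteratedFDerivWithin ℝ r f U x - iteratedFDerivWithin ℝ r f U y) := by
      ext v; simp
    rw [e r le_rfl x hx, e r le_rfl y hy, e2, mul_assoc]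
    exact (L.norm_compContinuousMultilinearMap_le _).trans (by gcongr; exact hf.3 x hx y hy)

/-- A bounded function with bounded derivative on a convex set is Hölder continuous. -/
theorem norm_sub_le_of_fderivWithin (hU : Convex ℝ U) (h0 : 0 ≤ θ) (h1 : θ ≤ 1)
    (hf : DifferentiableOn ℝ f U) (hb : ∀ x ∈ U, ‖f x‖ ≤ C)
    (hb' : ∀ x ∈ U, ‖fderivWithin ℝ f U x‖ ≤ C) {x y : E} (hx : x ∈ U) (hy : y ∈ U) :
    ‖f x - f y‖ ≤ 2 * C * ‖x - y‖ ^ θ := by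
  have hC : 0 ≤ C := (norm_nonneg _).trans (hb x hx)
  rcases eq_or_ne x y with rfl | hxy
  · simp only [sub_self, norm_zero]; positivity
  have hpos : 0 < ‖x - y‖ := norm_pos_iff.2 (sub_ne_zero.2 hxy)
  rcases le_total (‖x - y‖) 1 with h | h
  · have : ‖f x - f y‖ ≤ C * ‖x - y‖ := hU.norm_image_sub_le_of_norm_fderivWithin_le hf hb' hy hx
    have h2 : ‖x - y‖ ≤ ‖x - y‖ ^ θ := by
      simpa using Real.rpow_le_rpow_of_exponent_ge hpos h h1
    have h3 : 0 ≤ ‖x - y‖ ^ θ := by positivity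
    nlinarith
  · have h2 : 1 ≤ ‖x - y‖ ^ θ := Real.one_le_rpow h h0
    have h3 := norm_sub_le_of_le (hb x hx) (hb y hy)
    nlinarith

/-- A bounded derivative of order r + 1 gives any Hölder exponent in [0, 1] at order r: the mean
value inequality is used at distance at most 1 and the sup bound beyond, whence the factor 2. The
exponent θ' plays no role, only the sup bounds do. -/
theorem of_succ (hUc : Convex ℝ U) (hU : UniqueDiffOn ℝ U) (h0 : 0 ≤ θ) (h1 : θ ≤ 1) :
    ∀ {r : ℕ} {F : Type} [NormedAddCommGroup F] [NormedSpace ℝ F] {f : E → F} {C θ' : ℝ},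
      HolderCtrl (r + 1) θ' U f C → 0 ≤ C → HolderCtrl r θ U f (2 * C) := by
  intro r
  induction r with
  | zero =>
    intro F _ _ f C θ' h hC
    rw [succ_iff hU] at h
    rw [zero_iff]
    refine ⟨h.2.1.continuousOn, fun x hx => (h.1 x hx).trans (by linarith), fun x hx y hy =>
      norm_sub_le_of_fderivWithin hUc h0 h1 h.2.1 h.1 (fun x hx => h.2.2.norm_le hx) hx hy⟩
  | succ r ih =>
    intro F _ _ f C θ' h hC
    rw [succ_iff hU] at h ⊢
    exact ⟨fun x hx => (h.1 x hx).trans (by linarith), h.2.1, ih h.2.2 hC⟩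

/-- Bounded bilinear maps preserve Hölder bounds. -/
theorem exists_bilin (hUc : Convex ℝ U) (hU : UniqueDiffOn ℝ U) (h0 : 0 ≤ θ) (h1 : θ ≤ 1) (r : ℕ) :
    ∃ c : ℝ, 0 ≤ c ∧ ∀ {F G H : Type} [NormedAddCommGroup F] [NormedSpace ℝ F]
      [NormedAddCommGroup G] [NormedSpace ℝ G] [NormedAddCommGroup H] [NormedSpace ℝ H]
      (B : F →L[ℝ] G →L[ℝ] H) {f : E → F} {g : E → G} {C D : ℝ}, 0 ≤ C → 0 ≤ D →
      HolderCtrl r θ U f C → HolderCtrl r θ U g D →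
      HolderCtrl r θ U (fun x => B (f x) (g x)) (c * ‖B‖ * C * D) := by
  induction r with
  | zero =>
    refine ⟨2, by norm_num, ?_⟩
    intro F G H _ _ _ _ _ _ B f g C D hC hD hf hg
    rw [zero_iff] at hf hg ⊢
    refine ⟨(B.continuous.comp_continuousOn hf.1).clm_apply hg.1, fun x hx => ?_,
      fun x hx y hy => ?_⟩
    · refine (B.le_opNorm₂ _ _).trans ?_
      have : ‖B‖ * ‖f x‖ * ‖g x‖ ≤ ‖B‖ * C * D := by
        gcongr
        · exact hf.2.1 x hx
        · exact hg.2.1 x hx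
      have h3 : 0 ≤ ‖B‖ * C * D := by positivity
      linarith
    · have e : B (f x) (g x) - B (f y) (g y) = B (f x) (g x - g y) + B (f x - f y) (g y) := by
        simp
      have hθ : 0 ≤ ‖x - y‖ ^ θ := by positivity
      have a1 : ‖B (f x) (g x - g y)‖ ≤ ‖B‖ * C * (D * ‖x - y‖ ^ θ) := by
        refine (B.le_opNorm₂ _ _).trans ?_
        gcongr
        · exact hf.2.1 x hx
        · exact hg.2.2 x hx y hy
      have a2 : ‖B (f x - f y) (g y)‖ ≤ ‖B‖ * (C * ‖x - y‖ ^ θ) * D := by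
        refine (B.le_opNorm₂ _ _).trans ?_
        gcongr
        · exact hf.2.2 x hx y hy
        · exact hg.2.1 y hy
      rw [e]
      refine (norm_add_le_of_le a1 a2).trans (le_of_eq ?_)
      ring
  | succ r ih =>
    obtain ⟨c, hc, ih⟩ := ih
    -- Each of the two terms of the product rule costs c, times the 2 from `of_succ` for its
    -- undifferentiated factor. The extra 1 pays for the sup norm of the product itself.
    refine ⟨4 * c + 1, by positivity, ?_⟩
    intro F G H _ _ _ _ _ _ B f g C D hC hD hf hg
    have hf' := hf.of_succ hUc hU h0 h1 hC
    have hg' := hg.of_succ hUc hU h0 h1 hD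
    rw [succ_iff hU] at hf hg ⊢
    refine ⟨fun x hx => ?_, fun x hx => ?_, ?_⟩
    · have : ‖B‖ * ‖f x‖ * ‖g x‖ ≤ ‖B‖ * C * D := by
        gcongr
        · exact hf.1 x hx
        · exact hg.1 x hx
      have h3 : 0 ≤ c * ‖B‖ * C * D := by positivity
      exact (B.le_opNorm₂ _ _).trans (by linarith)
    · exact (B.hasFDerivWithinAt_of_bilinear (hf.2.1 x hx).hasFDerivWithinAt
        (hg.2.1 x hx).hasFDerivWithinAt).differentiableWithinAt
    · have k1 := ih (B.precompR E) (by positivity) hD hf' hg.2.2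
      have k2 := ih (B.precompL E) hC (by positivity) hf.2.2 hg'
      refine ((k1.add hU k2).mono ?_).congr fun x hx => ?_
      · have m1 := mul_le_mul_of_nonneg_left (B.norm_precompR_le E)
          (show 0 ≤ c * (2 * C) * D by positivity)
        have m2 := mul_le_mul_of_nonneg_left (B.norm_precompL_le E)
          (show 0 ≤ c * C * (2 * D) by positivity)
        have h3 : 0 ≤ ‖B‖ * C * D := by positivity
        linarith
      · exact B.fderivWithin_of_bilinear (hf.2.1 x hx) (hg.2.1 x hx) (hU x hx)

end HolderCtrl

/-! ### Half-spaces, orthants and their products as corner domains -/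

namespace IsCornerDomain

variable {E F : Type*} [NormedAddCommGroup E] [NormedSpace ℝ E]
  [NormedAddCommGroup F] [NormedSpace ℝ F]

theorem univ : IsCornerDomain (univ : Set E) :=
  ⟨convex_univ, uniqueDiffOn_univ, by simp⟩

theorem prod {U : Set E} {V : Set F} (hU : IsCornerDomain U) (hV : IsCornerDomain V) :
    IsCornerDomain (U ×ˢ V) := by
  refine ⟨hU.1.prod hV.1, hU.2.prod hV.2, ?_⟩
  rintro ⟨a, b⟩ -
  have ha : (a, (0 : F)) ∈ Submodule.span ℝ
      {v : E × F | ∀ x ∈ U ×ˢ V, ∀ t : ℝ, 0 ≤ t → x + t • v ∈ U ×ˢ V} := by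
    have h := Submodule.mem_map_of_mem (f := LinearMap.inl ℝ E F) (hU.3 (Submodule.mem_top (x := a)))
    rw [Submodule.map_span] at h
    refine Submodule.span_mono ?_ h
    rintro _ ⟨v, hv, rfl⟩ x hx t ht
    exact ⟨by simpa using hv x.1 hx.1 t ht, by simpa using hx.2⟩
  have hb : ((0 : E), b) ∈ Submodule.span ℝ
      {v : E × F | ∀ x ∈ U ×ˢ V, ∀ t : ℝ, 0 ≤ t → x + t • v ∈ U ×ˢ V} := by
    have h := Submodule.mem_map_of_mem (f := LinearMap.inr ℝ E F) (hV.3 (Submodule.mem_top (x := b)))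
    rw [Submodule.map_span] at h
    refine Submodule.span_mono ?_ h
    rintro _ ⟨v, hv, rfl⟩ x hx t ht
    exact ⟨by simpa using hx.1, by simpa using hv x.2 hx.2 t ht⟩
  simpa using Submodule.add_mem _ ha hb

theorem Ici : IsCornerDomain (Ici (0 : ℝ)) := by
  refine ⟨convex_Ici 0, uniqueDiffOn_Ici 0, ?_⟩
  rintro a -
  rw [show a = a • (1 : ℝ) by simp]
  refine Submodule.smul_mem _ _ (Submodule.subset_span fun x hx t ht => ?_)
  simp only [mem_Ici, smul_eq_mul, mul_one] at *
  positivity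

theorem orthant (q : ℕ) : IsCornerDomain (orthant q) := by
  have e : NonsmoothGreen.orthant q = Set.univ.pi fun _ => Set.Ici (0 : ℝ) := by
    ext Y; simp [NonsmoothGreen.orthant, Pi.le_def]
  refine ⟨e ▸ convex_pi fun _ _ => convex_Ici 0,
    e ▸ UniqueDiffOn.univ_pi fun _ => uniqueDiffOn_Ici 0, ?_⟩
  rintro a -
  rw [pi_eq_sum_univ' a]
  refine Submodule.sum_mem _ fun i _ => Submodule.smul_mem _ _
    (Submodule.subset_span fun x hx t ht j => ?_)
  have := hx j
  by_cases h : i = j <;> simp [h] <;> positivity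

theorem halfSpace (d : ℕ) : IsCornerDomain (halfSpace d) := by
  have e : NonsmoothGreen.halfSpace d = Set.univ ×ˢ Set.Ici (0 : ℝ) := by
    ext; simp [NonsmoothGreen.halfSpace]
  exact e ▸ univ.prod Ici

theorem domVY (d q : ℕ) : IsCornerDomain (domVY d q) := univ.prod (orthant q)

end IsCornerDomain

/-! ### Hölder bounds of parameter integrals -/

/-- Difference quotients along inward directions use only values at points of U, hence are
measurable in the parameter, and they converge to directional derivatives. Since inward directions
span, finitely many of them determine the whole derivative. This is the purpose of the spanning
condition in `IsCornerDomain`. -/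
theorem aestronglyMeasurable_fderivWithin {Ω E F : Type*} [MeasurableSpace Ω] {μ : Measure Ω}
    [NormedAddCommGroup E] [NormedSpace ℝ E] [FiniteDimensional ℝ E] [NormedAddCommGroup F]
    [NormedSpace ℝ F] {U : Set E} (hU : IsCornerDomain U) {f : Ω → E → F}
    (hd : ∀ a, DifferentiableOn ℝ (f a) U)
    (hm : ∀ x ∈ U, AEStronglyMeasurable (fun a => f a x) μ) {x : E} (hx : x ∈ U) :
    AEStronglyMeasurable (fun a => fderivWithin ℝ (f a) U x) μ := by
  set b := Module.Basis.ofSpan hU.span with hb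
  have : Fintype _ := FiniteDimensional.fintypeBasisIndex b
  have hv : ∀ i, AEStronglyMeasurable (fun a => fderivWithin ℝ (f a) U x (b i)) μ := by
    intro i
    have hi := Module.Basis.ofSpan_subset hU.span (mem_range_self i)
    have hmem : ∀ n : ℕ, x + ((n : ℝ) + 1)⁻¹ • b i ∈ U := fun n => hi x hx _ (by positivity)
    refine aestronglyMeasurable_of_tendsto_ae (u := atTop)
      (f := fun (n : ℕ) a => ((n : ℝ) + 1) • (f a (x + ((n : ℝ) + 1)⁻¹ • b i) - f a x))
      (fun n => ((hm _ (hmem n)).sub (hm x hx)).const_smul _) (Eventually.of_forall fun a => ?_)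
    refine (hd a x hx).hasFDerivWithinAt.lim ?_ (Eventually.of_forall hmem) ?_
    · have h0 : Tendsto (fun n : ℕ => ((n : ℝ) + 1)⁻¹) atTop (𝓝 0) := tendsto_inv_atTop_zero.comp
        (tendsto_atTop_add_const_right _ _ tendsto_natCast_atTop_atTop)
      simpa using h0.smul_const (b i)
    · refine tendsto_const_nhds.congr fun n => ?_
      rw [smul_smul, mul_inv_cancel₀ (by positivity), one_smul]
  have e : ∀ a, fderivWithin ℝ (f a) U x = ∑ i, ContinuousLinearMap.smulRightL ℝ E F
      (LinearMap.toContinuousLinearMap (b.coord i)) (fderivWithin ℝ (f a) U x (b i)) := by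
    intro a
    ext v
    conv_lhs => rw [← b.sum_repr v, map_sum]
    simp
  rw [funext e]
  exact Finset.aestronglyMeasurable_fun_sum _ fun i _ =>
    (ContinuousLinearMap.continuous _).comp_aestronglyMeasurable (hv i)

namespace HolderCtrl

variable {E : Type} [NormedAddCommGroup E] [NormedSpace ℝ E] {U : Set E} {θ : ℝ}

theorem const {F : Type} [NormedAddCommGroup F] [NormedSpace ℝ F] (hU : UniqueDiffOn ℝ U)
    (r : ℕ) (c : F) : HolderCtrl r θ U (fun _ => c) ‖c‖ := by
  induction r generalizing F with
  | zero =>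
    rw [zero_iff]
    exact ⟨continuousOn_const, fun x _ => le_rfl, fun x _ y _ => by
      rw [sub_self, norm_zero]; positivity⟩
  | succ r ih =>
    rw [succ_iff hU]
    refine ⟨fun x _ => le_rfl, differentiableOn_const _, ?_⟩
    refine ((ih (0 : E →L[ℝ] F)).mono (by simp)).congr fun x hx => ?_
    simp

/-- Minkowski's inequality for Hölder norms: one integrable B dominates all derivatives and Hölder
quotients at once, so differentiation under the integral sign can be repeated r times. -/
theorem integral [FiniteDimensional ℝ E] (hU : IsCornerDomain U) {Ω : Type*} [MeasurableSpace Ω]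
    {μ : Measure Ω} {B : Ω → ℝ} (hB : Integrable B μ) {F : Type} [NormedAddCommGroup F]
    [NormedSpace ℝ F] [CompleteSpace F] {r : ℕ} {f : Ω → E → F}
    (hf : ∀ a, HolderCtrl r θ U (f a) (B a))
    (hm : ∀ x ∈ U, AEStronglyMeasurable (fun a => f a x) μ) :
    HolderCtrl r θ U (fun x => ∫ a, f a x ∂μ) (∫ a, B a ∂μ) := by
  induction r generalizing F with
  | zero =>
    have hf0 := fun a => zero_iff.1 (hf a)
    have hi : ∀ x ∈ U, Integrable (fun a => f a x) μ := fun x hx =>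
      hB.mono' (hm x hx) (Eventually.of_forall fun a => (hf0 a).2.1 x hx)
    rw [zero_iff]
    refine ⟨continuousOn_of_dominated hm (fun x hx => Eventually.of_forall fun a =>
      (hf0 a).2.1 x hx) hB (Eventually.of_forall fun a => (hf0 a).1), fun x hx =>
      norm_integral_le_of_norm_le hB (Eventually.of_forall fun a => (hf0 a).2.1 x hx),
      fun x hx y hy => ?_⟩
    rw [← integral_sub (hi x hx) (hi y hy), ← integral_mul_const]
    exact norm_integral_le_of_norm_le (hB.mul_const _)
      (Eventually.of_forall fun a => (hf0 a).2.2 x hx y hy)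
  | succ r ih =>
    have hf0 := fun a => (succ_iff hU.2).1 (hf a)
    have hi : ∀ x ∈ U, Integrable (fun a => f a x) μ := fun x hx =>
      hB.mono' (hm x hx) (Eventually.of_forall fun a => (hf0 a).1 x hx)
    have hm' : ∀ x ∈ U, AEStronglyMeasurable (fun a => fderivWithin ℝ (f a) U x) μ :=
      fun x hx => aestronglyMeasurable_fderivWithin hU (fun a => (hf0 a).2.1) hm hx
    have hd : ∀ x ∈ U, HasFDerivWithinAt (fun x => ∫ a, f a x ∂μ)
        (∫ a, fderivWithin ℝ (f a) U x ∂μ) U x := fun x hx =>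
      hasFDerivWithinAt_integral_of_convex hU.1 hx hi (hm' x hx)
        (fun a y hy => ((hf0 a).2.1 y hy).hasFDerivWithinAt)
        (fun a y hy => (hf0 a).2.2.norm_le hy) hB
    rw [succ_iff hU.2]
    refine ⟨fun x hx => norm_integral_le_of_norm_le hB (Eventually.of_forall fun a =>
      (hf0 a).1 x hx), fun x hx => (hd x hx).differentiableWithinAt, ?_⟩
    exact (ih (fun a => (hf0 a).2.2) hm').congr fun x hx => (hd x hx).fderivWithin (hU.2 x hx)

-- On the exceptional null set f and B are replaced by 0, for which the Hölder bound holds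
-- trivially.
open Classical in
theorem integral_of_ae [FiniteDimensional ℝ E] (hU : IsCornerDomain U) {Ω : Type*}
    [MeasurableSpace Ω] {μ : Measure Ω} {B : Ω → ℝ} (hB : Integrable B μ) {F : Type}
    [NormedAddCommGroup F] [NormedSpace ℝ F] [CompleteSpace F] {r : ℕ} {f : Ω → E → F}
    (hf : ∀ᵐ a ∂μ, HolderCtrl r θ U (f a) (B a))
    (hm : ∀ x ∈ U, AEStronglyMeasurable (fun a => f a x) μ) :
    HolderCtrl r θ U (fun x => ∫ a, f a x ∂μ) (∫ a, B a ∂μ) := by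
  set P : Ω → Prop := fun a => HolderCtrl r θ U (f a) (B a)
  have e1 : ∀ x, (fun a => f a x) =ᵐ[μ] fun a => if P a then f a x else 0 := fun x => by
    filter_upwards [hf] with a ha
    rw [if_pos ha]
  have e2 : B =ᵐ[μ] fun a => if P a then B a else 0 := by
    filter_upwards [hf] with a ha
    rw [if_pos ha]
  have h := integral (θ := θ) (r := r) hU (hB.congr e2)
    (f := fun a x => if P a then f a x else 0) (fun a => ?_) fun x hx => (hm x hx).congr (e1 x)
  · rw [← integral_congr_ae e2] at h
    exact h.congr fun x _ => integral_congr_ae (e1 x)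
  · by_cases ha : P a
    · simpa only [if_pos ha] using ha
    · simpa only [if_neg ha, norm_zero] using const (θ := θ) hU.2 r (0 : F)

/-- Composition with an affine map; the constant does not depend on the translation. -/
theorem comp_affine {E' : Type} [NormedAddCommGroup E'] [NormedSpace ℝ E'] {V : Set E'}
    (hU : UniqueDiffOn ℝ U) (hV : UniqueDiffOn ℝ V) (L : E →L[ℝ] E') (c : E')
    (hm : MapsTo (fun x => L x + c) U V) {F : Type} [NormedAddCommGroup F] [NormedSpace ℝ F]
    {r : ℕ} {f : E' → F} {C : ℝ} (hC : 0 ≤ C) (hf : HolderCtrl r 0 V f C) :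
    HolderCtrl r 0 U (fun x => f (L x + c)) (C * (1 + ‖L‖) ^ r) := by
  have hA : ∀ x, HasFDerivWithinAt (fun x => L x + c) L U x := fun x =>
    (L.hasFDerivWithinAt).add_const c
  induction r generalizing F with
  | zero =>
    rw [zero_iff] at hf ⊢
    refine ⟨hf.1.comp (by fun_prop) hm, fun x hx => by simpa using hf.2.1 _ (hm hx),
      fun x hx y hy => by simpa using hf.2.2 _ (hm hx) _ (hm hy)⟩
  | succ r ih =>
    rw [succ_iff hV] at hf
    rw [succ_iff hU]
    have hd : ∀ x ∈ U, HasFDerivWithinAt (fun x => f (L x + c))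
        ((fderivWithin ℝ f V (L x + c)).comp L) U x := fun x hx =>
      ((hf.2.1 _ (hm hx)).hasFDerivWithinAt).comp x (hA x) hm
    have h1 : 1 ≤ (1 + ‖L‖) ^ (r + 1) := one_le_pow₀ (by linarith [norm_nonneg L])
    refine ⟨fun x hx => (hf.1 _ (hm hx)).trans (by nlinarith), fun x hx =>
      (hd x hx).differentiableWithinAt, ?_⟩
    -- By the chain rule each differentiation composes with L on the right, at the price of a factor
    -- ‖L‖.
    have h2 := (ih hf.2.2).clm_comp hU ((ContinuousLinearMap.compL ℝ E E' F).flip L)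
    refine (h2.mono ?_).congr fun x hx => (hd x hx).fderivWithin (hU x hx)
    have h3 : ‖(ContinuousLinearMap.compL ℝ E E' F).flip L‖ ≤ ‖L‖ :=
      ContinuousLinearMap.opNorm_le_bound _ (norm_nonneg _) fun M => by
        rw [mul_comm]; exact M.opNorm_comp_le L
    have h4 : 0 ≤ C * (1 + ‖L‖) ^ r := by positivity
    rw [pow_succ]
    nlinarith [norm_nonneg L]

end HolderCtrl

/-! ### Smooth functions that are bounded with all derivatives -/

/-- Smooth functions with values in a normed space that are bounded on `U` with all derivatives. -/
def IsSmoothBounded {E F : Type} [NormedAddCommGroup E] [NormedSpace ℝ E]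
    [NormedAddCommGroup F] [NormedSpace ℝ F] (U : Set E) (f : E → F) : Prop :=
  ∀ r : ℕ, ∃ C : ℝ, 0 ≤ C ∧ HolderCtrl r 0 U f C

/-- At θ = 0 the Hölder condition only bounds the oscillation of the top derivative, because ‖x - y‖
^ 0 = 1 even for x = y. Hence the factor 2. -/
theorem IsCbInfty.isSmoothBounded {E : Type} [NormedAddCommGroup E] [NormedSpace ℝ E] {U : Set E}
    {φ : E → ℂ} (h : IsCbInfty U φ) : IsSmoothBounded U φ := by
  intro r
  choose C hC using h.bound
  have h1 : ∀ j ≤ r, C j ≤ ∑ i ∈ Finset.range (r + 1), |C i| := fun j hj =>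
    (le_abs_self _).trans (Finset.single_le_sum (f := fun i => |C i|) (fun _ _ => abs_nonneg _)
      (Finset.mem_range.2 (by omega)))
  have h0 : 0 ≤ ∑ i ∈ Finset.range (r + 1), |C i| := Finset.sum_nonneg fun _ _ => abs_nonneg _
  refine ⟨2 * ∑ i ∈ Finset.range (r + 1), |C i|, by positivity, h.1.of_le (by exact_mod_cast le_top),
    fun j hj x hx => ?_, fun x hx y hy => ?_⟩
  · linarith [hC j x hx, h1 j hj]
  · rw [Real.rpow_zero, mul_one, two_mul]
    exact norm_sub_le_of_le ((hC r x hx).trans (h1 r le_rfl)) ((hC r y hy).trans (h1 r le_rfl))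

namespace IsSmoothBounded

variable {E F G : Type} [NormedAddCommGroup E] [NormedSpace ℝ E]
    [NormedAddCommGroup F] [NormedSpace ℝ F] [NormedAddCommGroup G] [NormedSpace ℝ G]
    {U : Set E} {f : E → F}

theorem contDiffOn (h : IsSmoothBounded U f) : ContDiffOn ℝ ∞ f U :=
  contDiffOn_infty.2 fun r => (h r).choose_spec.2.1

theorem mul {f g : E → ℂ} (hU : IsCornerDomain U) (hf : IsSmoothBounded U f)
    (hg : IsSmoothBounded U g) : IsSmoothBounded U (fun x => f x * g x) := by
  intro r
  obtain ⟨C, hC, hf⟩ := hf r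
  obtain ⟨D, hD, hg⟩ := hg r
  obtain ⟨c, hc, h⟩ := HolderCtrl.exists_bilin hU.1 hU.2 le_rfl zero_le_one r
  exact ⟨_, by positivity, h (ContinuousLinearMap.mul ℝ ℂ) hC hD hf hg⟩

theorem fderivWithin_apply (hU : IsCornerDomain U) (h : IsSmoothBounded U f) (v : E) :
    IsSmoothBounded U (fun x => fderivWithin ℝ f U x v) := by
  intro r
  obtain ⟨C, hC, hf⟩ := h (r + 1)
  exact ⟨_, by positivity, ((HolderCtrl.succ_iff hU.2).1 hf).2.2.clm_comp hU.2
    (ContinuousLinearMap.apply ℝ F v)⟩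

theorem comp_clm {V : Set G} {f : G → F} (hU : IsCornerDomain U) (hV : IsCornerDomain V)
    (h : IsSmoothBounded V f) (L : E →L[ℝ] G) (hm : MapsTo L U V) :
    IsSmoothBounded U (fun x => f (L x)) := by
  intro r
  obtain ⟨C, hC, hf⟩ := h r
  have := hf.comp_affine hU.2 hV.2 L 0 (by simpa using hm) hC
  exact ⟨C * (1 + ‖L‖) ^ r, by positivity, by simpa using this⟩

/-- A family of slices of a smooth bounded function is uniformly Hölder bounded. -/
theorem exists_holderBound {V : Set G} {f : G → F} (hU : IsCornerDomain U) (hV : IsCornerDomain V)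
    (h : IsSmoothBounded V f) (L : E →L[ℝ] G) {τ : ℝ} (hτ : 0 ≤ τ) :
    ∃ C : ℝ, 0 ≤ C ∧ ∀ c : G, MapsTo (fun x => L x + c) U V →
      HolderBound τ U (fun x => f (L x + c)) C := by
  -- One derivative more than ⌊τ⌋₊ is taken, so that `HolderCtrl.of_succ` can turn it into the
  -- fractional exponent.
  obtain ⟨C, hC, hf⟩ := h (⌊τ⌋₊ + 1)
  refine ⟨2 * (C * (1 + ‖L‖) ^ (⌊τ⌋₊ + 1)), by positivity, fun c hm => ?_⟩
  rw [holderBound_iff]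
  refine HolderCtrl.of_succ hU.1 hU.2 ?_ ?_ (hf.comp_affine hU.2 hV.2 L c hm hC) (by positivity)
  · linarith [Nat.floor_le hτ]
  · linarith [Nat.lt_floor_add_one τ]

end IsSmoothBounded

/-! ### Partial derivatives -/

section PartialDerivatives

variable {d q : ℕ} {f g : EuclideanSpace ℝ (Fin d) × (Fin q → ℝ) → ℂ}

theorem isClosed_domVY : IsClosed (domVY d q) := by
  have : orthant q = ⋂ j, {Y | 0 ≤ Y j} := by ext; simp [orthant]
  refine isClosed_univ.prod (this ▸ isClosed_iInter fun j => ?_)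
  exact isClosed_le continuous_const (continuous_apply j)

theorem interior_domVY_nonempty : (interior (domVY d q)).Nonempty := by
  rw [domVY, interior_prod_eq, interior_univ]
  have : orthant q = Set.univ.pi fun _ => Set.Ici (0 : ℝ) := by
    ext; simp [orthant, Pi.le_def]
  rw [this, interior_pi_set finite_univ]
  exact ⟨(0, fun _ => 1), by simp⟩

/-- Needed for the symmetry of second derivatives at boundary points of the orthant. -/
theorem domVY_subset_closure_interior : domVY d q ⊆ closure (interior (domVY d q)) := by
  rw [(IsCornerDomain.domVY d q).convex.closure_interior_eq_closure_of_nonempty_interior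
    interior_domVY_nonempty]
  exact subset_closure

/-- Off the closed set `domVY d q` both sides are 0 by the convention for `fderivWithin`. Having
equality everywhere, and not only on the domain, permits rewriting inside iterated derivatives. -/
theorem pd_congr (h : EqOn f g (domVY d q)) (v : EuclideanSpace ℝ (Fin d) × (Fin q → ℝ)) :
    pd v f = pd v g := by
  ext p
  by_cases hp : p ∈ domVY d q
  · simp only [pd]; rw [fderivWithin_congr h (h hp)]
  · have : p ∉ closure (domVY d q) := by rwa [isClosed_domVY.closure_eq]
    simp [pd, fderivWithin_zero_of_notMem_closure this]

theorem contDiffOn_pd (h : ContDiffOn ℝ ∞ f (domVY d q))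
    (v : EuclideanSpace ℝ (Fin d) × (Fin q → ℝ)) : ContDiffOn ℝ ∞ (pd v f) (domVY d q) :=
  (h.fderivWithin (IsCornerDomain.domVY d q).2 (by simp)).clm_apply contDiffOn_const

theorem pd_comm (h : ContDiffOn ℝ ∞ f (domVY d q)) (v w : EuclideanSpace ℝ (Fin d) × (Fin q → ℝ)) :
    pd v (pd w f) = pd w (pd v f) := by
  ext p
  by_cases hp : p ∈ domVY d q
  swap
  · have : p ∉ closure (domVY d q) := by rwa [isClosed_domVY.closure_eq]
    simp [pd, fderivWithin_zero_of_notMem_closure this]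
  have hs := (h p hp).isSymmSndFDerivWithinAt (by simpa using WithTop.coe_le_coe.2 (le_top : (2 : ℕ∞) ≤ ⊤)) (IsCornerDomain.domVY d q).2
    (domVY_subset_closure_interior hp) hp
  have hd : DifferentiableWithinAt ℝ (fderivWithin ℝ f (domVY d q)) (domVY d q) p :=
    (h.fderivWithin (m := 1) (IsCornerDomain.domVY d q).2 (by norm_cast)).differentiableOn
      (by simp) p hp
  have e : ∀ v w, pd v (pd w f) p
      = fderivWithin ℝ (fderivWithin ℝ f (domVY d q)) (domVY d q) p v w := fun v w => by
    unfold pd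
    rw [fderivWithin_clm_apply ((IsCornerDomain.domVY d q).2 p hp) hd
      (differentiableWithinAt_const w)]
    simp
  rw [e, e]
  exact hs v w

theorem contDiffOn_pd_iterate (h : ContDiffOn ℝ ∞ f (domVY d q))
    (v : EuclideanSpace ℝ (Fin d) × (Fin q → ℝ)) (n : ℕ) :
    ContDiffOn ℝ ∞ ((pd v)^[n] f) (domVY d q) := by
  induction n generalizing f with
  | zero => exact h
  | succ n ih => exact ih (contDiffOn_pd h v)

theorem pd_iterate_comm (h : ContDiffOn ℝ ∞ f (domVY d q))
    (v w : EuclideanSpace ℝ (Fin d) × (Fin q → ℝ)) (n : ℕ) :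
    pd v ((pd w)^[n] f) = (pd w)^[n] (pd v f) := by
  induction n generalizing f with
  | zero => rfl
  | succ n ih =>
    rw [Function.iterate_succ_apply, Function.iterate_succ_apply, ih (contDiffOn_pd h w),
      pd_comm h]

/-- Iterated partial derivatives along the directions `e i`, `i ∈ l`. -/
def foldPd {ι : Type*} (e : ι → EuclideanSpace ℝ (Fin d) × (Fin q → ℝ)) (α : ι → ℕ) (l : List ι)
    (f : EuclideanSpace ℝ (Fin d) × (Fin q → ℝ) → ℂ) :
    EuclideanSpace ℝ (Fin d) × (Fin q → ℝ) → ℂ :=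
  l.foldr (fun i g => (pd (e i))^[α i] g) f

section Fold

variable {ι : Type*} (e : ι → EuclideanSpace ℝ (Fin d) × (Fin q → ℝ))

theorem contDiffOn_foldPd (h : ContDiffOn ℝ ∞ f (domVY d q)) (α : ι → ℕ) (l : List ι) :
    ContDiffOn ℝ ∞ (foldPd e α l f) (domVY d q) := by
  induction l with
  | nil => exact h
  | cons i l ih => exact contDiffOn_pd_iterate ih _ _

theorem pd_foldPd_comm (h : ContDiffOn ℝ ∞ f (domVY d q))
    (v : EuclideanSpace ℝ (Fin d) × (Fin q → ℝ)) (α : ι → ℕ) (l : List ι) :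
    pd v (foldPd e α l f) = foldPd e α l (pd v f) := by
  induction l with
  | nil => rfl
  | cons i l ih =>
    change pd v ((pd (e i))^[α i] (foldPd e α l f)) = (pd (e i))^[α i] (foldPd e α l (pd v f))
    rw [pd_iterate_comm (contDiffOn_foldPd e h α l), ih]

theorem foldPd_congr {α β : ι → ℕ} {l : List ι} (h : ∀ i ∈ l, α i = β i) :
    foldPd e α l f = foldPd e β l f := by
  induction l with
  | nil => rfl
  | cons i l ih =>
    change (pd (e i))^[α i] (foldPd e α l f) = (pd (e i))^[β i] (foldPd e β l f)
    rw [ih fun j hj => h j (List.mem_cons_of_mem _ hj), h i List.mem_cons_self]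

/-- The new derivative commutes past the other directions until it meets its own. Absence of
duplicates ensures that raising α at i counts only once. -/
theorem pd_foldPd [DecidableEq ι] (h : ContDiffOn ℝ ∞ f (domVY d q)) (α : ι → ℕ) {l : List ι}
    (hl : l.Nodup) {i : ι} (hi : i ∈ l) :
    pd (e i) (foldPd e α l f) = foldPd e (α + Pi.single i 1) l f := by
  induction l with
  | nil => simp at hi
  | cons j l ih =>
    rw [List.nodup_cons] at hl
    change pd (e i) ((pd (e j))^[α j] (foldPd e α l f)) =
      (pd (e j))^[(α + Pi.single i 1 : ι → ℕ) j] (foldPd e (α + Pi.single i 1) l f)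
    rcases eq_or_ne i j with rfl | hij
    · have hc : foldPd e (α + Pi.single i 1) l f = foldPd e α l f := foldPd_congr e fun k hk => by
        have : k ≠ i := fun h => hl.1 (h ▸ hk)
        simp [this]
      rw [hc, ← Function.iterate_succ_apply' (pd (e i))]
      simp
    · rw [pd_iterate_comm (contDiffOn_foldPd e h α l),
        ih hl.2 ((List.mem_cons.1 hi).resolve_left hij)]
      simp [hij.symm]

end Fold

/-- The coordinate directions of `ℝ^d` in `ℝ^d × ℝ^q`. -/
def dirZ (i : Fin d) : EuclideanSpace ℝ (Fin d) × (Fin q → ℝ) := (EuclideanSpace.single i (1 : ℝ), 0)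

/-- The coordinate directions of `ℝ^q` in `ℝ^d × ℝ^q`. -/
def dirY (j : Fin q) : EuclideanSpace ℝ (Fin d) × (Fin q → ℝ) := (0, Pi.single j (1 : ℝ))

theorem mixedDeriv_eq (α : Fin d → ℕ) (k' : Fin q → ℕ) :
    mixedDeriv α k' f = foldPd dirZ α (List.finRange d) (foldPd dirY k' (List.finRange q) f) := rfl

theorem mixedDeriv_zero : mixedDeriv 0 0 f = f := by
  have h : ∀ {ι : Type} (e : ι → EuclideanSpace ℝ (Fin d) × (Fin q → ℝ)) (l : List ι) f,
      foldPd e 0 l f = f := by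
    intro ι e l f
    induction l with
    | nil => rfl
    | cons i l ih => exact ih
  rw [mixedDeriv_eq, h, h]

theorem contDiffOn_mixedDeriv (h : ContDiffOn ℝ ∞ f (domVY d q)) (α : Fin d → ℕ) (k' : Fin q → ℕ) :
    ContDiffOn ℝ ∞ (mixedDeriv α k' f) (domVY d q) :=
  contDiffOn_foldPd _ (contDiffOn_foldPd _ h _ _) _ _

theorem pd_dirZ_mixedDeriv (h : ContDiffOn ℝ ∞ f (domVY d q)) (α : Fin d → ℕ) (k' : Fin q → ℕ)
    (i : Fin d) : pd (dirZ i) (mixedDeriv α k' f) = mixedDeriv (α + Pi.single i 1) k' f :=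
  pd_foldPd dirZ (contDiffOn_foldPd _ h _ _) α (List.nodup_finRange d) (List.mem_finRange i)

theorem pd_dirY_mixedDeriv (h : ContDiffOn ℝ ∞ f (domVY d q)) (α : Fin d → ℕ) (k' : Fin q → ℕ)
    (j : Fin q) : pd (dirY j) (mixedDeriv α k' f) = mixedDeriv α (k' + Pi.single j 1) f := by
  rw [mixedDeriv_eq, pd_foldPd_comm _ (contDiffOn_foldPd _ h _ _),
    pd_foldPd dirY h k' (List.nodup_finRange q) (List.mem_finRange j)]
  rfl

theorem prod_eq_sum_dir (p : EuclideanSpace ℝ (Fin d) × (Fin q → ℝ)) :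
    p = ∑ i, p.1 i • dirZ i + ∑ j, p.2 j • dirY j := by
  have h1 : ∀ i : Fin d, p.1 i • (dirZ i : EuclideanSpace ℝ (Fin d) × (Fin q → ℝ))
      = LinearMap.inl ℝ _ _ (p.1 i • EuclideanSpace.single i (1 : ℝ)) := fun i => by simp [dirZ]
  have h2 : ∀ j : Fin q, p.2 j • (dirY j : EuclideanSpace ℝ (Fin d) × (Fin q → ℝ))
      = LinearMap.inr ℝ _ _ (p.2 j • Pi.single j (1 : ℝ)) := fun j => by
    simp only [dirY, LinearMap.inr_apply, Prod.smul_mk, smul_zero]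
  simp_rw [h1, h2, ← map_sum]
  have e1 : ∑ i, p.1 i • EuclideanSpace.single i (1 : ℝ) = p.1 := by
    ext k; simp [Pi.single_apply]
  rw [e1, ← pi_eq_sum_univ' p.2]
  simp

/-- The linear form on `ℝ^d × ℝ^q` with given values on the coordinate directions. -/
def linForm (a : Fin d → ℂ) (b : Fin q → ℂ) : EuclideanSpace ℝ (Fin d) × (Fin q → ℝ) →L[ℝ] ℂ :=
  ∑ i, ((EuclideanSpace.proj i : EuclideanSpace ℝ (Fin d) →L[ℝ] ℝ).comp
      (ContinuousLinearMap.fst ℝ _ _)).smulRight (a i) +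
    ∑ j, ((ContinuousLinearMap.proj j : (Fin q → ℝ) →L[ℝ] ℝ).comp
      (ContinuousLinearMap.snd ℝ _ _)).smulRight (b j)

theorem linForm_apply (a : Fin d → ℂ) (b : Fin q → ℂ)
    (p : EuclideanSpace ℝ (Fin d) × (Fin q → ℝ)) :
    linForm a b p = ∑ i, p.1 i • a i + ∑ j, p.2 j • b j := by
  simp [linForm]

theorem linForm_dirZ (a : Fin d → ℂ) (b : Fin q → ℂ) (i : Fin d) : linForm a b (dirZ i) = a i := by
  simp [linForm_apply, dirZ]

theorem linForm_dirY (a : Fin d → ℂ) (b : Fin q → ℂ) (j : Fin q) : linForm a b (dirY j) = b j := by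
  simp [linForm_apply, dirY, Pi.single_apply]

theorem eq_linForm (L : EuclideanSpace ℝ (Fin d) × (Fin q → ℝ) →L[ℝ] ℂ) :
    L = linForm (fun i => L (dirZ i)) (fun j => L (dirY j)) := by
  refine ContinuousLinearMap.ext fun p => ?_
  conv_lhs => rw [prod_eq_sum_dir p]
  rw [linForm_apply]
  simp

theorem linForm_add (a a' : Fin d → ℂ) (b b' : Fin q → ℂ) :
    linForm a b + linForm a' b' = linForm (fun i => a i + a' i) (fun j => b j + b' j) := by
  refine ContinuousLinearMap.ext fun p => ?_
  simp [linForm_apply, Finset.sum_add_distrib]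
  ring

theorem pd_eq_of_hasFDerivWithinAt {p : EuclideanSpace ℝ (Fin d) × (Fin q → ℝ)}
    (hp : p ∈ domVY d q) {L : EuclideanSpace ℝ (Fin d) × (Fin q → ℝ) →L[ℝ] ℂ}
    (h : HasFDerivWithinAt f L (domVY d q) p) (v : EuclideanSpace ℝ (Fin d) × (Fin q → ℝ)) :
    pd v f p = L v := by
  rw [pd, h.fderivWithin ((IsCornerDomain.domVY d q).2 p hp)]

end PartialDerivatives

/-- A class of functions on `ℝ^d × [0, ∞)^q` that is closed under partial derivatives consists of
smooth functions. -/
theorem contDiffOn_of_closed_pd {d q : ℕ} {E : Type*} {U : Set E}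
    {P : (E → EuclideanSpace ℝ (Fin d) × (Fin q → ℝ) → ℂ) → Prop}
    (hP : ∀ K, P K → ∃ (Kz : Fin d → E → EuclideanSpace ℝ (Fin d) × (Fin q → ℝ) → ℂ)
      (Ky : Fin q → E → EuclideanSpace ℝ (Fin d) × (Fin q → ℝ) → ℂ),
      (∀ i, P (Kz i)) ∧ (∀ j, P (Ky j)) ∧ ∀ x ∈ U, ∀ p ∈ domVY d q,
        HasFDerivWithinAt (K x) (linForm (fun i => Kz i x p) (fun j => Ky j x p)) (domVY d q) p)
    {K : E → EuclideanSpace ℝ (Fin d) × (Fin q → ℝ) → ℂ} (hK : P K) {x : E} (hx : x ∈ U) :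
    ContDiffOn ℝ ∞ (K x) (domVY d q) := by
  rw [contDiffOn_infty]
  intro n
  have hD := (IsCornerDomain.domVY d q).2
  induction n generalizing K with
  | zero =>
    obtain ⟨Kz, Ky, -, -, h⟩ := hP K hK
    exact contDiffOn_zero.2 fun p hp => (h x hx p hp).continuousWithinAt
  | succ n ih =>
    obtain ⟨Kz, Ky, hz, hy, h⟩ := hP K hK
    rw [Nat.cast_add, Nat.cast_one, contDiffOn_succ_iff_fderivWithin hD]
    refine ⟨fun p hp => (h x hx p hp).differentiableWithinAt, by simp, ?_⟩
    refine ContDiffOn.congr (f := fun p => linForm (fun i => Kz i x p) (fun j => Ky j x p)) ?_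
      fun p hp => (h x hx p hp).fderivWithin (hD p hp)
    unfold linForm
    refine ContDiffOn.add (ContDiffOn.sum fun i _ => ?_) (ContDiffOn.sum fun j _ => ?_)
    · exact contDiffOn_const.smulRight (ih (hz i))
    · exact contDiffOn_const.smulRight (ih (hy j))

/-- Members of P are known only up to equality on U × `domVY d q`. By `pd_congr` this suffices to
pass to the next derivative, so the property survives any number of them. -/
theorem exists_mixedDeriv_of_closed_pd {d q : ℕ} {E : Type*} {U : Set E}
    {P : (E → EuclideanSpace ℝ (Fin d) × (Fin q → ℝ) → ℂ) → Prop}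
    (hP : ∀ K, P K → ∃ (Kz : Fin d → E → EuclideanSpace ℝ (Fin d) × (Fin q → ℝ) → ℂ)
      (Ky : Fin q → E → EuclideanSpace ℝ (Fin d) × (Fin q → ℝ) → ℂ),
      (∀ i, P (Kz i)) ∧ (∀ j, P (Ky j)) ∧ ∀ x ∈ U, ∀ p ∈ domVY d q,
        HasFDerivWithinAt (K x) (linForm (fun i => Kz i x p) (fun j => Ky j x p)) (domVY d q) p)
    (α : Fin d → ℕ) (k' : Fin q → ℕ) {K : E → EuclideanSpace ℝ (Fin d) × (Fin q → ℝ) → ℂ}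
    (hK : P K) : ∃ K', P K' ∧ ∀ x ∈ U, ∀ p ∈ domVY d q, mixedDeriv α k' (K x) p = K' x p := by
  have fold : ∀ {ι : Type} (e : ι → EuclideanSpace ℝ (Fin d) × (Fin q → ℝ)) (α : ι → ℕ),
      (∀ i K, P K → ∃ K', P K' ∧ ∀ x ∈ U, ∀ p ∈ domVY d q, pd (e i) (K x) p = K' x p) →
      ∀ (l : List ι) (g : E → EuclideanSpace ℝ (Fin d) × (Fin q → ℝ) → ℂ),
      (∃ K, P K ∧ ∀ x ∈ U, ∀ p ∈ domVY d q, g x p = K x p) →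
      ∃ K', P K' ∧ ∀ x ∈ U, ∀ p ∈ domVY d q, foldPd e α l (g x) p = K' x p := by
    intro ι e α he l g hg
    induction l with
    | nil => exact hg
    | cons i l ih =>
      have it : ∀ (n : ℕ) (g : E → EuclideanSpace ℝ (Fin d) × (Fin q → ℝ) → ℂ),
          (∃ K, P K ∧ ∀ x ∈ U, ∀ p ∈ domVY d q, g x p = K x p) →
          ∃ K', P K' ∧ ∀ x ∈ U, ∀ p ∈ domVY d q, (pd (e i))^[n] (g x) p = K' x p := by
        intro n
        induction n with
        | zero => exact fun g hg => hg
        | succ n ihn =>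
          rintro g ⟨K, hK, hgK⟩
          refine ihn (fun x => pd (e i) (g x)) ?_
          obtain ⟨K', hK', h⟩ := he i K hK
          refine ⟨K', hK', fun x hx p hp => ?_⟩
          rw [pd_congr (hgK x hx), h x hx p hp]
      exact it (α i) _ ih
  refine fold dirZ α (fun i K hK => ?_) (List.finRange d) _
    (fold dirY k' (fun j K hK => ?_) (List.finRange q) K ⟨K, hK, fun _ _ _ _ => rfl⟩)
  · obtain ⟨Kz, Ky, hz, -, h⟩ := hP K hK
    exact ⟨Kz i, hz i, fun x hx p hp => by
      rw [pd_eq_of_hasFDerivWithinAt hp (h x hx p hp), linForm_dirZ]⟩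
  · obtain ⟨Kz, Ky, -, hy, h⟩ := hP K hK
    exact ⟨Ky j, hy j, fun x hx p hp => by
      rw [pd_eq_of_hasFDerivWithinAt hp (h x hx p hp), linForm_dirY]⟩

/-! ### The japanese bracket -/

section Japanese

variable {d : ℕ} (ξ : EuclideanSpace ℝ (Fin d))

theorem one_le_japanese : 1 ≤ japanese ξ := by
  rw [japanese, Real.one_le_sqrt]
  nlinarith [sq_nonneg ‖ξ‖]

theorem japanese_pos : 0 < japanese ξ := zero_lt_one.trans_le (one_le_japanese ξ)

theorem norm_le_japanese : ‖ξ‖ ≤ japanese ξ :=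
  Real.le_sqrt_of_sq_le (by linarith)

theorem abs_coord_le_japanese (i : Fin d) : |ξ i| ≤ japanese ξ :=
  (by simpa using PiLp.norm_apply_le ξ i : |ξ i| ≤ ‖ξ‖).trans (norm_le_japanese ξ)

theorem japanese_le : japanese ξ ≤ 1 + ‖ξ‖ :=
  (Real.sqrt_le_left (by positivity)).2 (by nlinarith [norm_nonneg ξ])

theorem integrable_japanese_rpow {a : ℝ} (ha : a < -(d : ℝ)) :
    Integrable fun ξ : EuclideanSpace ℝ (Fin d) => japanese ξ ^ a := by
  have h := integrable_rpow_neg_one_add_norm_sq (E := EuclideanSpace ℝ (Fin d))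
    (μ := volume) (r := -a) (by simpa using by linarith)
  refine h.congr (Eventually.of_forall fun ξ => ?_)
  simp only [japanese, neg_neg]
  rw [Real.sqrt_eq_rpow, ← Real.rpow_mul (by positivity)]
  ring_nf

theorem japanese_rpow_pos (a : ℝ) : 0 < japanese ξ ^ a := Real.rpow_pos_of_pos (japanese_pos ξ) a

end Japanese

/-! ### The algebra generated by a symbol-kernel -/

/-- The functions obtained from `h` by differentiation and by multiplication with coordinates,
graded by the order relative to the order of `h`. -/
inductive SymClass {E : Type} {d q : ℕ} (U : Set E)
    (h : E → EuclideanSpace ℝ (Fin d) × (Fin q → ℝ) → ℂ) :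
    ℤ → (E → EuclideanSpace ℝ (Fin d) × (Fin q → ℝ) → ℂ) → Prop
  | base (α : Fin d → ℕ) (k' : Fin q → ℕ) :
      SymClass U h ((∑ j, k' j : ℕ) - (∑ i, α i : ℕ)) (fun x => mixedDeriv α k' (h x))
  | mulY {s f} (j : Fin q) : SymClass U h s f →
      SymClass U h (s - 1) (fun x p => (p.2 j : ℂ) * f x p)
  | mulZ {s f} (i : Fin d) : SymClass U h s f →
      SymClass U h (s + 1) (fun x p => (p.1 i : ℂ) * f x p)
  | add {s f g} : SymClass U h s f → SymClass U h s g → SymClass U h s (fun x p => f x p + g x p)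
  | smul {s f} (c : ℂ) : SymClass U h s f → SymClass U h s (fun x p => c * f x p)
  | mono {s f} : SymClass U h s f → SymClass U h (s + 1) f
  | congr {s f g} : SymClass U h s f → (∀ x ∈ U, EqOn (g x) (f x) (domVY d q)) → SymClass U h s g

theorem pd_mul_clm {d q : ℕ} {f : EuclideanSpace ℝ (Fin d) × (Fin q → ℝ) → ℂ}
    (hf : ContDiffOn ℝ ∞ f (domVY d q)) (ℓ : EuclideanSpace ℝ (Fin d) × (Fin q → ℝ) →L[ℝ] ℝ)
    (v : EuclideanSpace ℝ (Fin d) × (Fin q → ℝ)) :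
    EqOn (pd v fun p => (ℓ p : ℂ) * f p) (fun p => (ℓ v : ℂ) * f p + (ℓ p : ℂ) * pd v f p)
      (domVY d q) := by
  intro p hp
  have h1 : HasFDerivWithinAt (fun p => (ℓ p : ℂ)) (Complex.ofRealCLM.comp ℓ) (domVY d q) p :=
    (Complex.ofRealCLM.comp ℓ).hasFDerivWithinAt
  have h2 := (hf.differentiableOn (by simp) p hp).hasFDerivWithinAt
  refine (pd_eq_of_hasFDerivWithinAt hp (h1.mul h2) v).trans ?_
  simp [pd]
  ring

namespace SymClass

variable {E : Type} {d q : ℕ} {U : Set E}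
  {h f g : E → EuclideanSpace ℝ (Fin d) × (Fin q → ℝ) → ℂ} {s : ℤ}

theorem self : SymClass U h 0 h := by
  simpa [mixedDeriv_zero] using base (U := U) (h := h) 0 0

theorem contDiffOn (hh : ∀ x ∈ U, ContDiffOn ℝ ∞ (h x) (domVY d q)) (hf : SymClass U h s f)
    {x : E} (hx : x ∈ U) : ContDiffOn ℝ ∞ (f x) (domVY d q) := by
  induction hf with
  | base α k' => exact contDiffOn_mixedDeriv (hh x hx) α k'
  | @mulY s f j _ ih =>
    refine ContDiffOn.mul ?_ ih
    exact (Complex.ofRealCLM.comp ((ContinuousLinearMap.proj (R := ℝ) (φ := fun _ => ℝ) j).comp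
      (ContinuousLinearMap.snd ℝ (EuclideanSpace ℝ (Fin d)) (Fin q → ℝ)))).contDiff.contDiffOn
  | @mulZ s f i _ ih =>
    refine ContDiffOn.mul ?_ ih
    exact (Complex.ofRealCLM.comp ((EuclideanSpace.proj (𝕜 := ℝ) i).comp
      (ContinuousLinearMap.fst ℝ (EuclideanSpace ℝ (Fin d)) (Fin q → ℝ)))).contDiff.contDiffOn
  | add _ _ ih1 ih2 => exact ih1.add ih2
  | smul c _ ih => exact contDiffOn_const.mul ih
  | mono _ ih => exact ih
  | congr _ hfg ih => exact ih.congr (hfg x hx)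

theorem mono_le {s' : ℤ} (hf : SymClass U h s f) (hs : s ≤ s') : SymClass U h s' f := by
  obtain ⟨n, rfl⟩ := Int.le.dest hs
  induction n with
  | zero => simpa using hf
  | succ n ih => simpa [add_assoc] using (ih (by omega)).mono

theorem of_eq {s' : ℤ} (hf : SymClass U h s f) (hs : s = s') : SymClass U h s' f := hs ▸ hf

/-- Partial derivatives along a direction that changes the order by `δ`. -/
theorem pd_aux (hh : ∀ x ∈ U, ContDiffOn ℝ ∞ (h x) (domVY d q)) (hf : SymClass U h s f)
    (v : EuclideanSpace ℝ (Fin d) × (Fin q → ℝ)) (δ : ℤ)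
    (hb : ∀ α k', SymClass U h (((∑ j, k' j : ℕ) - (∑ i, α i : ℕ)) + δ)
      (fun x => pd v (mixedDeriv α k' (h x))))
    (hy : ∀ j, v.2 j = 0 ∨ δ = 1) (hz : ∀ i, v.1 i = 0 ∨ δ = -1) :
    SymClass U h (s + δ) (fun x => pd v (f x)) := by
  induction hf with
  | base α k' => exact hb α k'
  | @mulY s f j hf ih =>
    have e : ∀ x ∈ U, EqOn (pd v fun p => (p.2 j : ℂ) * f x p)
        (fun p => (v.2 j : ℂ) * f x p + (p.2 j : ℂ) * pd v (f x) p) (domVY d q) := fun x hx =>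
      pd_mul_clm (hf.contDiffOn hh hx) ((ContinuousLinearMap.proj (R := ℝ) (φ := fun _ => ℝ) j).comp
        (ContinuousLinearMap.snd ℝ _ _)) v
    -- The Leibniz term v_j f has order s, while order s - 1 + δ is required: either it vanishes or
    -- δ = 1.
    rcases hy j with h0 | h1
    · refine ((ih.mulY j).of_eq (by ring)).congr fun x hx p hp => ?_
      rw [e x hx hp, h0]; simp
    · refine ((hf.smul (v.2 j : ℂ)).add ((ih.mulY j).of_eq (by omega))).of_eq (by omega) |>.congr e
  | @mulZ s f i hf ih =>
    have e : ∀ x ∈ U, EqOn (pd v fun p => (p.1 i : ℂ) * f x p)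
        (fun p => (v.1 i : ℂ) * f x p + (p.1 i : ℂ) * pd v (f x) p) (domVY d q) := fun x hx =>
      pd_mul_clm (hf.contDiffOn hh hx) ((EuclideanSpace.proj (𝕜 := ℝ) i).comp
        (ContinuousLinearMap.fst ℝ _ _)) v
    -- Here order s + 1 + δ is required of the Leibniz term, which forces δ = -1 unless the term
    -- vanishes.
    rcases hz i with h0 | h1
    · refine ((ih.mulZ i).of_eq (by ring)).congr fun x hx p hp => ?_
      rw [e x hx hp, h0]; simp
    · refine ((hf.smul (v.1 i : ℂ)).add ((ih.mulZ i).of_eq (by omega))).of_eq (by omega) |>.congr e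
  | @add s f g hf hg ih1 ih2 =>
    refine (ih1.add ih2).congr fun x hx p hp => ?_
    have a1 := ((hf.contDiffOn hh hx).differentiableOn (by simp) p hp).hasFDerivWithinAt
    have a2 := ((hg.contDiffOn hh hx).differentiableOn (by simp) p hp).hasFDerivWithinAt
    exact pd_eq_of_hasFDerivWithinAt hp (a1.add a2) v
  | @smul s f c hf ih =>
    refine (ih.smul c).congr fun x hx p hp => ?_
    have a1 := ((hf.contDiffOn hh hx).differentiableOn (by simp) p hp).hasFDerivWithinAt
    exact pd_eq_of_hasFDerivWithinAt hp (a1.const_mul c) v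
  | mono _ ih => exact ih.mono.of_eq (by ring)
  | congr _ hfg ih =>
    refine ih.congr fun x hx p _ => ?_
    rw [pd_congr (hfg x hx)]

theorem pd_dirZ (hh : ∀ x ∈ U, ContDiffOn ℝ ∞ (h x) (domVY d q)) (hf : SymClass U h s f)
    (i : Fin d) : SymClass U h (s - 1) (fun x => pd (dirZ i) (f x)) := by
  refine (pd_aux hh hf (dirZ i) (-1) (fun α k' => ?_) (fun j => Or.inl (by simp [dirZ]))
    (fun j => Or.inr rfl)).of_eq (by ring)
  refine ((base (U := U) (h := h) (α + Pi.single i 1) k').of_eq ?_).congr fun x hx p _ => ?_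
  · simp only [Pi.add_apply, Finset.sum_add_distrib, Finset.sum_pi_single', Finset.mem_univ]
    push_cast; ring
  · rw [pd_dirZ_mixedDeriv (hh x hx)]

theorem pd_dirY (hh : ∀ x ∈ U, ContDiffOn ℝ ∞ (h x) (domVY d q)) (hf : SymClass U h s f)
    (j : Fin q) : SymClass U h (s + 1) (fun x => pd (dirY j) (f x)) := by
  refine (pd_aux hh hf (dirY j) 1 (fun α k' => ?_) (fun j => Or.inr rfl)
    (fun j => Or.inl (by simp [dirY])))
  refine ((base (U := U) (h := h) α (k' + Pi.single j 1)).of_eq ?_).congr fun x hx p _ => ?_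
  · simp only [Pi.add_apply, Finset.sum_add_distrib, Finset.sum_pi_single', Finset.mem_univ]
    push_cast; ring
  · rw [pd_dirY_mixedDeriv (hh x hx)]

end SymClass

/-! ### Calculus of `HolderBound` and estimates in C^τ with values in L² -/

theorem HolderBound.clm_comp {E F G : Type} [NormedAddCommGroup E] [NormedSpace ℝ E]
    [NormedAddCommGroup F] [NormedSpace ℝ F] [NormedAddCommGroup G] [NormedSpace ℝ G] {τ : ℝ}
    {U : Set E} (hU : UniqueDiffOn ℝ U) {f : E → F} {C D : ℝ} (hf : HolderBound τ U f C)
    (L : F →L[ℝ] G) (hL : ‖L‖ * C ≤ D) : HolderBound τ U (fun x => L (f x)) D :=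
  holderBound_iff.2 (((holderBound_iff.1 hf).clm_comp hU L).mono hL)

theorem HolderBound.congr {E F : Type} [NormedAddCommGroup E] [NormedSpace ℝ E]
    [NormedAddCommGroup F] [NormedSpace ℝ F] {τ : ℝ}
    {U : Set E} {f g : E → F} {C : ℝ} (hf : HolderBound τ U f C) (h : EqOn g f U) :
    HolderBound τ U g C := holderBound_iff.2 ((holderBound_iff.1 hf).congr h)

theorem HolderBound.mono {E F : Type} [NormedAddCommGroup E] [NormedSpace ℝ E]
    [NormedAddCommGroup F] [NormedSpace ℝ F] {τ : ℝ}
    {U : Set E} {f : E → F} {C D : ℝ} (hf : HolderBound τ U f C) (h : C ≤ D) :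
    HolderBound τ U f D := holderBound_iff.2 ((holderBound_iff.1 hf).mono h)

theorem HolderBound.add {E F : Type} [NormedAddCommGroup E] [NormedSpace ℝ E]
    [NormedAddCommGroup F] [NormedSpace ℝ F] {τ : ℝ}
    {U : Set E} (hU : UniqueDiffOn ℝ U) {f g : E → F} {C D : ℝ} (hf : HolderBound τ U f C)
    (hg : HolderBound τ U g D) : HolderBound τ U (fun x => f x + g x) (C + D) :=
  holderBound_iff.2 ((holderBound_iff.1 hf).add hU (holderBound_iff.1 hg))

/-- Bounds in `C^τ(U; L²)` for all elements of the algebra generated by a symbol-kernel. -/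
theorem SymClass.exists_l2_bound {E : Type} [NormedAddCommGroup E] [NormedSpace ℝ E] {d q : ℕ}
    {U : Set E} (hU : IsCornerDomain U) {τ m : ℝ}
    {h f : E → EuclideanSpace ℝ (Fin d) × (Fin q → ℝ) → ℂ} (hh : IsSymbolKernel τ m U h) {s : ℤ}
    (hf : SymClass U h s f) (k : Fin q → ℕ) :
    ∃ C : ℝ, 0 ≤ C ∧ ∀ ξ : EuclideanSpace ℝ (Fin d),
      ∃ G : E → Lp ℂ 2 (volume.restrict (orthant q)),
        (∀ x ∈ U, (G x : (Fin q → ℝ) → ℂ) =ᵐ[volume.restrict (orthant q)]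
          fun Y => (monomial k Y : ℂ) * f x (ξ, Y)) ∧
        HolderBound τ U G (C * japanese ξ ^ (m + (q : ℝ) / 2 + s - (∑ j, k j : ℕ))) := by
  -- At fixed ξ both a constant and a coordinate ξ_i are scalars on L², so one statement serves both
  -- generators.
  have scal : ∀ {f : E → EuclideanSpace ℝ (Fin d) × (Fin q → ℝ) → ℂ} {ξ : EuclideanSpace ℝ (Fin d)}
      {C D : ℝ} (c : ℂ) (k : Fin q → ℕ), 0 ≤ C → ‖c‖ * C ≤ D →
      (∃ G : E → Lp ℂ 2 (volume.restrict (orthant q)),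
        (∀ x ∈ U, (G x : (Fin q → ℝ) → ℂ) =ᵐ[volume.restrict (orthant q)]
          fun Y => (monomial k Y : ℂ) * f x (ξ, Y)) ∧ HolderBound τ U G C) →
      ∃ G : E → Lp ℂ 2 (volume.restrict (orthant q)),
        (∀ x ∈ U, (G x : (Fin q → ℝ) → ℂ) =ᵐ[volume.restrict (orthant q)]
          fun Y => (monomial k Y : ℂ) * (c * f x (ξ, Y))) ∧ HolderBound τ U G D := by
    rintro f ξ C D c k hC hD ⟨G, hG, hGb⟩
    refine ⟨fun x => c • G x, fun x hx => ?_, ?_⟩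
    · filter_upwards [hG x hx, Lp.coeFn_smul c (G x)] with Y h1 h2
      rw [h2, Pi.smul_apply, h1, smul_eq_mul]
      ring
    · refine hGb.clm_comp hU.2 (ContinuousLinearMap.restrictScalars ℝ
        (c • ContinuousLinearMap.id ℂ (Lp ℂ 2 (volume.restrict (orthant q))))) (le_trans ?_ hD)
      gcongr
      rw [ContinuousLinearMap.norm_restrictScalars]
      refine (norm_smul_le _ _).trans ?_
      exact mul_le_of_le_one_right (norm_nonneg _) ContinuousLinearMap.norm_id_le
  induction hf generalizing k with
  | base α k' =>
    obtain ⟨C, hC⟩ := hh.bound α k k'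
    refine ⟨|C|, abs_nonneg _, fun ξ => ?_⟩
    obtain ⟨G, hG, hGb⟩ := hC ξ
    refine ⟨G, hG, hGb.mono ?_⟩
    have e : m + (q : ℝ) / 2 - (∑ j, k j : ℕ) + (∑ j, k' j : ℕ) - (∑ i, α i : ℕ)
        = m + (q : ℝ) / 2 + (((∑ j, k' j : ℕ) - (∑ i, α i : ℕ) : ℤ) : ℝ) - (∑ j, k j : ℕ) := by
      push_cast; ring
    rw [e]
    gcongr
    · exact (japanese_rpow_pos _ _).le
    · exact le_abs_self C
  | @mulY s f j _ ih =>
    -- The factor Y_j is absorbed into the monomial. This is why the induction is over all k.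
    obtain ⟨C, hC0, hC⟩ := ih (k + Pi.single j 1)
    refine ⟨C, hC0, fun ξ => ?_⟩
    obtain ⟨G, hG, hGb⟩ := hC ξ
    refine ⟨G, fun x hx => (hG x hx).trans (Eventually.of_forall fun Y => ?_), hGb.mono ?_⟩
    · have : monomial (k + Pi.single j 1) Y = monomial k Y * Y j := by
        simp only [monomial, Pi.add_apply, pow_add, Finset.prod_mul_distrib]
        congr 1
        rw [Finset.prod_eq_single j (fun b _ hb => by simp [hb]) (by simp)]
        simp
      simp only [this]
      push_cast; ring
    · have : ((∑ i, (k + Pi.single j 1 : Fin q → ℕ) i : ℕ) : ℝ) = (∑ i, k i : ℕ) + 1 := by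
        simp only [Pi.add_apply, Finset.sum_add_distrib, Finset.sum_pi_single', Finset.mem_univ]
        push_cast; simp
      rw [this]
      apply le_of_eq
      push_cast
      congr 2
      ring
  | @mulZ s f i _ ih =>
    obtain ⟨C, hC0, hC⟩ := ih k
    refine ⟨C, hC0, fun ξ => ?_⟩
    refine scal (ξ i : ℂ) k (mul_nonneg hC0 (japanese_rpow_pos _ _).le) ?_ (hC ξ)
    have e : m + (q : ℝ) / 2 + ((s + 1 : ℤ) : ℝ) - (∑ j, k j : ℕ)
        = m + (q : ℝ) / 2 + s - (∑ j, k j : ℕ) + 1 := by push_cast; ring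
    rw [e, Real.rpow_add_one (japanese_pos ξ).ne', Complex.norm_real, Real.norm_eq_abs]
    have := japanese_rpow_pos ξ (m + (q : ℝ) / 2 + s - (∑ j, k j : ℕ))
    have h2 := mul_le_mul_of_nonneg_left (abs_coord_le_japanese ξ i) (mul_nonneg hC0 this.le)
    linarith
  | @add s f g _ _ ih1 ih2 =>
    obtain ⟨C, hC0, hC⟩ := ih1 k
    obtain ⟨D, hD0, hD⟩ := ih2 k
    refine ⟨C + D, by positivity, fun ξ => ?_⟩
    obtain ⟨G, hG, hGb⟩ := hC ξ
    obtain ⟨H, hH, hHb⟩ := hD ξ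
    refine ⟨fun x => G x + H x, fun x hx => ?_, ?_⟩
    · filter_upwards [hG x hx, hH x hx, Lp.coeFn_add (G x) (H x)] with Y h1 h2 h3
      rw [h3, Pi.add_apply, h1, h2]
      ring
    · rw [add_mul]
      exact hGb.add hU.2 hHb
  | @smul s f c _ ih =>
    obtain ⟨C, hC0, hC⟩ := ih k
    refine ⟨‖c‖ * C, by positivity, fun ξ => ?_⟩
    exact scal c k (mul_nonneg hC0 (japanese_rpow_pos _ _).le) (by rw [mul_assoc]) (hC ξ)
  | @mono s f _ ih =>
    obtain ⟨C, hC0, hC⟩ := ih k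
    refine ⟨C, hC0, fun ξ => ?_⟩
    obtain ⟨G, hG, hGb⟩ := hC ξ
    refine ⟨G, hG, hGb.mono ?_⟩
    gcongr
    · exact one_le_japanese ξ
    · omega
  | @congr s f g _ hfg ih =>
    obtain ⟨C, hC0, hC⟩ := ih k
    refine ⟨C, hC0, fun ξ => ?_⟩
    obtain ⟨G, hG, hGb⟩ := hC ξ
    refine ⟨G, fun x hx => (hG x hx).trans ?_, hGb⟩
    have hmeas : MeasurableSet (orthant q) := by
      have : orthant q = ⋂ j, {Y | 0 ≤ Y j} := by ext; simp [orthant]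
      rw [this]
      exact MeasurableSet.iInter fun j => measurableSet_le measurable_const (measurable_pi_apply j)
    refine (ae_restrict_iff' hmeas).2 (Eventually.of_forall fun Y hY => ?_)
    simp only []
    rw [hfg x hx ⟨mem_univ _, hY⟩]

/-! ### Point evaluations as functionals on `L²` -/

/-- A function on a half-line is an average of itself and its derivative over a unit interval. -/
theorem eq_integral_unit_interval {φ φ' : ℝ → ℂ} {a : ℝ} (ha : 0 ≤ a)
    (hφ : ∀ t, 0 ≤ t → HasDerivWithinAt φ (φ' t) (Ici 0) t) (hφ' : ContinuousOn φ' (Ici 0)) :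
    φ a = (∫ t in Icc a (a + 1), φ t) + ∫ t in Icc a (a + 1), ((t - a - 1 : ℝ) : ℂ) * φ' t := by
  have hsub : Icc a (a + 1) ⊆ Ici 0 := fun t ht => ha.trans ht.1
  have hc : ContinuousOn φ (Ici 0) := fun t ht => (hφ t ht).continuousWithinAt
  have hl : Continuous fun t : ℝ => ((t - a - 1 : ℝ) : ℂ) := by fun_prop
  have i1 : IntegrableOn φ (Icc a (a + 1)) := (hc.mono hsub).integrableOn_compact isCompact_Icc
  have i2 : IntegrableOn (fun t => ((t - a - 1 : ℝ) : ℂ) * φ' t) (Icc a (a + 1)) :=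
    (hl.continuousOn.mul (hφ'.mono hsub)).integrableOn_compact isCompact_Icc
  have hle : a ≤ a + 1 := by linarith
  -- The weight t - a - 1 equals -1 at the left endpoint and 0 at the right one, so only φ(a)
  -- survives as a boundary term.
  have key := intervalIntegral.integral_eq_sub_of_hasDerivAt_of_le hle
    (f := fun t => ((t - a - 1 : ℝ) : ℂ) * φ t)
    (f' := fun t => φ t + ((t - a - 1 : ℝ) : ℂ) * φ' t)
    (hl.continuousOn.mul (hc.mono hsub)) (fun t ht => ?_) ?_
  · rw [intervalIntegral.integral_of_le hle, ← integral_Icc_eq_integral_Ioc,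
      integral_add i1 i2] at key
    rw [key]
    push_cast; ring
  · have h1 : HasDerivAt (fun t : ℝ => ((t - a - 1 : ℝ) : ℂ)) ((1 : ℝ) : ℂ) t :=
      (((hasDerivAt_id t).sub_const a).sub_const 1).ofReal_comp
    have h2 : HasDerivAt φ (φ' t) t :=
      (hφ t (ha.trans ht.1.le)).hasDerivAt (Ici_mem_nhds (ha.trans_lt ht.1))
    exact (h1.mul h2).congr_deriv (by simp)
  · rw [intervalIntegrable_iff_integrableOn_Icc_of_le hle]
    exact i1.add i2

/-- Iterated derivatives in the `Y`-variables. -/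
def listPdY {d q : ℕ} (l : List (Fin q)) (f : EuclideanSpace ℝ (Fin d) × (Fin q → ℝ) → ℂ) :
    EuclideanSpace ℝ (Fin d) × (Fin q → ℝ) → ℂ :=
  l.foldr (fun j g => pd (dirY j) g) f

/-- Values of a smooth function on `[0, ∞)^q` are sums of weighted averages, over unit cubes, of
derivatives of order at most `q`. -/
def HasPointFormula (q : ℕ) : Prop :=
  ∃ (l : Bool × Bool → List (Fin q)) (c : Bool × Bool → (Fin q → ℝ) → ℝ),
    (∀ i, (l i).length ≤ q) ∧ (∀ i, Continuous (c i)) ∧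
    (∀ i, ∀ Y ∈ Icc (0 : Fin q → ℝ) 1, |c i Y| ≤ 1) ∧
    ∀ {d : ℕ} {f : EuclideanSpace ℝ (Fin d) × (Fin q → ℝ) → ℂ}, ContDiffOn ℝ ∞ f (domVY d q) →
      ∀ ξ : EuclideanSpace ℝ (Fin d), ∀ Y ∈ orthant q,
        f (ξ, Y) = ∑ i, ∫ Y' in Icc Y (Y + 1), (c i (Y' - Y) : ℂ) * listPdY (l i) f (ξ, Y')

theorem hasDerivWithinAt_update {d q : ℕ} {f : EuclideanSpace ℝ (Fin d) × (Fin q → ℝ) → ℂ}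
    (hf : ContDiffOn ℝ ∞ f (domVY d q)) (ξ : EuclideanSpace ℝ (Fin d)) {Y : Fin q → ℝ}
    (hY : Y ∈ orthant q) (j : Fin q) {t : ℝ} (ht : 0 ≤ t) :
    HasDerivWithinAt (fun t => f (ξ, Function.update Y j t))
      (pd (dirY j) f (ξ, Function.update Y j t)) (Ici 0) t := by
  have hmem : ∀ t : ℝ, 0 ≤ t → (ξ, Function.update Y j t) ∈ domVY d q := fun t ht =>
    ⟨mem_univ _, fun i => by
      by_cases h : i = j
      · subst h; simpa using ht
      · simpa [h] using hY i⟩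
  have h1 := (hf.differentiableOn (by simp) _ (hmem t ht)).hasFDerivWithinAt
  have h2 : HasDerivWithinAt (fun t : ℝ => (ξ, Function.update Y j t)) (dirY j) (Ici 0) t := by
    have := ((hasDerivAt_const t ξ).prodMk (hasDerivAt_update Y j t))
    exact this.hasDerivWithinAt
  exact h1.comp_hasDerivWithinAt t h2 (fun t ht => hmem t ht)

theorem hasPointFormula_one : HasPointFormula 1 := by
  -- One variable needs two terms only. The two indices with first entry false are given weight 0.
  refine ⟨fun i => if i.1 then (if i.2 then [0] else []) else [],
    fun i Y => if i.1 then (if i.2 then Y 0 - 1 else 1) else 0, ?_, ?_, ?_, ?_⟩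
  · rintro ⟨_ | _, _ | _⟩ <;> simp
  · rintro ⟨_ | _, _ | _⟩ <;> simp <;> fun_prop
  · rintro ⟨_ | _, _ | _⟩ Y hY <;> simp
    rw [abs_le]
    have h1 := hY.1 0; have h2 := hY.2 0
    simp at h1 h2
    constructor <;> linarith
  · intro d f hf ξ Y hY
    have hu : ∀ t, Function.update Y 0 t = fun _ => t := fun t => by
      ext i; fin_cases i; simp
    have e1 : ∀ g : (Fin 1 → ℝ) → ℂ, ∫ Y' in Icc Y (Y + 1), g Y' =
        ∫ t in Icc (Y 0) (Y 0 + 1), g (fun _ => t) := by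
      intro g
      have mp := (volume_preserving_funUnique (Fin 1) ℝ).symm
      have h := mp.setIntegral_preimage_emb (MeasurableEquiv.measurableEmbedding _) g
        (Icc Y (Y + 1))
      refine h.symm.trans ?_
      have hs : (MeasurableEquiv.funUnique (Fin 1) ℝ).symm ⁻¹' Icc Y (Y + 1)
          = Icc (Y 0) (Y 0 + 1) := by
        ext t
        simp [Pi.le_def]
      rw [hs]
      rfl
    have key := eq_integral_unit_interval (φ := fun t => f (ξ, Function.update Y 0 t))
      (φ' := fun t => pd (dirY 0) f (ξ, Function.update Y 0 t)) (hY 0)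
      (fun t ht => hasDerivWithinAt_update hf ξ hY 0 ht)
      (fun t ht => (hasDerivWithinAt_update (contDiffOn_pd hf _) ξ hY 0 ht).continuousWithinAt)
    rw [Function.update_eq_self] at key
    rw [key]
    simp only [Fintype.sum_prod_type, Fintype.sum_bool, listPdY, e1, hu]
    simp
    ring

theorem hasPointFormula_two : HasPointFormula 2 := by
  refine ⟨fun i => (if i.1 then [0] else []) ++ (if i.2 then [1] else []),
    fun i Y => (if i.1 then Y 0 - 1 else 1) * (if i.2 then Y 1 - 1 else 1), ?_, ?_, ?_, ?_⟩
  · rintro ⟨_ | _, _ | _⟩ <;> simp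
  · rintro ⟨_ | _, _ | _⟩ <;> simp <;> fun_prop
  · rintro ⟨i, j⟩ Y hY
    have h : ∀ (b : Bool) (k : Fin 2), |if b then Y k - 1 else 1| ≤ 1 := by
      rintro (_ | _) k
      · simp
      · have h1 := hY.1 k; have h2 := hY.2 k
        simp at h1 h2
        simp only [if_true, abs_le]
        constructor <;> linarith
    rw [abs_mul]
    exact mul_le_one₀ (h i 0) (abs_nonneg _) (h j 1)
  · intro d f hf ξ Y hY
    have hsub : Icc Y (Y + 1) ⊆ orthant 2 := fun Z hZ j => (hY j).trans (hZ.1 j)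
    have hcont : ∀ g : EuclideanSpace ℝ (Fin d) × (Fin 2 → ℝ) → ℂ, ContDiffOn ℝ ∞ g (domVY d 2) →
        ContinuousOn (fun Z => g (ξ, Z)) (Icc Y (Y + 1)) := fun g hg =>
      hg.continuousOn.comp (by fun_prop) fun Z hZ => ⟨mem_univ _, hsub hZ⟩
    have e1 : ∀ g : (Fin 2 → ℝ) → ℂ, ContinuousOn g (Icc Y (Y + 1)) →
        ∫ Y' in Icc Y (Y + 1), g Y' =
        ∫ s in Icc (Y 0) (Y 0 + 1), ∫ t in Icc (Y 1) (Y 1 + 1), g ![s, t] := by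
      intro g hg
      have mp := (volume_preserving_finTwoArrow ℝ).symm
      have h := mp.setIntegral_preimage_emb (MeasurableEquiv.measurableEmbedding _) g
        (Icc Y (Y + 1))
      have hs : (MeasurableEquiv.finTwoArrow (α := ℝ)).symm ⁻¹' Icc Y (Y + 1)
          = Icc (Y 0) (Y 0 + 1) ×ˢ Icc (Y 1) (Y 1 + 1) := by
        ext t
        simp [Pi.le_def, Fin.forall_fin_two, Prod.le_def]
      rw [← h, hs]
      have hi : IntegrableOn (fun x : ℝ × ℝ => g ![x.1, x.2])
          (Icc (Y 0) (Y 0 + 1) ×ˢ Icc (Y 1) (Y 1 + 1)) (volume.prod volume) := by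
        refine ContinuousOn.integrableOn_compact (isCompact_Icc.prod isCompact_Icc) ?_
        refine hg.comp (Continuous.continuousOn (by
          refine continuous_pi fun i => ?_
          fin_cases i <;> simp <;> fun_prop)) fun x hx => ?_
        rw [← hs] at hx
        exact hx
      exact setIntegral_prod (fun x : ℝ × ℝ => g ![x.1, x.2]) hi
    have m0 : ∀ s, 0 ≤ s → Function.update Y 0 s ∈ orthant 2 := fun s hs j => by
      fin_cases j
      · simpa using hs
      · simpa using hY 1
    have hu0 : ∀ s, Function.update Y 0 s = ![s, Y 1] := fun s => by
      ext i; fin_cases i <;> simp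
    have hu1 : ∀ s t, Function.update (![s, Y 1] : Fin 2 → ℝ) 1 t = ![s, t] := fun s t => by
      ext i; fin_cases i <;> simp
    have k1 : ∀ g, ContDiffOn ℝ ∞ g (domVY d 2) → g (ξ, Y) =
        (∫ s in Icc (Y 0) (Y 0 + 1), g (ξ, ![s, Y 1])) +
        ∫ s in Icc (Y 0) (Y 0 + 1), ((s - Y 0 - 1 : ℝ) : ℂ) * pd (dirY 0) g (ξ, ![s, Y 1]) := by
      intro g hg
      have key := eq_integral_unit_interval (φ := fun t => g (ξ, Function.update Y 0 t))
        (φ' := fun t => pd (dirY 0) g (ξ, Function.update Y 0 t)) (hY 0)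
        (fun t ht => hasDerivWithinAt_update hg ξ hY 0 ht)
        (fun t ht => (hasDerivWithinAt_update (contDiffOn_pd hg _) ξ hY 0 ht).continuousWithinAt)
      simp only [Function.update_eq_self, hu0] at key
      exact key
    have k2 : ∀ g, ContDiffOn ℝ ∞ g (domVY d 2) → ∀ s, 0 ≤ s → g (ξ, ![s, Y 1]) =
        (∫ t in Icc (Y 1) (Y 1 + 1), g (ξ, ![s, t])) +
        ∫ t in Icc (Y 1) (Y 1 + 1), ((t - Y 1 - 1 : ℝ) : ℂ) * pd (dirY 1) g (ξ, ![s, t]) := by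
      intro g hg s hs
      have hm := hu0 s ▸ m0 s hs
      have key := eq_integral_unit_interval
        (φ := fun t => g (ξ, Function.update (![s, Y 1] : Fin 2 → ℝ) 1 t))
        (φ' := fun t => pd (dirY 1) g (ξ, Function.update (![s, Y 1] : Fin 2 → ℝ) 1 t)) (hY 1)
        (fun t ht => hasDerivWithinAt_update hg ξ hm 1 ht)
        (fun t ht => (hasDerivWithinAt_update (contDiffOn_pd hg _) ξ hm 1 ht).continuousWithinAt)
      simp only [hu1] at key
      exact key
    -- The formula in the second variable is inserted under the integral over the first one. The
    -- weight c is 1 or s - Y 0 - 1, according to the term produced by the first variable.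
    have k3 : ∀ (g : EuclideanSpace ℝ (Fin d) × (Fin 2 → ℝ) → ℂ) (c : ℝ → ℝ), Continuous c →
        ContDiffOn ℝ ∞ g (domVY d 2) →
        ∫ s in Icc (Y 0) (Y 0 + 1), (c s : ℂ) * g (ξ, ![s, Y 1]) =
        (∫ Y' in Icc Y (Y + 1), (c (Y' 0) : ℂ) * g (ξ, Y')) + ∫ Y' in Icc Y (Y + 1),
          (c (Y' 0) : ℂ) * (((Y' 1 - Y 1 - 1 : ℝ) : ℂ) * pd (dirY 1) g (ξ, Y')) := by
      intro g c hc hg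
      have c1 : ContinuousOn (fun Y' : Fin 2 → ℝ => (c (Y' 0) : ℂ) * g (ξ, Y')) (Icc Y (Y + 1)) :=
        ContinuousOn.mul (by fun_prop) (hcont g hg)
      have c2 : ContinuousOn (fun Y' : Fin 2 → ℝ =>
          (c (Y' 0) : ℂ) * (((Y' 1 - Y 1 - 1 : ℝ) : ℂ) * pd (dirY 1) g (ξ, Y'))) (Icc Y (Y + 1)) :=
        ContinuousOn.mul (by fun_prop)
          (ContinuousOn.mul (by fun_prop) (hcont _ (contDiffOn_pd hg _)))
      rw [← integral_add (c1.integrableOn_compact isCompact_Icc)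
        (c2.integrableOn_compact isCompact_Icc)]
      refine Eq.trans ?_ (e1 _ (c1.add c2)).symm
      refine setIntegral_congr_fun measurableSet_Icc fun s hs => ?_
      have hs0 : 0 ≤ s := (hY 0).trans hs.1
      have cs : ∀ u : EuclideanSpace ℝ (Fin d) × (Fin 2 → ℝ) → ℂ, ContDiffOn ℝ ∞ u (domVY d 2) →
          ContinuousOn (fun t => u (ξ, ![s, t])) (Icc (Y 1) (Y 1 + 1)) := fun u hu =>
        hu.continuousOn.comp (Continuous.continuousOn (continuous_const.prodMk (continuous_pi
          fun i => by fin_cases i <;> simp <;> fun_prop))) fun t ht => ⟨mem_univ _, fun i => by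
            have := (hY 1).trans ht.1
            fin_cases i <;> simpa⟩
      change (c s : ℂ) * g (ξ, ![s, Y 1]) = ∫ t in Icc (Y 1) (Y 1 + 1), ((c s : ℂ) * g (ξ, ![s, t]) +
        (c s : ℂ) * (((t - Y 1 - 1 : ℝ) : ℂ) * pd (dirY 1) g (ξ, ![s, t])))
      have i1 : IntegrableOn (fun t => g (ξ, ![s, t])) (Icc (Y 1) (Y 1 + 1)) :=
        (cs g hg).integrableOn_compact isCompact_Icc
      have i2 : IntegrableOn (fun t => ((t - Y 1 - 1 : ℝ) : ℂ) * pd (dirY 1) g (ξ, ![s, t]))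
          (Icc (Y 1) (Y 1 + 1)) :=
        (ContinuousOn.mul (by fun_prop) (cs _ (contDiffOn_pd hg _))).integrableOn_compact
          isCompact_Icc
      rw [k2 g hg s hs0, ← integral_add i1 i2, ← integral_const_mul]
      simp only [mul_add]
    have a1 := k3 f (fun _ => 1) continuous_const hf
    have a2 := k3 (pd (dirY 0) f) (fun s => s - Y 0 - 1) (by fun_prop) (contDiffOn_pd hf _)
    simp only [Complex.ofReal_one, one_mul] at a1
    rw [k1 f hf, a1, a2]
    simp only [Fintype.sum_prod_type, Fintype.sum_bool, listPdY]
    simp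
    rw [pd_comm hf (dirY 0) (dirY 1)]
    simp only [mul_assoc]
    ring

theorem HolderBound.sum {E F ι : Type} [NormedAddCommGroup E] [NormedSpace ℝ E]
    [NormedAddCommGroup F] [NormedSpace ℝ F] {τ : ℝ}
    {U : Set E} (hU : UniqueDiffOn ℝ U) (t : Finset ι) {f : ι → E → F} {C : ι → ℝ}
    (hf : ∀ i ∈ t, HolderBound τ U (f i) (C i)) :
    HolderBound τ U (fun x => ∑ i ∈ t, f i x) (∑ i ∈ t, C i) := by
  classical
  induction t using Finset.induction_on with
  | empty => simpa using holderBound_iff.2 (HolderCtrl.const hU _ (0 : F))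
  | insert i t hi ih =>
    simp only [Finset.sum_insert hi]
    exact (hf i (Finset.mem_insert_self i t)).add hU
      (ih fun j hj => hf j (Finset.mem_insert_of_mem hj))

/-- Weighted averages over unit cubes are bounded functionals on `L²`. -/
theorem exists_average_functional {q : ℕ} {c : (Fin q → ℝ) → ℝ} (hc : Continuous c)
    (hc1 : ∀ Y ∈ Icc (0 : Fin q → ℝ) 1, |c Y| ≤ 1) {Y : Fin q → ℝ} (hY : Y ∈ orthant q) :
    ∃ L : Lp ℂ 2 (volume.restrict (orthant q)) →L[ℝ] ℂ, ‖L‖ ≤ 1 ∧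
      ∀ (g : Lp ℂ 2 (volume.restrict (orthant q))) (F : (Fin q → ℝ) → ℂ),
        g =ᵐ[volume.restrict (orthant q)] F →
        L g = ∫ Y' in Icc Y (Y + 1), (c (Y' - Y) : ℂ) * F Y' := by
  set μ := volume.restrict (orthant q)
  set w : (Fin q → ℝ) → ℂ := (Icc Y (Y + 1)).indicator fun Y' => (c (Y' - Y) : ℂ) with hw
  have hsub : Icc Y (Y + 1) ⊆ orthant q := fun Z hZ j => (hY j).trans (hZ.1 j)
  have hμ : μ (Icc Y (Y + 1)) ≤ 1 := by
    refine (Measure.restrict_apply_le _ _).trans ?_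
    rw [Real.volume_Icc_pi]
    simp
  have hwm : AEStronglyMeasurable w μ := by
    refine AEStronglyMeasurable.indicator ?_ measurableSet_Icc
    exact Continuous.aestronglyMeasurable (by fun_prop)
  have hwle : ∀ Z, ‖w Z‖ ≤ ‖(Icc Y (Y + 1)).indicator (fun _ => (1 : ℝ)) Z‖ := fun Z => by
    by_cases hZ : Z ∈ Icc Y (Y + 1)
    · simp only [hw, indicator_of_mem hZ, Complex.norm_real, Real.norm_eq_abs, abs_one]
      refine hc1 _ ⟨sub_nonneg.2 hZ.1, ?_⟩
      rw [sub_le_iff_le_add, add_comm]; exact hZ.2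
    · simp [hw, indicator_of_notMem hZ]
  have hind : eLpNorm ((Icc Y (Y + 1)).indicator (fun _ => (1 : ℝ))) 2 μ ≤ 1 := by
    refine (eLpNorm_indicator_const_le _ _).trans ?_
    simp only [enorm_one, one_mul]
    exact ENNReal.rpow_le_one hμ (by simp)
  have hwn : eLpNorm w 2 μ ≤ 1 :=
    (eLpNorm_mono_ae (Eventually.of_forall hwle)).trans hind
  have hwL : MemLp w 2 μ := ⟨hwm, hwn.trans_lt ENNReal.one_lt_top⟩
  -- The average is the L² pairing with w, which is real, so conjugation is invisible. Its norm is
  -- at most 1, since |w| ≤ 1 on a cube of measure at most 1.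
  refine ⟨(innerSL ℂ (hwL.toLp w)).restrictScalars ℝ, ?_, fun g F hg => ?_⟩
  · rw [ContinuousLinearMap.norm_restrictScalars, innerSL_apply_norm, Lp.norm_toLp]
    exact ENNReal.toReal_le_of_le_ofReal zero_le_one (by simpa using hwn)
  · rw [ContinuousLinearMap.coe_restrictScalars', innerSL_apply_apply, L2.inner_def]
    have e : ∫ Z, inner ℂ ((hwL.toLp w : Lp ℂ 2 μ) Z) (g Z) ∂μ
        = ∫ Z, (Icc Y (Y + 1)).indicator (fun Z => (c (Z - Y) : ℂ) * F Z) Z ∂μ := by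
      refine integral_congr_ae ?_
      filter_upwards [hwL.coeFn_toLp, hg] with Z h1 h2
      rw [h1, h2]
      by_cases hZ : Z ∈ Icc Y (Y + 1)
      · simp only [hw, indicator_of_mem hZ]
        simp [mul_comm]
      · simp [hw, indicator_of_notMem hZ]
    rw [e, integral_indicator measurableSet_Icc, Measure.restrict_restrict measurableSet_Icc,
      inter_eq_left.2 hsub]

theorem SymClass.listPdY {E : Type} {d q : ℕ} {U : Set E}
    {h f : E → EuclideanSpace ℝ (Fin d) × (Fin q → ℝ) → ℂ} {s : ℤ}
    (hh : ∀ x ∈ U, ContDiffOn ℝ ∞ (h x) (domVY d q)) (hf : SymClass U h s f)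
    (l : List (Fin q)) : SymClass U h (s + l.length) (fun x => listPdY l (f x)) := by
  induction l with
  | nil => simpa [NonsmoothGreen.listPdY] using hf
  | cons j l ih => exact (ih.pd_dirY hh j).of_eq (by push_cast [List.length_cons]; ring)

namespace SymClass

variable {E : Type} [NormedAddCommGroup E] [NormedSpace ℝ E] {d q : ℕ} {U : Set E} {τ m : ℝ}
  {h f : E → EuclideanSpace ℝ (Fin d) × (Fin q → ℝ) → ℂ} {s : ℤ}

/-- Pointwise bounds for all elements of the algebra generated by a symbol-kernel. -/
theorem exists_bound (hU : IsCornerDomain U) (hq : HasPointFormula q)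
    (hh : IsSymbolKernel τ m U h) (hf : SymClass U h s f) :
    ∃ C : ℝ, 0 ≤ C ∧ ∀ p ∈ domVY d q,
      HolderBound τ U (fun x => f x p) (C * japanese p.1 ^ (m + (q : ℝ) / 2 + q + s)) := by
  obtain ⟨l, c, hl, hc, hc1, hform⟩ := hq
  -- At most q derivatives in Y occur, each raising the order by one. This is the loss q in the
  -- exponent.
  choose C hC0 hC using fun i => (hf.listPdY hh.smooth (l i)).exists_l2_bound hU hh 0
  refine ⟨∑ i, C i, Finset.sum_nonneg fun i _ => hC0 i, ?_⟩
  rintro ⟨ξ, Y⟩ hp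
  choose G hG hGb using fun i => hC i ξ
  choose L hL hLv using fun i => exists_average_functional (hc i) (hc1 i) hp.2
  have key : ∀ i, HolderBound τ U (fun x => L i (G i x))
      (C i * japanese ξ ^ (m + (q : ℝ) / 2 + q + s)) := fun i => by
    refine (hGb i).clm_comp hU.2 (L i) ?_
    have h0 := mul_nonneg (hC0 i) (japanese_rpow_pos ξ
      (m + (q : ℝ) / 2 + (s + (l i).length : ℤ) - (∑ j, (0 : Fin q → ℕ) j : ℕ))).le
    refine (mul_le_of_le_one_left h0 (hL i)).trans ?_
    gcongr
    · exact hC0 i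
    · exact one_le_japanese ξ
    · have : ((l i).length : ℝ) ≤ q := by exact_mod_cast hl i
      push_cast
      simp
      linarith
  have := HolderBound.sum hU.2 Finset.univ (fun i _ => key i)
  rw [← Finset.sum_mul] at this
  refine this.congr fun x hx => ?_
  simp only
  rw [hform (hf.contDiffOn hh.smooth hx) ξ Y hp.2]
  refine Finset.sum_congr rfl fun i _ => (hLv i _ _ ?_).symm
  refine (hG i x hx).trans (Eventually.of_forall fun Z => ?_)
  simp [monomial]

end SymClass

/-! ### Cutoff functions -/

/-- The domain `ℝ^d × (ℝ^d × [0, ∞)^q)` of the variables `(x', (z', Y))`. -/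
def domCutoff (d q : ℕ) :
    Set (EuclideanSpace ℝ (Fin d) × (EuclideanSpace ℝ (Fin d) × (Fin q → ℝ))) :=
  univ ×ˢ domVY d q

theorem IsCornerDomain.domCutoff (d q : ℕ) : IsCornerDomain (domCutoff d q) :=
  IsCornerDomain.univ.prod (IsCornerDomain.domVY d q)

/-- Functions of `(x', (z', Y))` that are smooth and bounded with all derivatives and vanish near
each of the points `(x', 0)`. -/
structure IsCutoff {d q : ℕ}
    (W : EuclideanSpace ℝ (Fin d) × (EuclideanSpace ℝ (Fin d) × (Fin q → ℝ)) → ℂ) : Prop where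
  isSmoothBounded : IsSmoothBounded (domCutoff d q) W
  eventually_eq_zero : ∀ x', ∀ᶠ y in 𝓝[domCutoff d q] (x', 0), W y = 0

namespace IsCutoff

variable {d q : ℕ} {W : EuclideanSpace ℝ (Fin d) × (EuclideanSpace ℝ (Fin d) × (Fin q → ℝ)) → ℂ}

/-- The derivative of a cutoff function in a direction of the `(z', Y)`-space. -/
def deriv (W : EuclideanSpace ℝ (Fin d) × (EuclideanSpace ℝ (Fin d) × (Fin q → ℝ)) → ℂ)
    (v : EuclideanSpace ℝ (Fin d) × (Fin q → ℝ)) :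
    EuclideanSpace ℝ (Fin d) × (EuclideanSpace ℝ (Fin d) × (Fin q → ℝ)) → ℂ :=
  fun y => fderivWithin ℝ W (domCutoff d q) y (0, v)

/-- The average of a cutoff function over the segment from `0` to `(z', Y)`. -/
def avg (W : EuclideanSpace ℝ (Fin d) × (EuclideanSpace ℝ (Fin d) × (Fin q → ℝ)) → ℂ) :
    EuclideanSpace ℝ (Fin d) × (EuclideanSpace ℝ (Fin d) × (Fin q → ℝ)) → ℂ :=
  fun y => ∫ t in Icc (0 : ℝ) 1, W (y.1, t • y.2)

theorem zero_mem_domVY : (0 : EuclideanSpace ℝ (Fin d) × (Fin q → ℝ)) ∈ domVY d q :=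
  ⟨mem_univ _, fun _ => le_rfl⟩

theorem smul_mem_domVY {p : EuclideanSpace ℝ (Fin d) × (Fin q → ℝ)} (hp : p ∈ domVY d q) {t : ℝ}
    (ht : 0 ≤ t) : t • p ∈ domVY d q :=
  ⟨mem_univ _, fun j => mul_nonneg ht (hp.2 j)⟩

theorem eq_zero (h : IsCutoff W) (x' : EuclideanSpace ℝ (Fin d)) : W (x', 0) = 0 :=
  (h.eventually_eq_zero x').self_of_nhdsWithin ⟨mem_univ _, zero_mem_domVY⟩

/-- Vanishing near (x', 0) is a property of the germ, so it passes to derivatives. -/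
theorem isCutoff_deriv (h : IsCutoff W) (v : EuclideanSpace ℝ (Fin d) × (Fin q → ℝ)) :
    IsCutoff (deriv W v) := by
  refine ⟨h.1.fderivWithin_apply (IsCornerDomain.domCutoff d q) _, fun x' => ?_⟩
  have h1 : W =ᶠ[𝓝[domCutoff d q] (x', 0)] fun _ => 0 := h.2 x'
  filter_upwards [h1.fderivWithin (𝕜 := ℝ)] with y hy
  rw [deriv, hy]
  simp

theorem hasFDerivWithinAt (h : IsCutoff W) (x' : EuclideanSpace ℝ (Fin d))
    {p : EuclideanSpace ℝ (Fin d) × (Fin q → ℝ)} (hp : p ∈ domVY d q) :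
    HasFDerivWithinAt (fun p => W (x', p))
      (linForm (fun i => deriv W (dirZ i) (x', p)) (fun j => deriv W (dirY j) (x', p)))
      (domVY d q) p := by
  have h1 := (h.1.contDiffOn.differentiableOn (by simp) (x', p)
    ⟨mem_univ _, hp⟩).hasFDerivWithinAt
  have h2 : HasFDerivWithinAt (fun p : EuclideanSpace ℝ (Fin d) × (Fin q → ℝ) => (x', p))
      (ContinuousLinearMap.inr ℝ _ _) (domVY d q) p := (hasFDerivAt_prodMk_right x' p).hasFDerivWithinAt
  have h3 := h1.comp p h2 (fun p hp => ⟨mem_univ _, hp⟩)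
  rw [eq_linForm ((fderivWithin ℝ W (domCutoff d q) (x', p)).comp _)] at h3
  exact h3

/-- The maps (x', p) ↦ (x', t p) with 0 ≤ t ≤ 1 have norm at most 1 and preserve the domain, so the
bounds are uniform in t. They also keep each ball around (x', 0) within itself, so the vanishing
near that point persists. -/
theorem isCutoff_avg (h : IsCutoff W) : IsCutoff (avg W) := by
  have hS := IsCornerDomain.domCutoff d q
  refine ⟨fun r => ?_, fun x' => ?_⟩
  · obtain ⟨C, hC, hW⟩ := h.1 r
    have hi : Integrable (fun _ : ℝ => C * 2 ^ r) (volume.restrict (Icc (0 : ℝ) 1)) :=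
      integrable_const _
    refine ⟨∫ _ in Icc (0 : ℝ) 1, C * 2 ^ r, by positivity,
      HolderCtrl.integral_of_ae hS hi (f := fun t y => W (y.1, t • y.2)) ?_ ?_⟩
    · refine (ae_restrict_iff' measurableSet_Icc).2 (Eventually.of_forall fun t ht => ?_)
      set L : EuclideanSpace ℝ (Fin d) × (EuclideanSpace ℝ (Fin d) × (Fin q → ℝ)) →L[ℝ]
          EuclideanSpace ℝ (Fin d) × (EuclideanSpace ℝ (Fin d) × (Fin q → ℝ)) :=
        (ContinuousLinearMap.fst ℝ _ _).prod (t • ContinuousLinearMap.snd ℝ _ _) with hL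
      have hn : ‖L‖ ≤ 1 := by
        refine ContinuousLinearMap.opNorm_le_bound _ zero_le_one fun y => ?_
        rw [one_mul]
        refine max_le (norm_fst_le y) ?_
        change ‖t • y.2‖ ≤ _
        rw [norm_smul, Real.norm_eq_abs, abs_of_nonneg ht.1]
        exact (mul_le_of_le_one_left (norm_nonneg _) ht.2).trans (norm_snd_le y)
      have := hW.comp_affine hS.2 hS.2 L 0
        (fun y hy => by simpa [hL] using ⟨mem_univ _, smul_mem_domVY hy.2 ht.1⟩) hC
      simp only [add_zero] at this
      refine this.mono ?_
      gcongr
      linarith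
    · intro y hy
      refine ContinuousOn.aestronglyMeasurable ?_ measurableSet_Icc
      exact h.1.contDiffOn.continuousOn.comp (by fun_prop)
        fun t ht => ⟨mem_univ _, smul_mem_domVY hy.2 ht.1⟩
  · obtain ⟨ε, hε, hW⟩ := Metric.mem_nhdsWithin_iff.1 (h.2 x')
    refine Metric.mem_nhdsWithin_iff.2 ⟨ε, hε, ?_⟩
    rintro y ⟨hy, hyS⟩
    refine (setIntegral_congr_fun (g := fun _ => (0 : ℂ)) measurableSet_Icc fun t ht => ?_).trans
      (by simp)
    refine hW ⟨?_, mem_univ _, smul_mem_domVY hyS.2 ht.1⟩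
    rw [Metric.mem_ball, Prod.dist_eq, max_lt_iff] at hy ⊢
    refine ⟨hy.1, ?_⟩
    have h2 := hy.2
    simp only [dist_zero_right] at h2 ⊢
    rw [norm_smul, Real.norm_eq_abs, abs_of_nonneg ht.1]
    exact (mul_le_of_le_one_left (norm_nonneg _) ht.2).trans_lt h2

/-- Hadamard's lemma. -/
theorem eq_sum_avg (h : IsCutoff W) (x' : EuclideanSpace ℝ (Fin d))
    {p : EuclideanSpace ℝ (Fin d) × (Fin q → ℝ)} (hp : p ∈ domVY d q) :
    W (x', p) = ∑ i, (p.1 i : ℂ) * avg (deriv W (dirZ i)) (x', p) +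
      ∑ j, (p.2 j : ℂ) * avg (deriv W (dirY j)) (x', p) := by
  have hmaps : ∀ t ∈ Icc (0 : ℝ) 1, t • p ∈ domVY d q := fun t ht => smul_mem_domVY hp ht.1
  have hd : ∀ t ∈ Icc (0 : ℝ) 1, HasDerivWithinAt (fun t : ℝ => W (x', t • p))
      (linForm (fun i => deriv W (dirZ i) (x', t • p)) (fun j => deriv W (dirY j) (x', t • p)) p)
      (Icc 0 1) t := by
    intro t ht
    have h1 : HasDerivWithinAt (fun t : ℝ => t • p) p (Icc 0 1) t := by
      simpa using ((hasDerivAt_id t).smul_const p).hasDerivWithinAt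
    exact (h.hasFDerivWithinAt x' (hmaps t ht)).comp_hasDerivWithinAt t h1 hmaps
  have hc : ∀ v, ContinuousOn (fun t : ℝ => deriv W v (x', t • p)) (Icc 0 1) := fun v =>
    (h.isCutoff_deriv v).1.contDiffOn.continuousOn.comp (by fun_prop)
      fun t ht => ⟨mem_univ _, hmaps t ht⟩
  have hci : ∀ v, IntegrableOn (fun t : ℝ => deriv W v (x', t • p)) (Icc 0 1) := fun v =>
    (hc v).integrableOn_compact isCompact_Icc
  have hcs : ∀ (c : ℝ) v, IntegrableOn (fun t : ℝ => c • deriv W v (x', t • p)) (Icc 0 1) :=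
    fun c v => (hci v).smul c
  have hz : IntegrableOn (fun t : ℝ => ∑ i, p.1 i • deriv W (dirZ i) (x', t • p)) (Icc 0 1) :=
    integrable_finsetSum _ fun i _ => hcs _ _
  have hy : IntegrableOn (fun t : ℝ => ∑ j, p.2 j • deriv W (dirY j) (x', t • p)) (Icc 0 1) :=
    integrable_finsetSum _ fun i _ => hcs _ _
  -- Fundamental theorem of calculus along the segment from 0 to p, with starting value W(x', 0) =
  -- 0.
  have key := intervalIntegral.integral_eq_sub_of_hasDerivAt_of_le zero_le_one
    (f := fun t : ℝ => W (x', t • p))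
    (f' := fun t => linForm (fun i => deriv W (dirZ i) (x', t • p))
      (fun j => deriv W (dirY j) (x', t • p)) p) (fun t ht => (hd t ht).continuousWithinAt)
    (fun t ht => (hd t (Ioo_subset_Icc_self ht)).hasDerivAt (Icc_mem_nhds ht.1 ht.2)) ?_
  · rw [intervalIntegral.integral_of_le zero_le_one, ← integral_Icc_eq_integral_Ioc] at key
    simp only [one_smul, zero_smul, h.eq_zero, sub_zero, linForm_apply] at key
    rw [← key, integral_add hz hy, integral_finsetSum _ fun i _ => hcs _ _,
      integral_finsetSum _ fun i _ => hcs _ _]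
    simp only [avg, Complex.real_smul, integral_const_mul]
  · rw [intervalIntegrable_iff_integrableOn_Icc_of_le zero_le_one]
    simp only [linForm_apply]
    exact hz.add hy

end IsCutoff

/-! ### Inverse Fourier transforms of symbols -/

section LinForm

variable {d q : ℕ}

theorem norm_linForm_le (a : Fin d → ℂ) (b : Fin q → ℂ) :
    ‖linForm a b‖ ≤ ∑ i, ‖a i‖ + ∑ j, ‖b j‖ := by
  refine ContinuousLinearMap.opNorm_le_bound _ (by positivity) fun p => ?_
  rw [linForm_apply, add_mul, Finset.sum_mul, Finset.sum_mul]
  refine norm_add_le_of_le (norm_sum_le_of_le _ fun i _ => ?_) (norm_sum_le_of_le _ fun j _ => ?_)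
  · rw [norm_smul, mul_comm]
    gcongr
    exact (PiLp.norm_apply_le p.1 i).trans (norm_fst_le p)
  · rw [norm_smul, mul_comm]
    gcongr
    exact (norm_le_pi_norm p.2 j).trans (norm_snd_le p)

theorem smul_linForm (c : ℂ) (a : Fin d → ℂ) (b : Fin q → ℂ) :
    c • linForm a b = linForm (fun i => c * a i) (fun j => c * b j) := by
  refine ContinuousLinearMap.ext fun p => ?_
  simp only [smul_apply, linForm_apply, smul_eq_mul, mul_add, Finset.mul_sum,
    mul_smul_comm]

theorem continuous_linForm {X : Type*} [TopologicalSpace X] {a : X → Fin d → ℂ}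
    {b : X → Fin q → ℂ} (ha : ∀ i, Continuous fun x => a x i) (hb : ∀ j, Continuous fun x => b x j) :
    Continuous fun x => linForm (a x) (b x) := by
  unfold linForm
  refine (continuous_finsetSum _ fun i _ => ?_).add (continuous_finsetSum _ fun j _ => ?_)
  · exact (ContinuousLinearMap.smulRightL ℝ _ ℂ _).continuous.comp (ha i)
  · exact (ContinuousLinearMap.smulRightL ℝ _ ℂ _).continuous.comp (hb j)

theorem integral_linForm {X : Type*} [MeasurableSpace X] {μ : Measure X} {a : X → Fin d → ℂ}
    {b : X → Fin q → ℂ} (hab : Integrable (fun x => linForm (a x) (b x)) μ) :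
    ∫ x, linForm (a x) (b x) ∂μ = linForm (fun i => ∫ x, a x i ∂μ) (fun j => ∫ x, b x j ∂μ) := by
  rw [eq_linForm (∫ x, linForm (a x) (b x) ∂μ)]
  simp only [ContinuousLinearMap.integral_apply hab, linForm_dirZ, linForm_dirY]

end LinForm

section Fiber

variable {d q : ℕ}

/-- The character `ξ ↦ e^{i z·ξ}`. -/
def character (z ξ : EuclideanSpace ℝ (Fin d)) : ℂ := Complex.exp (Complex.I * (inner ℝ z ξ : ℝ))

theorem norm_character (z ξ : EuclideanSpace ℝ (Fin d)) : ‖character z ξ‖ = 1 := by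
  rw [character, mul_comm]
  exact Complex.norm_exp_ofReal_mul_I _

@[fun_prop]
theorem continuous_character : Continuous fun p : EuclideanSpace ℝ (Fin d) ×
    EuclideanSpace ℝ (Fin d) => character p.1 p.2 := by
  unfold character; fun_prop

theorem continuous_character_right (z : EuclideanSpace ℝ (Fin d)) : Continuous (character z) := by
  unfold character; fun_prop

theorem integrable_character_mul {g : EuclideanSpace ℝ (Fin d) → ℂ} (hg : Integrable g)
    (z : EuclideanSpace ℝ (Fin d)) : Integrable fun ξ => character z ξ * g ξ :=
  hg.mono ((continuous_character_right z).aestronglyMeasurable.mul hg.1)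
    (Eventually.of_forall fun ξ => by rw [norm_mul, norm_character, one_mul])

/-- The normalizing constant of the inverse Fourier transform. -/
def fourierConst (d : ℕ) : ℂ := (((2 * Real.pi : ℝ) ^ d)⁻¹ : ℝ)

theorem inner_single_real (z : EuclideanSpace ℝ (Fin d)) (i : Fin d) :
    inner ℝ z (EuclideanSpace.single i (1 : ℝ)) = z i := by
  simp [EuclideanSpace.inner_single_right]

/-- The inverse Fourier transform in the covariable of a function of `(x, ξ', Y)`. -/
def fiberInv {E : Type} (b : E → EuclideanSpace ℝ (Fin d) × (Fin q → ℝ) → ℂ) (x : E)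
    (p : EuclideanSpace ℝ (Fin d) × (Fin q → ℝ)) : ℂ :=
  invFourierHat (fun ξ => b x (ξ, p.2)) p.1

theorem fiberInv_eq {E : Type} (b : E → EuclideanSpace ℝ (Fin d) × (Fin q → ℝ) → ℂ) (x : E)
    (p : EuclideanSpace ℝ (Fin d) × (Fin q → ℝ)) : fiberInv b x p =
    fourierConst d * ∫ ξ, character p.1 ξ * b x (ξ, p.2) := rfl

theorem hasFDerivAt_character (z ξ : EuclideanSpace ℝ (Fin d)) :
    HasFDerivAt (fun z => character z ξ) ((character z ξ * Complex.I) •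
      (Complex.ofRealCLM.comp (innerSL ℝ ξ))) z := by
  have h1 : HasFDerivAt (fun z => Complex.I * (inner ℝ z ξ : ℝ))
      (Complex.I • (Complex.ofRealCLM.comp (innerSL ℝ ξ))) z := by
    have : (fun z => Complex.I * ((inner ℝ z ξ : ℝ) : ℂ))
        = fun z => (Complex.I • (Complex.ofRealCLM.comp (innerSL ℝ ξ))) z := by
      ext z; simp [real_inner_comm]
    rw [this]
    exact ContinuousLinearMap.hasFDerivAt _
  have := h1.cexp
  rwa [smul_smul] at this

theorem character_comm (z ξ : EuclideanSpace ℝ (Fin d)) : character z ξ = character ξ z := by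
  rw [character, character, real_inner_comm]

end Fiber

namespace SymClass

section

variable {E : Type} {d q : ℕ} {U : Set E}
  {h f : E → EuclideanSpace ℝ (Fin d) × (Fin q → ℝ) → ℂ} {s : ℤ}

theorem mulY_pow (hf : SymClass U h s f) (j : Fin q) (n : ℕ) :
    SymClass U h (s - n) (fun x p => (p.2 j : ℂ) ^ n * f x p) := by
  induction n with
  | zero => simpa using hf
  | succ n ih =>
    refine ((ih.mulY j).of_eq (by push_cast; ring)).congr fun x _ p _ => ?_
    simp only [pow_succ]; ring

theorem fiberInv_mulY (j : Fin q) (x : E) (p : EuclideanSpace ℝ (Fin d) × (Fin q → ℝ)) :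
    fiberInv (fun x p => (p.2 j : ℂ) * f x p) x p = (p.2 j : ℂ) * fiberInv f x p := by
  simp only [fiberInv_eq, mul_left_comm _ (p.2 j : ℂ), integral_const_mul]

end

variable {E : Type} [NormedAddCommGroup E] [NormedSpace ℝ E] {d q : ℕ} {U : Set E} {τ m : ℝ}
  {h f : E → EuclideanSpace ℝ (Fin d) × (Fin q → ℝ) → ℂ} {s : ℤ}

theorem exists_norm_le (hU : IsCornerDomain U) (hq : HasPointFormula q)
    (hh : IsSymbolKernel τ m U h) (hf : SymClass U h s f) :
    ∃ C : ℝ, 0 ≤ C ∧ ∀ x ∈ U, ∀ p ∈ domVY d q,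
      ‖f x p‖ ≤ C * japanese p.1 ^ (m + (q : ℝ) / 2 + q + s) := by
  obtain ⟨C, hC, hb⟩ := hf.exists_bound hU hq hh
  exact ⟨C, hC, fun x hx p hp => by simpa using (hb p hp).bound 0 (Nat.zero_le _) x hx⟩

theorem continuous_fiber (hh : IsSymbolKernel τ m U h) (hf : SymClass U h s f) {x : E} (hx : x ∈ U)
    {Y : Fin q → ℝ} (hY : Y ∈ orthant q) : Continuous fun ξ => f x (ξ, Y) :=
  (hf.contDiffOn hh.smooth hx).continuousOn.comp_continuous (by fun_prop)
    fun _ => ⟨mem_univ _, hY⟩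

/-- If Y_j > 0, then Y_j ^ n f has order s - n, and dividing by the fixed positive number Y_j ^ n
yields arbitrary decay in ξ'. Only at Y = 0 must the order itself be low. -/
theorem integrable (hU : IsCornerDomain U) (hq : HasPointFormula q)
    (hh : IsSymbolKernel τ m U h) (hf : SymClass U h s f) {x : E} (hx : x ∈ U) {Y : Fin q → ℝ}
    (hY : Y ∈ orthant q) (hs : m + (q : ℝ) / 2 + q + s < -d ∨ Y ≠ 0) :
    Integrable fun ξ => f x (ξ, Y) := by
  have hm := (hf.continuous_fiber hh hx hY).aestronglyMeasurable (μ := volume)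
  rcases hs with hs | hs
  · obtain ⟨C, hC, hb⟩ := hf.exists_norm_le hU hq hh
    exact ((integrable_japanese_rpow hs).const_mul C).mono' hm
      (Eventually.of_forall fun ξ => hb x hx (ξ, Y) ⟨mem_univ _, hY⟩)
  · obtain ⟨j, hj⟩ := Function.ne_iff.1 hs
    have hj : 0 < Y j := lt_of_le_of_ne (hY j) (Ne.symm hj)
    obtain ⟨n, hn⟩ := exists_nat_gt (m + (q : ℝ) / 2 + q + s + d)
    obtain ⟨C, hC, hb⟩ := (hf.mulY_pow j n).exists_norm_le hU hq hh
    have hlt : m + (q : ℝ) / 2 + q + (s - n : ℤ) < -d := by push_cast; linarith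
    refine ((integrable_japanese_rpow hlt).const_mul ((Y j ^ n)⁻¹ * C)).mono' hm
      (Eventually.of_forall fun ξ => ?_)
    have := hb x hx (ξ, Y) ⟨mem_univ _, hY⟩
    simp only [norm_mul, norm_pow, Complex.norm_real, Real.norm_eq_abs, abs_of_pos hj] at this
    rw [mul_assoc, ← div_eq_inv_mul, le_div_iff₀ (by positivity), mul_comm]
    exact this

/-- Hölder bounds for inverse Fourier transforms of symbols of low order. -/
theorem exists_holderBound_fiberInv [FiniteDimensional ℝ E] (hU : IsCornerDomain U)
    (hq : HasPointFormula q) (hh : IsSymbolKernel τ m U h) (hf : SymClass U h s f)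
    (hs : m + (q : ℝ) / 2 + q + s < -d) :
    ∃ C : ℝ, 0 ≤ C ∧ ∀ p ∈ domVY d q, HolderBound τ U (fun x => fiberInv f x p) C := by
  obtain ⟨C, hC, hb⟩ := hf.exists_bound hU hq hh
  set I := ∫ ξ : EuclideanSpace ℝ (Fin d), C * japanese ξ ^ (m + (q : ℝ) / 2 + q + s)
  have hI : 0 ≤ I := integral_nonneg fun ξ => mul_nonneg hC (japanese_rpow_pos ξ _).le
  refine ⟨‖fourierConst d‖ * I, by positivity, fun p hp => ?_⟩
  have key : HolderBound τ U (fun x => ∫ ξ, character p.1 ξ * f x (ξ, p.2)) I := by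
    rw [holderBound_iff]
    refine HolderCtrl.integral hU ((integrable_japanese_rpow hs).const_mul C)
      (f := fun ξ x => character p.1 ξ * f x (ξ, p.2)) (fun ξ => ?_) fun x hx => ?_
    · have h1 := (holderBound_iff.1 (hb (ξ, p.2) ⟨mem_univ _, hp.2⟩)).clm_comp hU.2
        (ContinuousLinearMap.mul ℝ ℂ (character p.1 ξ))
      refine h1.mono (mul_le_of_le_one_left (mul_nonneg hC (japanese_rpow_pos ξ _).le) ?_)
      exact (ContinuousLinearMap.opNorm_mul_apply_le ℝ ℂ _).trans (norm_character _ _).le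
    · exact (continuous_character_right p.1).aestronglyMeasurable.mul
        (hf.continuous_fiber hh hx hp.2).aestronglyMeasurable
  refine key.clm_comp hU.2 (ContinuousLinearMap.mul ℝ ℂ (fourierConst d)) ?_
  gcongr
  exact ContinuousLinearMap.opNorm_mul_apply_le ℝ ℂ _

/-- Integration by parts in ξ_i, without boundary terms by integrability. The derivative of the
character brings down i z_i, and the two factors i together with the sign give z_i. -/
theorem fiberInv_pd_dirZ (hh : IsSymbolKernel τ m U h) (hf : SymClass U h s f) {x : E} (hx : x ∈ U)
    {p : EuclideanSpace ℝ (Fin d) × (Fin q → ℝ)} (hp : p ∈ domVY d q) (i : Fin d)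
    (h1 : Integrable fun ξ => f x (ξ, p.2)) (h2 : Integrable fun ξ => pd (dirZ i) (f x) (ξ, p.2)) :
    fiberInv (fun x p => Complex.I * pd (dirZ i) (f x) p) x p = (p.1 i : ℂ) * fiberInv f x p := by
  have hd : ∀ ξ : EuclideanSpace ℝ (Fin d), HasFDerivAt (fun ξ => f x (ξ, p.2))
      ((fderivWithin ℝ (f x) (domVY d q) (ξ, p.2)).comp (ContinuousLinearMap.inl ℝ _ _)) ξ := by
    intro ξ
    have a1 := ((hf.contDiffOn hh.smooth hx).differentiableOn (by simp) (ξ, p.2)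
      ⟨mem_univ _, hp.2⟩).hasFDerivWithinAt
    have a0 : MapsTo (fun ξ : EuclideanSpace ℝ (Fin d) => (ξ, p.2)) univ (domVY d q) :=
      fun ξ _ => ⟨mem_univ _, hp.2⟩
    have a2 := HasFDerivWithinAt.comp (f := fun ξ : EuclideanSpace ℝ (Fin d) => (ξ, p.2)) ξ a1
      (hasFDerivAt_prodMk_left ξ p.2).hasFDerivWithinAt a0
    exact hasFDerivWithinAt_univ.1 a2
  have hg : ∀ ξ, fderiv ℝ (fun ξ => f x (ξ, p.2)) ξ (EuclideanSpace.single i (1 : ℝ))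
      = pd (dirZ i) (f x) (ξ, p.2) := fun ξ => by
    rw [(hd ξ).fderiv]; rfl
  have hc : ∀ ξ, HasFDerivAt (character p.1) ((character p.1 ξ * Complex.I) •
      (Complex.ofRealCLM.comp (innerSL ℝ p.1))) ξ := fun ξ => by
    have := hasFDerivAt_character ξ p.1
    simp only [character_comm _ p.1] at this
    exact this
  have hcv : ∀ ξ, fderiv ℝ (character p.1) ξ (EuclideanSpace.single i (1 : ℝ))
      = Complex.I * (p.1 i) * character p.1 ξ := fun ξ => by
    rw [(hc ξ).fderiv]
    simp only [smul_apply, ContinuousLinearMap.comp_apply, innerSL_apply_apply, inner_single_real,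
      Complex.ofRealCLM_apply, smul_eq_mul]
    ring
  have key := integral_mul_fderiv_eq_neg_fderiv_mul_of_integrable (μ := volume)
    (f := character p.1) (g := fun ξ => f x (ξ, p.2)) (v := EuclideanSpace.single i (1 : ℝ))
    (by
      simp only [hcv, mul_assoc]
      exact ((integrable_character_mul h1 p.1).const_mul _).const_mul _)
    (by simpa only [hg] using integrable_character_mul h2 p.1)
    (integrable_character_mul h1 p.1) (fun ξ _ => (hc ξ).differentiableAt)
    (fun ξ _ => (hd ξ).differentiableAt)
  simp only [hg, hcv] at key
  simp only [fiberInv_eq, mul_left_comm _ Complex.I, integral_const_mul, key]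
  simp only [mul_assoc, integral_const_mul]
  linear_combination (-(p.1 i : ℂ) * fourierConst d *
    ∫ ξ, character p.1 ξ * f x (ξ, p.2)) * Complex.I_sq

/-- Inverse Fourier transforms of symbols of low order are differentiable. -/
theorem hasFDerivWithinAt_fiberInv (hU : IsCornerDomain U)
    (hq : HasPointFormula q) (hh : IsSymbolKernel τ m U h) (hf : SymClass U h s f)
    (hs : m + (q : ℝ) / 2 + q + s + 1 < -d) {x : E} (hx : x ∈ U)
    {p : EuclideanSpace ℝ (Fin d) × (Fin q → ℝ)} (hp : p ∈ domVY d q) :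
    HasFDerivWithinAt (fiberInv f x)
      (linForm (fun i => fiberInv (fun x p => Complex.I * ((p.1 i : ℂ) * f x p)) x p)
        (fun j => fiberInv (fun x p => pd (dirY j) (f x) p) x p)) (domVY d q) p := by
  -- A derivative in z_i brings down i ξ_i and one in Y_j falls on f. Both raise the order by one,
  -- and the results must still be dominated integrably.
  have hs1 : m + (q : ℝ) / 2 + q + (s + 1 : ℤ) < -d := by push_cast; linarith
  have hfz : ∀ i : Fin d, SymClass U h (s + 1) (fun x p => Complex.I * ((p.1 i : ℂ) * f x p)) :=
    fun i => (hf.mulZ i).smul _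
  have hfy : ∀ j, SymClass U h (s + 1) (fun x p => pd (dirY j) (f x) p) :=
    fun j => hf.pd_dirY hh.smooth j
  choose Cz hCz hz using fun i => (hfz i).exists_norm_le hU hq hh
  choose Cy hCy hy using fun j => (hfy j).exists_norm_le hU hq hh
  set g' : EuclideanSpace ℝ (Fin d) → EuclideanSpace ℝ (Fin d) × (Fin q → ℝ) →
      EuclideanSpace ℝ (Fin d) × (Fin q → ℝ) →L[ℝ] ℂ := fun ξ p =>
    linForm (fun i => character p.1 ξ * (Complex.I * ((ξ i : ℂ) * f x (ξ, p.2))))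
      (fun j => character p.1 ξ * pd (dirY j) (f x) (ξ, p.2)) with hg'
  have hd : ∀ ξ, ∀ p ∈ domVY d q,
      HasFDerivWithinAt (fun p => character p.1 ξ * f x (ξ, p.2)) (g' ξ p) (domVY d q) p := by
    intro ξ p hp
    have a1 := ((hf.contDiffOn hh.smooth hx).differentiableOn (by simp) (ξ, p.2)
      ⟨mem_univ _, hp.2⟩).hasFDerivWithinAt
    have a2 : HasFDerivWithinAt (fun p : EuclideanSpace ℝ (Fin d) × (Fin q → ℝ) => (ξ, p.2))
        ((0 : EuclideanSpace ℝ (Fin d) × (Fin q → ℝ) →L[ℝ] EuclideanSpace ℝ (Fin d)).prod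
          (ContinuousLinearMap.snd ℝ _ _)) (domVY d q) p :=
      (hasFDerivWithinAt_const ξ p _).prodMk hasFDerivWithinAt_snd
    have a0 : MapsTo (fun p : EuclideanSpace ℝ (Fin d) × (Fin q → ℝ) => (ξ, p.2)) (domVY d q)
        (domVY d q) := fun p hp => ⟨mem_univ _, hp.2⟩
    have a3 := HasFDerivWithinAt.comp (f := fun p : EuclideanSpace ℝ (Fin d) × (Fin q → ℝ) =>
      (ξ, p.2)) p a1 a2 a0
    have a4 : HasFDerivWithinAt (fun p : EuclideanSpace ℝ (Fin d) × (Fin q → ℝ) =>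
        character p.1 ξ) _ (domVY d q) p :=
      ((hasFDerivAt_character p.1 ξ).comp p hasFDerivAt_fst).hasFDerivWithinAt
    have a5 := a4.mul a3
    refine a5.congr_fderiv ?_
    rw [eq_linForm (character p.1 ξ • _ + _)]
    simp only [hg']
    congr 1
    · ext i
      simp [dirZ, inner_single_real, Prod.mk_zero_zero]
      ring
    · ext j
      simp [dirY, pd]
  have hbound : ∀ ξ, ∀ p ∈ domVY d q, ‖g' ξ p‖ ≤ (∑ i, Cz i + ∑ j, Cy j) *
      japanese ξ ^ (m + (q : ℝ) / 2 + q + (s + 1 : ℤ)) := by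
    intro ξ p hp
    refine (norm_linForm_le _ _).trans ?_
    rw [add_mul, Finset.sum_mul, Finset.sum_mul]
    refine add_le_add (Finset.sum_le_sum fun i _ => ?_) (Finset.sum_le_sum fun j _ => ?_)
    · rw [norm_mul, norm_character, one_mul]
      exact hz i x hx (ξ, p.2) ⟨mem_univ _, hp.2⟩
    · rw [norm_mul, norm_character, one_mul]
      exact hy j x hx (ξ, p.2) ⟨mem_univ _, hp.2⟩
  have hcont : Continuous fun ξ => g' ξ p :=
    continuous_linForm (fun i => (continuous_character_right p.1).mul
      ((hfz i).continuous_fiber hh hx hp.2))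
      (fun j => (continuous_character_right p.1).mul ((hfy j).continuous_fiber hh hx hp.2))
  have hBi := (integrable_japanese_rpow hs1).const_mul (∑ i, Cz i + ∑ j, Cy j)
  have hs0 : m + (q : ℝ) / 2 + q + s < -d := by linarith
  have key := hasFDerivWithinAt_integral_of_convex (μ := volume) (IsCornerDomain.domVY d q).1 hp
    (f := fun ξ p => character p.1 ξ * f x (ξ, p.2)) (f' := g')
    (fun p hp => integrable_character_mul (hf.integrable hU hq hh hx hp.2 (Or.inl hs0)) p.1)
    hcont.aestronglyMeasurable hd hbound hBi
  have hint : Integrable (fun ξ => g' ξ p) := hBi.mono' hcont.aestronglyMeasurable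
    (Eventually.of_forall fun ξ => hbound ξ p hp)
  rw [hg', integral_linForm hint] at key
  have := key.const_mul (fourierConst d)
  rw [smul_linForm] at this
  exact this

end SymClass

/-! ### Kernels with cutoffs -/

theorem HolderBound.exists_mul {E : Type} [NormedAddCommGroup E] [NormedSpace ℝ E] {U : Set E}
    (hU : IsCornerDomain U) {τ : ℝ} (hτ : 0 ≤ τ) : ∃ c : ℝ, 0 ≤ c ∧ ∀ {f g : E → ℂ} {C D : ℝ},
      0 ≤ C → 0 ≤ D → HolderBound τ U f C → HolderBound τ U g D →
      HolderBound τ U (fun x => f x * g x) (c * C * D) := by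
  have h0 : 0 ≤ τ - ⌊τ⌋₊ := by linarith [Nat.floor_le hτ]
  have h1 : τ - ⌊τ⌋₊ ≤ 1 := by linarith [Nat.lt_floor_add_one τ]
  obtain ⟨c, hc, h⟩ := HolderCtrl.exists_bilin hU.1 hU.2 h0 h1 ⌊τ⌋₊
  exact ⟨c * ‖ContinuousLinearMap.mul ℝ ℂ‖, by positivity, fun hC hD hf hg =>
    holderBound_iff.2 (h (ContinuousLinearMap.mul ℝ ℂ) hC hD (holderBound_iff.1 hf) (holderBound_iff.1 hg))⟩

/-- Finite sums of products of cutoff functions and inverse Fourier transforms of symbols. -/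
inductive KernelClass {E : Type} [NormedAddCommGroup E] [NormedSpace ℝ E] {d q : ℕ} (U : Set E)
    (h : E → EuclideanSpace ℝ (Fin d) × (Fin q → ℝ) → ℂ) (π : E →L[ℝ] EuclideanSpace ℝ (Fin d))
    (s : ℤ) : (E → EuclideanSpace ℝ (Fin d) × (Fin q → ℝ) → ℂ) → Prop
  | zero : KernelClass U h π s (fun _ _ => 0)
  | term {b W} : IsCutoff W → SymClass U h s b →
      KernelClass U h π s (fun x p => W (π x, p) * fiberInv b x p)
  | add {K K'} : KernelClass U h π s K → KernelClass U h π s K' →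
      KernelClass U h π s (fun x p => K x p + K' x p)

namespace KernelClass

variable {E : Type} [NormedAddCommGroup E] [NormedSpace ℝ E] {d q : ℕ} {U : Set E} {τ m : ℝ}
  {h K : E → EuclideanSpace ℝ (Fin d) × (Fin q → ℝ) → ℂ} {s : ℤ}
  {π : E →L[ℝ] EuclideanSpace ℝ (Fin d)}

theorem mono_le {s' : ℤ} (hK : KernelClass U h π s K) (hs : s ≤ s') : KernelClass U h π s' K := by
  induction hK with
  | zero => exact zero
  | term hW hb => exact term hW (hb.mono_le hs)
  | add _ _ h1 h2 => exact add h1 h2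

theorem sum {ι : Type*} (t : Finset ι)
    {K : ι → E → EuclideanSpace ℝ (Fin d) × (Fin q → ℝ) → ℂ}
    (hK : ∀ i ∈ t, KernelClass U h π s (K i)) :
    KernelClass U h π s (fun x p => ∑ i ∈ t, K i x p) := by
  classical
  induction t using Finset.induction_on with
  | empty => simpa using zero
  | insert i t hi ih =>
    simp only [Finset.sum_insert hi]
    exact add (hK i (Finset.mem_insert_self i t)) (ih fun j hj => hK j (Finset.mem_insert_of_mem hj))

theorem exists_holderBound [FiniteDimensional ℝ E] (hU : IsCornerDomain U) (hτ : 0 ≤ τ)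
    (hq : HasPointFormula q) (hh : IsSymbolKernel τ m U h) (hK : KernelClass U h π s K)
    (hs : m + (q : ℝ) / 2 + q + s < -d) :
    ∃ C : ℝ, 0 ≤ C ∧ ∀ p ∈ domVY d q, HolderBound τ U (fun x => K x p) C := by
  induction hK with
  | zero =>
    refine ⟨0, le_rfl, fun p _ => ?_⟩
    simpa using holderBound_iff.2 (HolderCtrl.const hU.2 _ (0 : ℂ))
  | @term b W hW hb =>
    obtain ⟨c, hc, hmul⟩ := HolderBound.exists_mul hU hτ
    obtain ⟨C, hC, hbd⟩ := hb.exists_holderBound_fiberInv hU hq hh hs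
    obtain ⟨D, hD, hWd⟩ := hW.1.exists_holderBound hU (IsCornerDomain.domCutoff d q)
      ((ContinuousLinearMap.inl ℝ _ _).comp π) hτ
    refine ⟨_, by positivity, fun p hp => hmul hD hC ?_ (hbd p hp)⟩
    -- The slice x ↦ W(πx, p) is a fixed linear map followed by translation by (0, p), so its Hölder
    -- bound does not depend on p.
    have := hWd (0, p) (fun x _ => ⟨mem_univ _, by simpa using hp⟩)
    simpa using this
  | add _ _ h1 h2 =>
    obtain ⟨C, hC, h1⟩ := h1
    obtain ⟨D, hD, h2⟩ := h2
    exact ⟨C + D, by positivity, fun p hp => (h1 p hp).add hU.2 (h2 p hp)⟩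

theorem exists_mulY (hK : KernelClass U h π s K) (j : Fin q) :
    ∃ K', KernelClass U h π (s - 1) K' ∧ ∀ x p, (p.2 j : ℂ) * K x p = K' x p := by
  induction hK with
  | zero => exact ⟨_, zero, fun x p => by simp⟩
  | term hW hb =>
    refine ⟨_, term hW (hb.mulY j), fun x p => ?_⟩
    rw [SymClass.fiberInv_mulY]
    ring
  | add _ _ h1 h2 =>
    obtain ⟨K1, hK1, e1⟩ := h1
    obtain ⟨K2, hK2, e2⟩ := h2
    exact ⟨_, add hK1 hK2, fun x p => by rw [mul_add, e1, e2]⟩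

/-- The condition on the order or on p.2 is what makes the symbol and its ξ_i-derivative integrable
for the integration by parts. Multiplication by Y_j needs no such condition. -/
theorem exists_mulZ (hU : IsCornerDomain U) (hq : HasPointFormula q) (hh : IsSymbolKernel τ m U h)
    (hK : KernelClass U h π s K) (i : Fin d) :
    ∃ K', KernelClass U h π (s - 1) K' ∧ ∀ x ∈ U, ∀ p ∈ domVY d q,
      m + (q : ℝ) / 2 + q + s < -d ∨ p.2 ≠ 0 → (p.1 i : ℂ) * K x p = K' x p := by
  induction hK with
  | zero => exact ⟨_, zero, fun x _ p _ _ => by simp⟩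
  | @term b W hW hb =>
    have hb' := hb.pd_dirZ hh.smooth i
    refine ⟨_, term hW (hb'.smul Complex.I), fun x hx p hp hs => ?_⟩
    rw [SymClass.fiberInv_pd_dirZ hh hb hx hp i (hb.integrable hU hq hh hx hp.2 hs)
      (hb'.integrable hU hq hh hx hp.2 (hs.imp_left fun h => by push_cast; linarith))]
    ring
  | add _ _ h1 h2 =>
    obtain ⟨K1, hK1, e1⟩ := h1
    obtain ⟨K2, hK2, e2⟩ := h2
    exact ⟨_, add hK1 hK2, fun x hx p hp hs => by
      rw [mul_add, e1 x hx p hp hs, e2 x hx p hp hs]⟩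

/-- The order of a representation can be lowered by one. -/
theorem exists_lower (hU : IsCornerDomain U) (hq : HasPointFormula q)
    (hh : IsSymbolKernel τ m U h) (hK : KernelClass U h π s K) :
    ∃ K', KernelClass U h π (s - 1) K' ∧ ∀ x ∈ U, ∀ p ∈ domVY d q, p.2 ≠ 0 → K x p = K' x p := by
  induction hK with
  | zero => exact ⟨_, zero, fun x _ p _ _ => rfl⟩
  | @term b W hW hb =>
    -- Hadamard's coefficients are cutoffs again. The coordinate multiplying each of them is moved
    -- onto the inverse Fourier transform, where it lowers the order.
    choose Kz hKz ez using fun i => exists_mulZ hU hq hh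
      (term (π := π) (hW.isCutoff_deriv (dirZ i)).isCutoff_avg hb) i
    choose Ky hKy ey using fun j => exists_mulY
      (term (π := π) (hW.isCutoff_deriv (dirY j)).isCutoff_avg hb) j
    refine ⟨_, add (sum Finset.univ fun i _ => hKz i) (sum Finset.univ fun j _ => hKy j),
      fun x hx p hp hs => ?_⟩
    simp only []
    rw [hW.eq_sum_avg (π x) hp, add_mul, Finset.sum_mul, Finset.sum_mul]
    congr 1
    · refine Finset.sum_congr rfl fun i _ => ?_
      rw [← ez i x hx p hp (Or.inr hs), mul_assoc]
    · refine Finset.sum_congr rfl fun j _ => ?_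
      rw [← ey j x p, mul_assoc]
  | add _ _ h1 h2 =>
    obtain ⟨K1, hK1, e1⟩ := h1
    obtain ⟨K2, hK2, e2⟩ := h2
    exact ⟨_, add hK1 hK2, fun x hx p hp hs =>
      congrArg₂ (· + ·) (e1 x hx p hp hs) (e2 x hx p hp hs)⟩

/-- Product rule. Terms in which the cutoff is differentiated keep the order s and are regarded as
of order s + 1. -/
theorem exists_deriv (hU : IsCornerDomain U) (hq : HasPointFormula q)
    (hh : IsSymbolKernel τ m U h) (hK : KernelClass U h π s K)
    (hs : m + (q : ℝ) / 2 + q + s + 1 < -d) :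
    ∃ (Kz : Fin d → E → EuclideanSpace ℝ (Fin d) × (Fin q → ℝ) → ℂ)
      (Ky : Fin q → E → EuclideanSpace ℝ (Fin d) × (Fin q → ℝ) → ℂ),
      (∀ i, KernelClass U h π (s + 1) (Kz i)) ∧ (∀ j, KernelClass U h π (s + 1) (Ky j)) ∧
      ∀ x ∈ U, ∀ p ∈ domVY d q,
        HasFDerivWithinAt (K x) (linForm (fun i => Kz i x p) (fun j => Ky j x p))
          (domVY d q) p := by
  induction hK with
  | zero =>
    refine ⟨_, _, fun i => zero, fun j => zero, fun x _ p _ => ?_⟩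
    have : linForm (fun _ : Fin d => (0 : ℂ)) (fun _ : Fin q => (0 : ℂ)) = 0 :=
      ContinuousLinearMap.ext fun p => by simp [linForm_apply]
    rw [this]
    exact hasFDerivWithinAt_const _ _ _
  | @term b W hW hb =>
    refine ⟨_, _, fun i => add ((term (π := π) (hW.isCutoff_deriv (dirZ i)) hb).mono_le (by omega))
      (term hW ((hb.mulZ i).smul Complex.I)),
      fun j => add ((term (π := π) (hW.isCutoff_deriv (dirY j)) hb).mono_le (by omega))
      (term hW (hb.pd_dirY hh.smooth j)), fun x hx p hp => ?_⟩
    have h1 := (hW.hasFDerivWithinAt (π x) hp).mul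
      (hb.hasFDerivWithinAt_fiberInv hU hq hh hs hx hp)
    refine h1.congr_fderiv ?_
    rw [smul_linForm, smul_linForm, add_comm, linForm_add]
    simp only [mul_comm (fiberInv b x p)]
  | @add K K' _ _ h1 h2 =>
    obtain ⟨Kz, Ky, hz, hy, h1⟩ := h1
    obtain ⟨Kz', Ky', hz', hy', h2⟩ := h2
    refine ⟨_, _, fun i => add (hz i) (hz' i), fun j => add (hy j) (hy' j), fun x hx p hp => ?_⟩
    rw [← linForm_add]
    exact (h1 x hx p hp).add (h2 x hx p hp)

end KernelClass

/-- Functions that have representations of arbitrarily low order. -/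
def IsSmoothingKernel {E : Type} [NormedAddCommGroup E] [NormedSpace ℝ E] {d q : ℕ} (U : Set E)
    (h : E → EuclideanSpace ℝ (Fin d) × (Fin q → ℝ) → ℂ) (π : E →L[ℝ] EuclideanSpace ℝ (Fin d))
    (K : E → EuclideanSpace ℝ (Fin d) × (Fin q → ℝ) → ℂ) : Prop :=
  ∀ s : ℤ, ∃ K', KernelClass U h π s K' ∧ ∀ x ∈ U, ∀ p ∈ domVY d q, K x p = K' x p

namespace IsSmoothingKernel

variable {E : Type} [NormedAddCommGroup E] [NormedSpace ℝ E] {d q : ℕ} {U : Set E} {τ m : ℝ}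
  {h K : E → EuclideanSpace ℝ (Fin d) × (Fin q → ℝ) → ℂ}
  {π : E →L[ℝ] EuclideanSpace ℝ (Fin d)}

theorem congr {K' : E → EuclideanSpace ℝ (Fin d) × (Fin q → ℝ) → ℂ}
    (hK : IsSmoothingKernel U h π K) (e : ∀ x ∈ U, ∀ p ∈ domVY d q, K' x p = K x p) :
    IsSmoothingKernel U h π K' := fun s => by
  obtain ⟨K1, h1, e1⟩ := hK s
  exact ⟨K1, h1, fun x hx p hp => (e x hx p hp).trans (e1 x hx p hp)⟩

/-- The derivatives are read off from one representation of sufficiently low order. By uniqueness of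
the derivative they agree with those of every lower representation, and so have representations of
every order themselves. -/
theorem exists_deriv (hU : IsCornerDomain U) (hq : HasPointFormula q)
    (hh : IsSymbolKernel τ m U h) (K) (hK : IsSmoothingKernel U h π K) :
    ∃ (Kz : Fin d → E → EuclideanSpace ℝ (Fin d) × (Fin q → ℝ) → ℂ)
      (Ky : Fin q → E → EuclideanSpace ℝ (Fin d) × (Fin q → ℝ) → ℂ),
      (∀ i, IsSmoothingKernel U h π (Kz i)) ∧ (∀ j, IsSmoothingKernel U h π (Ky j)) ∧
      ∀ x ∈ U, ∀ p ∈ domVY d q,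
        HasFDerivWithinAt (K x) (linForm (fun i => Kz i x p) (fun j => Ky j x p))
          (domVY d q) p := by
  have low : ∀ s : ℤ, m + (q : ℝ) / 2 + q + s + 1 < -d →
      ∃ (Kz : Fin d → E → EuclideanSpace ℝ (Fin d) × (Fin q → ℝ) → ℂ)
      (Ky : Fin q → E → EuclideanSpace ℝ (Fin d) × (Fin q → ℝ) → ℂ),
      (∀ i, KernelClass U h π (s + 1) (Kz i)) ∧ (∀ j, KernelClass U h π (s + 1) (Ky j)) ∧
      ∀ x ∈ U, ∀ p ∈ domVY d q,
        HasFDerivWithinAt (K x) (linForm (fun i => Kz i x p) (fun j => Ky j x p))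
          (domVY d q) p := by
    intro s hs
    obtain ⟨K1, h1, e1⟩ := hK s
    obtain ⟨Kz, Ky, hz, hy, hd⟩ := h1.exists_deriv hU hq hh hs
    exact ⟨Kz, Ky, hz, hy, fun x hx p hp => (hd x hx p hp).congr (fun p hp => e1 x hx p hp)
      (e1 x hx p hp)⟩
  obtain ⟨s0, hs0⟩ := exists_int_lt (-d - (m + (q : ℝ) / 2 + q + 1))
  obtain ⟨Kz, Ky, -, -, hd⟩ := low s0 (by linarith)
  have key : ∀ s : ℤ, ∃ (Kz' : Fin d → E → EuclideanSpace ℝ (Fin d) × (Fin q → ℝ) → ℂ)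
      (Ky' : Fin q → E → EuclideanSpace ℝ (Fin d) × (Fin q → ℝ) → ℂ),
      (∀ i, KernelClass U h π s (Kz' i)) ∧ (∀ j, KernelClass U h π s (Ky' j)) ∧
      ∀ x ∈ U, ∀ p ∈ domVY d q, (∀ i, Kz i x p = Kz' i x p) ∧ ∀ j, Ky j x p = Ky' j x p := by
    intro s
    have hle : ((min (s - 1) s0 : ℤ) : ℝ) ≤ s0 := by exact_mod_cast min_le_right _ _
    -- The bound s - 1 compensates the order gained by differentiating, and s0 guarantees
    -- convergence.
    obtain ⟨Kz', Ky', hz, hy, hd'⟩ := low (min (s - 1) s0) (by linarith)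
    refine ⟨Kz', Ky', fun i => (hz i).mono_le (by omega), fun j => (hy j).mono_le (by omega),
      fun x hx p hp => ⟨fun i => ?_, fun j => ?_⟩⟩
    · have a1 := pd_eq_of_hasFDerivWithinAt hp (hd x hx p hp) (dirZ i)
      have a2 := pd_eq_of_hasFDerivWithinAt hp (hd' x hx p hp) (dirZ i)
      rw [linForm_dirZ] at a1 a2
      exact a1.symm.trans a2
    · have a1 := pd_eq_of_hasFDerivWithinAt hp (hd x hx p hp) (dirY j)
      have a2 := pd_eq_of_hasFDerivWithinAt hp (hd' x hx p hp) (dirY j)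
      rw [linForm_dirY] at a1 a2
      exact a1.symm.trans a2
  refine ⟨Kz, Ky, fun i s => ?_, fun j s => ?_, hd⟩
  · obtain ⟨Kz', Ky', hz, hy, e⟩ := key s
    exact ⟨Kz' i, hz i, fun x hx p hp => (e x hx p hp).1 i⟩
  · obtain ⟨Kz', Ky', hz, hy, e⟩ := key s
    exact ⟨Ky' j, hy j, fun x hx p hp => (e x hx p hp).2 j⟩

theorem mulY (hK : IsSmoothingKernel U h π K) (j : Fin q) :
    IsSmoothingKernel U h π (fun x p => (p.2 j : ℂ) * K x p) := fun s => by
  obtain ⟨K1, h1, e1⟩ := hK (s + 1)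
  obtain ⟨K2, h2, e2⟩ := h1.exists_mulY j
  exact ⟨K2, h2.mono_le (by omega), fun x hx p hp => by
    simp only [← e2, e1 x hx p hp]⟩

theorem mulZ (hU : IsCornerDomain U) (hq : HasPointFormula q) (hh : IsSymbolKernel τ m U h)
    (hK : IsSmoothingKernel U h π K) (i : Fin d) :
    IsSmoothingKernel U h π (fun x p => (p.1 i : ℂ) * K x p) := fun s => by
  obtain ⟨s0, hs0⟩ := exists_int_lt (-d - (m + (q : ℝ) / 2 + q))
  have hle : ((min (s + 1) s0 : ℤ) : ℝ) ≤ s0 := by exact_mod_cast min_le_right _ _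
  -- Below s0 the integration by parts is valid at all points, including Y = 0.
  obtain ⟨K1, h1, e1⟩ := hK (min (s + 1) s0)
  obtain ⟨K2, h2, e2⟩ := h1.exists_mulZ hU hq hh i
  refine ⟨K2, h2.mono_le (by omega), fun x hx p hp => ?_⟩
  simp only [← e2 x hx p hp (Or.inl (by linarith)), e1 x hx p hp]

theorem mul_prod {ι : Type*} (t : Finset ι) (β : ι → ℕ)
    (c : ι → EuclideanSpace ℝ (Fin d) × (Fin q → ℝ) → ℝ)
    (hc : ∀ i, ∀ K, IsSmoothingKernel U h π K →
      IsSmoothingKernel U h π (fun x p => (c i p : ℂ) * K x p)) (hK : IsSmoothingKernel U h π K) :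
    IsSmoothingKernel U h π (fun x p => ((∏ i ∈ t, c i p ^ β i : ℝ) : ℂ) * K x p) := by
  classical
  have hpow : ∀ i, ∀ n : ℕ, ∀ K, IsSmoothingKernel U h π K →
      IsSmoothingKernel U h π (fun x p => (c i p : ℂ) ^ n * K x p) := by
    intro i n K hK
    induction n with
    | zero => simpa using hK
    | succ n ih => exact (hc i _ ih).congr fun x _ p _ => by ring
  induction t using Finset.induction_on with
  | empty => simpa using hK
  | insert i t hi ih =>
    refine (hpow i (β i) _ ih).congr fun x _ p _ => ?_
    rw [Finset.prod_insert hi]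
    push_cast; ring

/-- Every quantity to be bounded is again a smoothing kernel, so a single uniform C^τ bound at one
low order suffices. -/
theorem isCtauCinftyKernel [FiniteDimensional ℝ E] (hU : IsCornerDomain U) (hτ : 0 ≤ τ)
    (hq : HasPointFormula q) (hh : IsSymbolKernel τ m U h) (hK : IsSmoothingKernel U h π K) :
    IsCtauCinftyKernel τ U K := by
  have hP := exists_deriv (π := π) hU hq hh
  refine ⟨fun x hx => contDiffOn_of_closed_pd hP hK hx, fun α β k k' => ?_⟩
  obtain ⟨K1, hK1, e1⟩ := exists_mixedDeriv_of_closed_pd hP α k' hK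
  have hY := mul_prod Finset.univ k (fun j p => p.2 j) (fun j K hK => mulY hK j) hK1
  have hZ := mul_prod Finset.univ β (fun i p => p.1 i) (fun i K hK => mulZ hU hq hh hK i) hY
  obtain ⟨s0, hs0⟩ := exists_int_lt (-d - (m + (q : ℝ) / 2 + q))
  obtain ⟨K2, h2, e2⟩ := hZ s0
  obtain ⟨C, hC, hb⟩ := h2.exists_holderBound hU hτ hq hh (by linarith)
  refine ⟨C, fun p hp => (hb p hp).congr fun x hx => ?_⟩
  simp only
  rw [← e2 x hx p hp, e1 x hx p hp, mul_assoc]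
  rfl

end IsSmoothingKernel

/-- A small shift along (1, …, 1) makes all Y-coordinates positive, and q ≥ 1 then gives Y ≠ 0. -/
theorem domVY_subset_closure_ne {d q : ℕ} [NeZero q] :
    domVY d q ⊆ closure {p | p ∈ domVY d q ∧ p.2 ≠ 0} := by
  intro p hp
  have ht : Tendsto (fun t : ℝ => p + t • ((0 : EuclideanSpace ℝ (Fin d)), (1 : Fin q → ℝ)))
      (𝓝[>] 0) (𝓝 p) := by
    have : Continuous fun t : ℝ => p + t • ((0 : EuclideanSpace ℝ (Fin d)), (1 : Fin q → ℝ)) := by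
      fun_prop
    have h0 := this.tendsto 0
    rw [zero_smul, add_zero] at h0
    exact h0.mono_left nhdsWithin_le_nhds
  refine mem_closure_of_tendsto ht ?_
  filter_upwards [self_mem_nhdsWithin] with t ht
  have hpos : ∀ j, 0 < (p + t • ((0 : EuclideanSpace ℝ (Fin d)), (1 : Fin q → ℝ))).2 j := fun j => by
    have := hp.2 j
    have ht : 0 < t := ht
    simp
    positivity
  exact ⟨⟨mem_univ _, fun j => (hpos j).le⟩, fun h0 => by
    have := hpos 0
    rw [h0] at this
    exact lt_irrefl _ this⟩

/-- The kernel of a symbol-kernel operator with disjoint cutoffs. -/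
theorem exists_smoothingKernel {E : Type} [NormedAddCommGroup E] [NormedSpace ℝ E] {d q : ℕ}
    [NeZero q] {U : Set E} {τ m : ℝ} {h : E → EuclideanSpace ℝ (Fin d) × (Fin q → ℝ) → ℂ}
    (hU : IsCornerDomain U) (hq : HasPointFormula q) (hh : IsSymbolKernel τ m U h)
    (π : E →L[ℝ] EuclideanSpace ℝ (Fin d))
    {W : EuclideanSpace ℝ (Fin d) × (EuclideanSpace ℝ (Fin d) × (Fin q → ℝ)) → ℂ}
    (hW : IsCutoff W) :
    ∃ K, IsSmoothingKernel U h π K ∧ ∀ x ∈ U, ∀ p ∈ domVY d q, p.2 ≠ 0 →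
      K x p = W (π x, p) * fiberInv h x p := by
  have hn : ∀ n : ℕ, ∃ K, KernelClass U h π (-n) K ∧ ∀ x ∈ U, ∀ p ∈ domVY d q, p.2 ≠ 0 →
      K x p = W (π x, p) * fiberInv h x p := by
    intro n
    induction n with
    | zero => exact ⟨_, by simpa using KernelClass.term hW SymClass.self, fun _ _ _ _ _ => rfl⟩
    | succ n ih =>
      obtain ⟨K, hK, e⟩ := ih
      obtain ⟨K', hK', e'⟩ := hK.exists_lower hU hq hh
      exact ⟨K', hK'.mono_le (by push_cast; omega), fun x hx p hp hs =>
        (e' x hx p hp hs).symm.trans (e x hx p hp hs)⟩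
  -- From n0 on, representations are differentiable, hence continuous up to Y = 0. The one of order
  -- -n0 is taken as the definition of the kernel.
  obtain ⟨n0, hn0⟩ := exists_nat_gt (m + (q : ℝ) / 2 + q + 1 + d)
  obtain ⟨K, hK, e⟩ := hn n0
  have hcont : ∀ n : ℕ, n0 ≤ n → ∀ K, KernelClass U h π (-n) K → ∀ x ∈ U,
      ContinuousOn (K x) (domVY d q) := by
    intro n hle K hK x hx
    have hle : (n0 : ℝ) ≤ n := by exact_mod_cast hle
    obtain ⟨Kz, Ky, -, -, hd⟩ := hK.exists_deriv hU hq hh (by push_cast; linarith)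
    exact fun p hp => (hd x hx p hp).continuousWithinAt
  refine ⟨K, fun s => ?_, e⟩
  -- The maximum makes K' both continuous and of order at most s. Agreement on the dense set Y ≠ 0
  -- then gives agreement everywhere.
  obtain ⟨K', hK', e'⟩ := hn (max n0 (-s).toNat)
  refine ⟨K', hK'.mono_le (by omega), fun x hx p hp => ?_⟩
  have heq : EqOn (K x) (K' x) {p | p ∈ domVY d q ∧ p.2 ≠ 0} := fun p hp =>
    (e x hx p hp.1 hp.2).trans (e' x hx p hp.1 hp.2).symm
  exact heq.of_subset_closure (hcont n0 le_rfl K hK x hx)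
    (hcont _ (le_max_left _ _) K' hK' x hx) (fun p hp => hp.1) domVY_subset_closure_ne hp

/-! ### Fourier transforms of rapidly decreasing functions -/

namespace IsSchwartzOn

variable {E : Type} [NormedAddCommGroup E] [NormedSpace ℝ E] {U : Set E} {u : E → ℂ}

theorem exists_decay (hu : IsSchwartzOn U u) (k j : ℕ) : ∃ C : ℝ, 0 ≤ C ∧ ∀ x ∈ U,
    (1 + ‖x‖) ^ k * ‖iteratedFDerivWithin ℝ j u U x‖ ≤ C := by
  obtain ⟨C, hC⟩ := hu.decay k j
  obtain ⟨D, hD⟩ := hu.decay 0 j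
  refine ⟨2 ^ (k - 1) * (|D| + |C|), by positivity, fun x hx => ?_⟩
  have h1 := add_pow_le zero_le_one (norm_nonneg x) k
  have h2 := (hC x hx).trans (le_abs_self C)
  have h3 := (hD x hx).trans (le_abs_self D)
  rw [pow_zero, one_mul] at h3
  calc _ ≤ (2 ^ (k - 1) * (1 ^ k + ‖x‖ ^ k)) * ‖iteratedFDerivWithin ℝ j u U x‖ := by gcongr
    _ = 2 ^ (k - 1) * (‖iteratedFDerivWithin ℝ j u U x‖
        + ‖x‖ ^ k * ‖iteratedFDerivWithin ℝ j u U x‖) := by ring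
    _ ≤ _ := by gcongr

theorem cb_mul (hU : UniqueDiffOn ℝ U) {φ : E → ℂ} (hφ : IsCbInfty U φ) (hu : IsSchwartzOn U u) :
    IsSchwartzOn U (fun x => φ x * u x) := by
  refine ⟨hφ.1.mul hu.1, fun k j => ?_⟩
  choose A hA using hφ.bound
  choose B hB using hu.decay k
  refine ⟨∑ i ∈ Finset.range (j + 1), (j.choose i : ℝ) * |A i| * B (j - i), fun x hx => ?_⟩
  have h := norm_iteratedFDerivWithin_mul_le hφ.1 hu.1 hU hx (n := j) (by exact_mod_cast le_top)
  refine (mul_le_mul_of_nonneg_left h (by positivity)).trans ?_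
  rw [Finset.mul_sum]
  refine Finset.sum_le_sum fun i _ => ?_
  calc _ = ((j.choose i : ℝ) * ‖iteratedFDerivWithin ℝ i φ U x‖) *
        (‖x‖ ^ k * ‖iteratedFDerivWithin ℝ (j - i) u U x‖) := by ring
    _ ≤ _ := by
      gcongr
      · exact (hA i x hx).trans (le_abs_self _)
      · exact hB _ x hx

end IsSchwartzOn

theorem _root_.SchwartzMap.isSchwartzOn {E : Type} [NormedAddCommGroup E] [NormedSpace ℝ E]
    (v : 𝓢(E, ℂ)) : IsSchwartzOn univ v :=
  ⟨v.smooth'.contDiffOn, fun k j => by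
    obtain ⟨C, hC⟩ := v.decay' k j
    exact ⟨C, fun x _ => by rw [iteratedFDerivWithin_univ]; exact hC x⟩⟩

section Fourier

variable {d : ℕ}

theorem integrable_one_add_norm_rpow :
    Integrable fun y : EuclideanSpace ℝ (Fin d) => (1 + ‖y‖) ^ (-(d + 1 : ℝ)) :=
  integrable_one_add_norm (by simp)

theorem fourierHat_eq (f : EuclideanSpace ℝ (Fin d) → ℂ) (ξ : EuclideanSpace ℝ (Fin d)) :
    fourierHat f ξ = FourierTransform.fourier f ((2 * Real.pi)⁻¹ • ξ) := by
  rw [Real.fourier_eq', fourierHat]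
  refine integral_congr_ae (Eventually.of_forall fun y => ?_)
  simp only [inner_smul_right, smul_eq_mul]
  congr 2
  have := Real.pi_ne_zero
  push_cast
  field_simp

/-- The constant depends on d and n only and A enters linearly, so decay of A in a normal variable
is inherited by the partial Fourier transform. The weight of exponent -(d + 1) is just integrable on
ℝ^d. -/
theorem exists_fourierHat_le (d n : ℕ) : ∃ c : ℝ, 0 ≤ c ∧
    ∀ (f : EuclideanSpace ℝ (Fin d) → ℂ) (A : ℝ), ContDiff ℝ ∞ f →
      (∀ j ≤ n, ∀ y, ‖iteratedFDeriv ℝ j f y‖ ≤ A * (1 + ‖y‖) ^ (-(d + 1 : ℝ))) →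
      ∀ ξ, ‖fourierHat f ξ‖ ≤ c * A * japanese ξ ^ (-n : ℝ) := by
  set I := ∫ y : EuclideanSpace ℝ (Fin d), (1 + ‖y‖) ^ (-(d + 1 : ℝ)) with hI
  have hI0 : 0 ≤ I := integral_nonneg fun y => by positivity
  refine ⟨2 ^ (n - 1) * (I + (2 * Real.pi) ^ n * (2 ^ n * ((n + 1) * I))), by positivity,
    fun f A hf hA ξ => ?_⟩
  have hint : ∀ j ≤ n, Integrable fun y => ‖iteratedFDeriv ℝ j f y‖ := fun j hj =>
    (integrable_one_add_norm_rpow.const_mul A).mono'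
      (hf.continuous_iteratedFDeriv (by exact_mod_cast le_top)).norm.aestronglyMeasurable
      (Eventually.of_forall fun y => by simpa using hA j hj y)
  have hle : ∀ j ≤ n, ∫ y, ‖iteratedFDeriv ℝ j f y‖ ≤ A * I := fun j hj => by
    rw [hI, ← integral_const_mul]
    exact integral_mono (hint j hj) (integrable_one_add_norm_rpow.const_mul A) (hA j hj)
  have h0 : ‖fourierHat f ξ‖ ≤ A * I := by
    refine le_trans ?_ (hle 0 (Nat.zero_le n))
    refine (norm_integral_le_integral_norm _).trans_eq ?_
    refine integral_congr_ae (Eventually.of_forall fun y => ?_)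
    simp only [norm_mul, norm_iteratedFDeriv_zero, neg_mul, Complex.norm_exp]
    simp
  have hn : ‖ξ‖ ^ n * ‖fourierHat f ξ‖ ≤ (2 * Real.pi) ^ n * (2 ^ n * ((n + 1) * (A * I))) := by
    have h := Real.pow_mul_norm_iteratedFDeriv_fourier_le (K := 0) (N := n) (f := f)
      (hf.of_le (by exact_mod_cast le_top)) (fun k j hk hj => by
        obtain rfl : k = 0 := by simpa using hk
        simpa using hint j (by exact_mod_cast hj)) (k := 0) (n := n) le_rfl le_rfl
      ((2 * Real.pi)⁻¹ • ξ)
    rw [norm_iteratedFDeriv_zero, ← fourierHat_eq, norm_smul, mul_pow] at h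
    have hpi : ‖(2 * Real.pi)⁻¹‖ = (2 * Real.pi)⁻¹ := by
      rw [Real.norm_eq_abs, abs_of_pos (by positivity)]
    rw [hpi, inv_pow, mul_assoc, inv_mul_le_iff₀ (by positivity)] at h
    refine h.trans ?_
    have hs : ∑ p ∈ Finset.range (0 + 1) ×ˢ Finset.range (n + 1),
        ∫ y, ‖y‖ ^ p.1 * ‖iteratedFDeriv ℝ p.2 f y‖ ≤ (n + 1) * (A * I) := by
      refine (Finset.sum_le_card_nsmul _ _ (A * I) fun p hp => ?_).trans_eq (by simp)
      rw [Finset.mem_product, Finset.mem_range, Finset.mem_range] at hp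
      have hp1 : p.1 = 0 := by omega
      simp only [hp1, pow_zero, one_mul]
      exact hle p.2 (by omega)
    simp only [pow_zero, one_mul, Nat.cast_zero, mul_zero, zero_add]
    gcongr
  have hA0 : 0 ≤ A * I := (norm_nonneg _).trans h0
  have hJ : japanese ξ ^ n ≤ 2 ^ (n - 1) * (1 ^ n + ‖ξ‖ ^ n) :=
    (pow_le_pow_left₀ (japanese_pos ξ).le (japanese_le ξ) n).trans
      (add_pow_le zero_le_one (norm_nonneg ξ) n)
  rw [Real.rpow_neg (japanese_pos ξ).le, Real.rpow_natCast, ← div_eq_mul_inv,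
    le_div_iff₀ (pow_pos (japanese_pos ξ) n), mul_comm]
  calc _ ≤ (2 ^ (n - 1) * (1 ^ n + ‖ξ‖ ^ n)) * ‖fourierHat f ξ‖ := by gcongr
    _ = 2 ^ (n - 1) * (‖fourierHat f ξ‖ + ‖ξ‖ ^ n * ‖fourierHat f ξ‖) := by ring
    _ ≤ 2 ^ (n - 1) * (A * I + (2 * Real.pi) ^ n * (2 ^ n * ((n + 1) * (A * I)))) := by gcongr
    _ = _ := by ring

-- After a translation by (0, w) the slice is a composition with the linear inclusion of ℝ^d, whose
-- norm is at most 1.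
open scoped Pointwise in
theorem norm_iteratedFDeriv_slice_le {u : EuclideanSpace ℝ (Fin d) × ℝ → ℂ}
    (hu : ContDiffOn ℝ ∞ u (halfSpace d)) {w : ℝ} (hw : 0 ≤ w) (j : ℕ)
    (y : EuclideanSpace ℝ (Fin d)) : ‖iteratedFDeriv ℝ j (fun y => u (y, w)) y‖ ≤
      ‖iteratedFDerivWithin ℝ j u (halfSpace d) (y, w)‖ := by
  set b : EuclideanSpace ℝ (Fin d) × ℝ := (0, w) with hb
  set s : Set (EuclideanSpace ℝ (Fin d) × ℝ) := univ ×ˢ Ici (-w) with hs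
  set L := ContinuousLinearMap.inl ℝ (EuclideanSpace ℝ (Fin d)) ℝ with hL
  have hsU : b +ᵥ s = halfSpace d := by
    ext p
    rw [Set.mem_vadd_set_iff_neg_vadd_mem]
    simp [hb, hs, halfSpace]
  have hpre : L ⁻¹' s = univ := by
    ext y; simp [hL, hs, hw]
  have hsd : UniqueDiffOn ℝ s := uniqueDiffOn_univ.prod (uniqueDiffOn_Ici _)
  have hu2 : ContDiffOn ℝ ∞ (fun p => u (p + b)) s :=
    hu.comp (by fun_prop) fun p hp => by
      have := hp.2
      simp [halfSpace, hb] at this ⊢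
      linarith
  have h1 := L.iteratedFDerivWithin_comp_right hu2 hsd (by rw [hpre]; exact uniqueDiffOn_univ)
    (x := y) (by simp [hL, hs, hw]) (i := j) (by exact_mod_cast le_top)
  rw [hpre, iteratedFDerivWithin_univ, iteratedFDerivWithin_comp_add_right, hsU] at h1
  have h2 : (fun p => u (p + b)) ∘ L = fun y => u (y, w) := by
    ext y; simp [hL, hb]
  have h3 : L y + b = (y, w) := by simp [hL, hb]
  rw [h2, h3] at h1
  rw [h1]
  refine (ContinuousMultilinearMap.norm_compContinuousLinearMap_le _ _).trans ?_
  refine mul_le_of_le_one_right (norm_nonneg _) (Finset.prod_le_one (fun _ _ => norm_nonneg _)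
    fun _ _ => ContinuousLinearMap.norm_inl_le_one _ _ _)

/-- The power d + 3 splits as (d + 1) + 2, which gives integrable decay in y and in w separately. -/
theorem one_add_rpow_mul_le {y : EuclideanSpace ℝ (Fin d)} {w X A : ℝ} (hX : 0 ≤ X)
    (h : (1 + ‖(y, w)‖) ^ (d + 3) * X ≤ A) :
    X ≤ A * (1 + ‖w‖) ^ (-2 : ℝ) * (1 + ‖y‖) ^ (-(d + 1 : ℝ)) := by
  have e1 : (1 + ‖w‖) ^ (-2 : ℝ) = ((1 + ‖w‖) ^ 2)⁻¹ := by
    rw [Real.rpow_neg (by positivity)]; norm_cast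
  have e2 : (1 + ‖y‖) ^ (-(d + 1 : ℝ)) = ((1 + ‖y‖) ^ (d + 1))⁻¹ := by
    rw [Real.rpow_neg (by positivity)]; norm_cast
  rw [e1, e2, ← div_eq_mul_inv, ← div_eq_mul_inv, le_div_iff₀ (by positivity),
    le_div_iff₀ (by positivity)]
  refine le_trans ?_ h
  rw [pow_add _ (d + 1) 2, mul_assoc, mul_comm X]
  gcongr
  · exact norm_fst_le (y, w)
  · exact norm_snd_le (y, w)

/-- The slices of a rapidly decreasing function on the half-space. -/
theorem IsSchwartzOn.exists_slice_le {u : EuclideanSpace ℝ (Fin d) × ℝ → ℂ}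
    (hu : IsSchwartzOn (halfSpace d) u) (n : ℕ) : ∃ A : ℝ, 0 ≤ A ∧ ∀ w, 0 ≤ w → ∀ j ≤ n, ∀ y,
      ‖iteratedFDeriv ℝ j (fun y => u (y, w)) y‖ ≤
        A * (1 + ‖w‖) ^ (-2 : ℝ) * (1 + ‖y‖) ^ (-(d + 1 : ℝ)) := by
  choose C hC h using hu.exists_decay (d + 3)
  refine ⟨∑ j ∈ Finset.range (n + 1), C j, Finset.sum_nonneg fun j _ => hC j,
    fun w hw j hj y => one_add_rpow_mul_le (norm_nonneg _) ?_⟩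
  calc _ ≤ (1 + ‖(y, w)‖) ^ (d + 3) * ‖iteratedFDerivWithin ℝ j u (halfSpace d) (y, w)‖ := by
        gcongr; exact norm_iteratedFDeriv_slice_le hu.1 hw j y
    _ ≤ C j := h j _ hw
    _ ≤ _ := Finset.single_le_sum (f := C) (fun j _ => hC j) (Finset.mem_range.2 (by omega))

theorem IsSchwartzOn.contDiff_slice {u : EuclideanSpace ℝ (Fin d) × ℝ → ℂ}
    (hu : IsSchwartzOn (halfSpace d) u) {w : ℝ} (hw : 0 ≤ w) :
    ContDiff ℝ ∞ fun y => u (y, w) :=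
  contDiffOn_univ.1 (hu.1.comp (s := univ) (by fun_prop) fun _ _ => hw)

/-- The partial Fourier transforms of a rapidly decreasing function on the half-space. -/
theorem IsSchwartzOn.exists_fourierHat_slice_le {u : EuclideanSpace ℝ (Fin d) × ℝ → ℂ}
    (hu : IsSchwartzOn (halfSpace d) u) (n : ℕ) : ∃ A : ℝ, 0 ≤ A ∧ ∀ w, 0 ≤ w → ∀ ξ,
      ‖fourierHat (fun y => u (y, w)) ξ‖ ≤ A * (1 + ‖w‖) ^ (-2 : ℝ) * japanese ξ ^ (-n : ℝ) := by
  obtain ⟨c, hc, h⟩ := exists_fourierHat_le d n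
  obtain ⟨A, hA, hs⟩ := hu.exists_slice_le n
  refine ⟨c * A, by positivity, fun w hw ξ => (h _ _ (hu.contDiff_slice hw) (hs w hw) ξ).trans_eq ?_⟩
  ring

theorem IsSchwartzOn.exists_fourierHat_le {v : EuclideanSpace ℝ (Fin d) → ℂ}
    (hv : IsSchwartzOn univ v) (n : ℕ) : ∃ A : ℝ, 0 ≤ A ∧ ∀ ξ,
      ‖fourierHat v ξ‖ ≤ A * japanese ξ ^ (-n : ℝ) := by
  obtain ⟨c, hc, h⟩ := NonsmoothGreen.exists_fourierHat_le d n
  choose C hC hd using hv.exists_decay (d + 1)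
  have hC0 : 0 ≤ ∑ j ∈ Finset.range (n + 1), C j := Finset.sum_nonneg fun j _ => hC j
  refine ⟨c * ∑ j ∈ Finset.range (n + 1), C j, by positivity,
    h v _ (contDiffOn_univ.1 hv.1) fun j hj y => ?_⟩
  have e2 : (1 + ‖y‖) ^ (-(d + 1 : ℝ)) = ((1 + ‖y‖) ^ (d + 1))⁻¹ := by
    rw [Real.rpow_neg (by positivity)]; norm_cast
  rw [e2, ← div_eq_mul_inv, le_div_iff₀ (by positivity), mul_comm, ← iteratedFDerivWithin_univ]
  exact (hd j y (mem_univ y)).trans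
    (Finset.single_le_sum (f := C) (fun j _ => hC j) (Finset.mem_range.2 (by omega)))

theorem IsSchwartzOn.integrable {v : EuclideanSpace ℝ (Fin d) → ℂ} (hv : IsSchwartzOn univ v) :
    Integrable v := by
  obtain ⟨C, hC, hd⟩ := hv.exists_decay (d + 1) 0
  refine (integrable_one_add_norm_rpow.const_mul C).mono'
    (contDiffOn_univ.1 hv.1).continuous.aestronglyMeasurable (Eventually.of_forall fun y => ?_)
  have e2 : (1 + ‖y‖) ^ (-(d + 1 : ℝ)) = ((1 + ‖y‖) ^ (d + 1))⁻¹ := by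
    rw [Real.rpow_neg (by positivity)]; norm_cast
  rw [e2, ← div_eq_mul_inv, le_div_iff₀ (by positivity), mul_comm]
  simpa using hd y (mem_univ y)

theorem IsSchwartzOn.exists_norm_slice_le {u : EuclideanSpace ℝ (Fin d) × ℝ → ℂ}
    (hu : IsSchwartzOn (halfSpace d) u) : ∃ A : ℝ, 0 ≤ A ∧ ∀ w, 0 ≤ w → ∀ y,
      ‖u (y, w)‖ ≤ A * (1 + ‖w‖) ^ (-2 : ℝ) * (1 + ‖y‖) ^ (-(d + 1 : ℝ)) := by
  obtain ⟨A, hA, hs⟩ := hu.exists_slice_le 0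
  exact ⟨A, hA, fun w hw y => by simpa using hs w hw 0 le_rfl y⟩

/-- The Fourier transform turns multiplication into convolution. -/
theorem invFourierHat_mul_fourierHat {a v : EuclideanSpace ℝ (Fin d) → ℂ} (ha : Integrable a)
    (hv : Integrable v) (x' : EuclideanSpace ℝ (Fin d)) :
    invFourierHat (fun ξ => a ξ * fourierHat v ξ) x' = ∫ y, invFourierHat a (x' - y) * v y := by
  have hexp : ∀ ξ y : EuclideanSpace ℝ (Fin d),
      Complex.exp (Complex.I * (inner ℝ x' ξ : ℝ)) * Complex.exp (-Complex.I * (inner ℝ y ξ : ℝ))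
        = character (x' - y) ξ := fun ξ y => by
    rw [← Complex.exp_add, character, inner_sub_left]
    push_cast
    congr 1; ring
  have e1 : ∀ ξ, Complex.exp (Complex.I * (inner ℝ x' ξ : ℝ)) * (a ξ * fourierHat v ξ)
      = ∫ y, character (x' - y) ξ * (a ξ * v y) := fun ξ => by
    rw [fourierHat, ← integral_const_mul, ← integral_const_mul]
    refine integral_congr_ae (Eventually.of_forall fun y => ?_)
    simp only [← hexp]; ring
  have e2 : ∀ y, invFourierHat a (x' - y) * v y
      = fourierConst d * ∫ ξ, character (x' - y) ξ * (a ξ * v y) := fun y => by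
    have : invFourierHat a (x' - y) = fourierConst d * ∫ ξ, character (x' - y) ξ * a ξ := rfl
    simp only [this, ← mul_assoc, integral_mul_const]
  simp only [e2, integral_const_mul]
  have : invFourierHat (fun ξ => a ξ * fourierHat v ξ) x' = fourierConst d *
    ∫ ξ, Complex.exp (Complex.I * (inner ℝ x' ξ : ℝ)) * (a ξ * fourierHat v ξ) := rfl
  rw [this]
  simp only [e1]
  congr 1
  -- Fubini applies because characters have modulus 1, so a ⊗ v dominates.
  refine integral_integral_swap ?_
  have hav := ha.mul_prod hv
  refine hav.mono (Continuous.aestronglyMeasurable ?_ |>.mul hav.1)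
    (Eventually.of_forall fun p => ?_)
  · exact continuous_character.comp
      (by fun_prop : Continuous fun p : EuclideanSpace ℝ (Fin d) × EuclideanSpace ℝ (Fin d) =>
        (x' - p.2, p.1))
  · simp [Function.uncurry, norm_character]

end Fourier

/-! ### Operators with kernels -/

/-- For each x' one of the two image points of (x', 0) lies outside a closed support, so the
corresponding factor vanishes near (x', 0). No lower bound on the distance of the supports is
needed. -/
theorem IsCutoff.of_mul {d q : ℕ} {G G' : Type} [NormedAddCommGroup G] [NormedSpace ℝ G]
    [NormedAddCommGroup G'] [NormedSpace ℝ G'] {V : Set G} {V' : Set G'} {φ : G → ℂ} {ψ : G' → ℂ}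
    (hV : IsCornerDomain V) (hV' : IsCornerDomain V') (hφ : IsCbInfty V φ) (hψ : IsCbInfty V' ψ)
    (L : EuclideanSpace ℝ (Fin d) × (EuclideanSpace ℝ (Fin d) × (Fin q → ℝ)) →L[ℝ] G)
    (L' : EuclideanSpace ℝ (Fin d) × (EuclideanSpace ℝ (Fin d) × (Fin q → ℝ)) →L[ℝ] G')
    (hL : MapsTo L (domCutoff d q) V) (hL' : MapsTo L' (domCutoff d q) V')
    (hdisj : ∀ x', ¬(L (x', 0) ∈ suppOn V φ ∧ L' (x', 0) ∈ suppOn V' ψ)) :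
    IsCutoff fun y => φ (L y) * ψ (L' y) := by
  have hS := IsCornerDomain.domCutoff d q
  refine ⟨(hφ.isSmoothBounded.comp_clm hS hV L hL).mul hS
    (hψ.isSmoothBounded.comp_clm hS hV' L' hL'), fun x' => ?_⟩
  have hev : ∀ {G : Type} [NormedAddCommGroup G] [NormedSpace ℝ G] {V : Set G} {φ : G → ℂ}
      (L : EuclideanSpace ℝ (Fin d) × (EuclideanSpace ℝ (Fin d) × (Fin q → ℝ)) →L[ℝ] G),
      MapsTo L (domCutoff d q) V → L (x', 0) ∉ suppOn V φ →
      ∀ᶠ y in 𝓝[domCutoff d q] (x', 0), φ (L y) = 0 := by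
    intro G _ _ V φ L hL hx
    have ho : (suppOn V φ)ᶜ ∈ 𝓝 (L (x', 0)) := isClosed_closure.isOpen_compl.mem_nhds hx
    filter_upwards [mem_nhdsWithin_of_mem_nhds (L.continuous.continuousAt.preimage_mem_nhds ho),
      self_mem_nhdsWithin] with y hy hyS
    by_contra hne
    exact hy (subset_closure ⟨hL hyS, hne⟩)
  by_cases h1 : L (x', 0) ∈ suppOn V φ
  · filter_upwards [hev (φ := ψ) L' hL' fun h2 => hdisj x' ⟨h1, h2⟩] with y hy
    rw [hy, mul_zero]
  · filter_upwards [hev L hL h1] with y hy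
    rw [hy, zero_mul]

theorem IsCtauCinftyKernel.exists_norm_le {E : Type} [NormedAddCommGroup E] [NormedSpace ℝ E]
    {d q : ℕ} {τ : ℝ} {U : Set E} {K : E → EuclideanSpace ℝ (Fin d) × (Fin q → ℝ) → ℂ}
    (hK : IsCtauCinftyKernel τ U K) :
    ∃ C : ℝ, ∀ x ∈ U, ∀ p ∈ domVY d q, ‖K x p‖ ≤ C := by
  obtain ⟨C, hC⟩ := hK.bound 0 0 0 0
  refine ⟨C, fun x hx p hp => ?_⟩
  have := (hC p hp).bound 0 (Nat.zero_le _) x hx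
  have h0 : mixedDeriv (0 : Fin d → ℕ) (0 : Fin q → ℕ) (K x) = K x := mixedDeriv_zero
  simpa [monomial, h0] using this

section Identities

variable {d : ℕ} {a κ : EuclideanSpace ℝ (Fin d) × ℝ → ℂ} {C D μ : ℝ}

theorem integrable_symbol_mul_rpow (C A B μ : ℝ) {n : ℕ} (hn : μ + d < n) :
    Integrable fun ξ : EuclideanSpace ℝ (Fin d) =>
      C * japanese ξ ^ μ * (A * B * japanese ξ ^ (-n : ℝ)) := by
  refine ((integrable_japanese_rpow (d := d) (a := μ + -n) (by linarith)).const_mul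
    (C * (A * B))).congr (Eventually.of_forall fun ξ => ?_)
  simp only [Real.rpow_add (japanese_pos ξ)]
  ring

/-- For w > 0 this is the convolution theorem. At w = 0 the symbol need not be integrable in ξ, and
the identity is obtained by letting w → 0. The left side is continuous because the decay of the
Fourier transform beats the growth of the symbol, the right side because κ is bounded. -/
theorem mul_invFourierHat_eq_integral {v θ : EuclideanSpace ℝ (Fin d) → ℂ} {c : ℝ → ℂ}
    {x' : EuclideanSpace ℝ (Fin d)}
    (ha : ContinuousOn a (univ ×ˢ Ici 0))
    (hab : ∀ ξ, ∀ w, 0 ≤ w → ‖a (ξ, w)‖ ≤ C * japanese ξ ^ μ)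
    (hai : ∀ w, 0 < w → Integrable fun ξ => a (ξ, w)) (hc : ContinuousOn c (Ici 0))
    (hv : Integrable v) (hθv : IsSchwartzOn univ fun y => θ y * v y)
    (hκ : ContinuousOn κ (univ ×ˢ Ici 0)) (hκb : ∀ y, ∀ w, 0 ≤ w → ‖κ (y, w)‖ ≤ D)
    (heq : ∀ y, ∀ w, 0 < w →
      κ (y, w) = c w * θ y * invFourierHat (fun ξ => a (ξ, w)) (x' - y)) {w : ℝ} (hw : 0 ≤ w) :
    c w * invFourierHat (fun ξ => a (ξ, w) * fourierHat (fun y => θ y * v y) ξ) x'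
      = ∫ y, κ (y, w) * v y := by
  obtain ⟨n, hn⟩ := exists_nat_gt (μ + d)
  obtain ⟨A, hA, hF⟩ := hθv.exists_fourierHat_le n
  have haξ : ∀ w, 0 ≤ w → Continuous fun ξ => a (ξ, w) := fun w hw =>
    ha.comp_continuous (by fun_prop) fun _ => ⟨mem_univ _, hw⟩
  have haw : ∀ ξ, ContinuousOn (fun w => a (ξ, w)) (Ici 0) := fun ξ =>
    ha.comp (by fun_prop) fun w hw => ⟨mem_univ _, hw⟩
  have hFc : Continuous (fourierHat fun y => θ y * v y) := by
    refine continuous_of_dominated (bound := fun y => ‖θ y * v y‖) (fun ξ => ?_)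
      (fun ξ => Eventually.of_forall fun y => ?_) hθv.integrable.norm
      (Eventually.of_forall fun y => by fun_prop)
    · exact (Continuous.aestronglyMeasurable (by fun_prop)).mul hθv.integrable.1
    · rw [norm_mul, Complex.norm_exp]; simp
  have hl : ContinuousOn (fun w => ∫ ξ, character x' ξ *
      (a (ξ, w) * fourierHat (fun y => θ y * v y) ξ)) (Ici 0) := by
    refine MeasureTheory.continuousOn_of_dominated (fun w hw => ?_)
      (fun w hw => Eventually.of_forall fun ξ => ?_) (integrable_symbol_mul_rpow C A 1 μ hn)
      (Eventually.of_forall fun ξ => continuousOn_const.mul ((haw ξ).mul continuousOn_const))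
    · exact ((continuous_character_right x').mul ((haξ w hw).mul hFc)).aestronglyMeasurable
    · rw [norm_mul, norm_character, one_mul, norm_mul, mul_one]
      exact mul_le_mul (hab ξ w hw) (hF ξ) (norm_nonneg _) ((norm_nonneg _).trans (hab ξ w hw))
  have hr : ContinuousOn (fun w => ∫ y, κ (y, w) * v y) (Ici 0) := by
    refine MeasureTheory.continuousOn_of_dominated (bound := fun y => D * ‖v y‖) (fun w hw => ?_)
      (fun w hw => Eventually.of_forall fun y => ?_) (hv.norm.const_mul D)
      (Eventually.of_forall fun y => (hκ.comp (by fun_prop)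
        fun w hw => ⟨mem_univ _, hw⟩).mul continuousOn_const)
    · have : Continuous fun y => κ (y, w) :=
        hκ.comp_continuous (by fun_prop) fun _ => ⟨mem_univ _, hw⟩
      exact this.aestronglyMeasurable.mul hv.1
    · rw [norm_mul]
      gcongr
      exact hκb y w hw
  have hpos : EqOn (fun w => c w * (fourierConst d * ∫ ξ, character x' ξ *
      (a (ξ, w) * fourierHat (fun y => θ y * v y) ξ))) (fun w => ∫ y, κ (y, w) * v y) (Ioi 0) := by
    intro w hw
    have h := invFourierHat_mul_fourierHat (hai w hw) hθv.integrable x'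
    have h1 : invFourierHat (fun ξ => a (ξ, w) * fourierHat (fun y => θ y * v y) ξ) x' =
      fourierConst d * ∫ ξ, character x' ξ * (a (ξ, w) * fourierHat (fun y => θ y * v y) ξ) := rfl
    simp only [← h1, h, heq _ w hw]
    rw [← integral_const_mul]
    refine integral_congr_ae (Eventually.of_forall fun y => ?_)
    ring
  exact hpos.of_subset_closure (hc.mul (continuousOn_const.mul hl)) hr Ioi_subset_Ici_self
    (by rw [closure_Ioi]) hw

theorem integrableOn_one_add_norm_rpow :
    Integrable (fun w : ℝ => (1 + ‖w‖) ^ (-2 : ℝ)) (volume.restrict (Ioi 0)) :=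
  (integrable_one_add_norm (by simp)).restrict

theorem aestronglyMeasurable_prod_Ioi {f : EuclideanSpace ℝ (Fin d) × ℝ → ℂ}
    (hf : ContinuousOn f (univ ×ˢ Ioi 0)) :
    AEStronglyMeasurable f ((volume : Measure (EuclideanSpace ℝ (Fin d))).prod
      (volume.restrict (Ioi (0 : ℝ)))) := by
  have : (volume : Measure (EuclideanSpace ℝ (Fin d))).prod (volume.restrict (Ioi (0 : ℝ)))
      = (volume.prod volume).restrict (univ ×ˢ Ioi 0) := by
    rw [← Measure.prod_restrict, Measure.restrict_univ]
  rw [this]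
  exact hf.aestronglyMeasurable (MeasurableSet.univ.prod measurableSet_Ioi)

theorem ae_prod_Ioi {P : EuclideanSpace ℝ (Fin d) × ℝ → Prop} (h : ∀ y, ∀ w, 0 < w → P (y, w)) :
    ∀ᵐ p ∂((volume : Measure (EuclideanSpace ℝ (Fin d))).prod
      (volume.restrict (Ioi (0 : ℝ)))), P p := by
  have : (volume : Measure (EuclideanSpace ℝ (Fin d))).prod (volume.restrict (Ioi (0 : ℝ)))
      = (volume.prod volume).restrict (univ ×ˢ Ioi 0) := by
    rw [← Measure.prod_restrict, Measure.restrict_univ]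
  rw [this, ae_restrict_iff' (MeasurableSet.univ.prod measurableSet_Ioi)]
  exact Eventually.of_forall fun p hp => h p.1 p.2 hp.2

theorem IsSchwartzOn.continuousOn_fourierHat_slice {u : EuclideanSpace ℝ (Fin d) × ℝ → ℂ}
    (hu : IsSchwartzOn (halfSpace d) u) :
    ContinuousOn (fun p : EuclideanSpace ℝ (Fin d) × ℝ => fourierHat (fun y => u (y, p.2)) p.1)
      (univ ×ˢ Ioi 0) := by
  obtain ⟨A, hA, hs⟩ := hu.exists_norm_slice_le
  refine MeasureTheory.continuousOn_of_dominated (fun p hp => ?_)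
    (fun p hp => Eventually.of_forall fun y => ?_) (integrable_one_add_norm_rpow.const_mul A)
    (Eventually.of_forall fun y => ?_)
  · have hw : 0 ≤ p.2 := (mem_Ioi.1 hp.2).le
    exact ((by fun_prop : Continuous fun y : EuclideanSpace ℝ (Fin d) =>
      Complex.exp (-Complex.I * (inner ℝ y p.1 : ℝ))).mul
      (hu.contDiff_slice hw).continuous).aestronglyMeasurable
  · have hw : 0 ≤ p.2 := (mem_Ioi.1 hp.2).le
    have h1 : ‖Complex.exp (-Complex.I * (inner ℝ y p.1 : ℝ))‖ = 1 := by
      rw [Complex.norm_exp]; simp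
    rw [norm_mul, h1, one_mul]
    refine (hs _ hw y).trans ?_
    gcongr
    refine mul_le_of_le_one_right hA ?_
    exact Real.rpow_le_one_of_one_le_of_nonpos (by simp) (by norm_num)
  · refine ContinuousOn.mul (Continuous.continuousOn (by fun_prop)) ?_
    exact hu.1.continuousOn.comp (by fun_prop) fun p hp => (mem_Ioi.1 hp.2).le

/-- Operators of class `0` as integral operators. -/
theorem mul_invFourierHat_integral_eq_integral {u θ : EuclideanSpace ℝ (Fin d) × ℝ → ℂ} {c : ℂ}
    {x' : EuclideanSpace ℝ (Fin d)}
    (ha : ContinuousOn a (univ ×ˢ Ioi 0))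
    (hab : ∀ ξ, ∀ w, 0 < w → ‖a (ξ, w)‖ ≤ C * japanese ξ ^ μ)
    (hai : ∀ w, 0 < w → Integrable fun ξ => a (ξ, w))
    (hu : IsSchwartzOn (halfSpace d) u) (hθu : IsSchwartzOn (halfSpace d) fun p => θ p * u p)
    (hκ : ContinuousOn κ (univ ×ˢ Ioi 0)) (hκb : ∀ y, ∀ w, 0 < w → ‖κ (y, w)‖ ≤ D)
    (heq : ∀ y, ∀ w, 0 < w →
      κ (y, w) = c * θ (y, w) * invFourierHat (fun ξ => a (ξ, w)) (x' - y)) :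
    c * invFourierHat (fun ξ => ∫ w in Ioi (0 : ℝ),
        a (ξ, w) * fourierHat (fun y => θ (y, w) * u (y, w)) ξ) x'
      = ∫ y, ∫ w in Ioi (0 : ℝ), κ (y, w) * u (y, w) := by
  have hint : Integrable (fun p : EuclideanSpace ℝ (Fin d) × ℝ => character x' p.1 *
      (a p * fourierHat (fun y => θ (y, p.2) * u (y, p.2)) p.1))
      (volume.prod (volume.restrict (Ioi 0))) := by
    obtain ⟨n, hn⟩ := exists_nat_gt (μ + d)
    obtain ⟨A, hA, hF⟩ := hθu.exists_fourierHat_slice_le n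
    refine ((integrable_symbol_mul_rpow C A 1 μ hn).mul_prod
      integrableOn_one_add_norm_rpow).mono' (aestronglyMeasurable_prod_Ioi ?_)
      (ae_prod_Ioi fun ξ w hw => ?_)
    · exact ((continuous_character_right x').comp continuous_fst).continuousOn.mul
        (ha.mul hθu.continuousOn_fourierHat_slice)
    · simp only [norm_mul, norm_character, one_mul]
      refine (mul_le_mul (hab ξ w hw) (hF w hw.le ξ) (norm_nonneg _)
        ((norm_nonneg _).trans (hab ξ w hw))).trans_eq ?_
      ring
  have hint' : Integrable (fun p : EuclideanSpace ℝ (Fin d) × ℝ => κ p * u p)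
      (volume.prod (volume.restrict (Ioi 0))) := by
    obtain ⟨A, hA, hs⟩ := hu.exists_norm_slice_le
    refine ((integrable_one_add_norm_rpow.const_mul (D * A)).mul_prod
      integrableOn_one_add_norm_rpow).mono' (aestronglyMeasurable_prod_Ioi ?_)
      (ae_prod_Ioi fun y w hw => ?_)
    · exact hκ.mul (hu.1.continuousOn.mono fun p hp => (mem_Ioi.1 hp.2).le)
    · rw [norm_mul]
      refine (mul_le_mul (hκb y w hw) (hs w hw.le y) (norm_nonneg _)
        ((norm_nonneg _).trans (hκb y w hw))).trans_eq ?_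
      ring
  have e1 : invFourierHat (fun ξ => ∫ w in Ioi (0 : ℝ),
        a (ξ, w) * fourierHat (fun y => θ (y, w) * u (y, w)) ξ) x'
      = fourierConst d * ∫ ξ, ∫ w in Ioi (0 : ℝ), character x' ξ *
        (a (ξ, w) * fourierHat (fun y => θ (y, w) * u (y, w)) ξ) := by
    simp only [integral_const_mul]
    rfl
  -- Moving the normal integral outside on both sides leaves the convolution theorem at fixed w > 0.
  -- The point w = 0 is irrelevant here.
  rw [e1, integral_integral_swap hint, integral_integral_swap (f := fun y w => κ (y, w) * u (y, w)) hint', ← integral_const_mul,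
    ← integral_const_mul]
  refine setIntegral_congr_fun measurableSet_Ioi fun w hw => ?_
  have hw0 : 0 < w := hw
  obtain ⟨A, hA, hs⟩ := hθu.exists_norm_slice_le
  have hi : Integrable fun y => θ (y, w) * u (y, w) :=
    (integrable_one_add_norm_rpow.const_mul (A * (1 + ‖w‖) ^ (-2 : ℝ))).mono'
      (hθu.contDiff_slice hw0.le).continuous.aestronglyMeasurable
      (Eventually.of_forall fun y => hs w hw0.le y)
  have h := invFourierHat_mul_fourierHat (hai w hw) hi x'
  have h1 : invFourierHat (fun ξ => a (ξ, w) * fourierHat (fun y => θ (y, w) * u (y, w)) ξ) x' =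
    fourierConst d * ∫ ξ, character x' ξ *
      (a (ξ, w) * fourierHat (fun y => θ (y, w) * u (y, w)) ξ) := rfl
  simp only [← h1, h, heq _ w hw]
  rw [← integral_const_mul]
  refine integral_congr_ae (Eventually.of_forall fun y => ?_)
  ring

end Identities

/-! ### Poisson, trace and singular Green operators with cutoffs -/

section Operators

variable {d : ℕ} {τ m : ℝ}

/-- The linear map `(x', (z', Y)) ↦ (x', Y_j)`. -/
def cutoffPoint (d : ℕ) {q : ℕ} (j : Fin q) :
    EuclideanSpace ℝ (Fin d) × (EuclideanSpace ℝ (Fin d) × (Fin q → ℝ)) →L[ℝ]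
      EuclideanSpace ℝ (Fin d) × ℝ :=
  (ContinuousLinearMap.fst ℝ _ _).prod ((ContinuousLinearMap.proj j).comp
    ((ContinuousLinearMap.snd ℝ _ _).comp (ContinuousLinearMap.snd ℝ _ _)))

/-- The linear map `(x', (z', Y)) ↦ x' - z'`. -/
def cutoffDiff (d q : ℕ) :
    EuclideanSpace ℝ (Fin d) × (EuclideanSpace ℝ (Fin d) × (Fin q → ℝ)) →L[ℝ]
      EuclideanSpace ℝ (Fin d) :=
  ContinuousLinearMap.fst ℝ _ _ -
    (ContinuousLinearMap.fst ℝ _ _).comp (ContinuousLinearMap.snd ℝ _ _)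

/-- The linear map `(x', (z', Y)) ↦ (x' - z', Y_j)`. -/
def cutoffShift (d : ℕ) {q : ℕ} (j : Fin q) :
    EuclideanSpace ℝ (Fin d) × (EuclideanSpace ℝ (Fin d) × (Fin q → ℝ)) →L[ℝ]
      EuclideanSpace ℝ (Fin d) × ℝ :=
  (cutoffDiff d q).prod ((ContinuousLinearMap.proj j).comp
    ((ContinuousLinearMap.snd ℝ _ _).comp (ContinuousLinearMap.snd ℝ _ _)))

theorem cutoffPoint_apply {q : ℕ} (j : Fin q)
    (y : EuclideanSpace ℝ (Fin d) × (EuclideanSpace ℝ (Fin d) × (Fin q → ℝ))) :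
    cutoffPoint d j y = (y.1, y.2.2 j) := rfl

theorem cutoffDiff_apply {q : ℕ}
    (y : EuclideanSpace ℝ (Fin d) × (EuclideanSpace ℝ (Fin d) × (Fin q → ℝ))) :
    cutoffDiff d q y = y.1 - y.2.1 := rfl

theorem cutoffShift_apply {q : ℕ} (j : Fin q)
    (y : EuclideanSpace ℝ (Fin d) × (EuclideanSpace ℝ (Fin d) × (Fin q → ℝ))) :
    cutoffShift d j y = (y.1 - y.2.1, y.2.2 j) := rfl

theorem mapsTo_cutoffPoint {q : ℕ} (j : Fin q) :
    MapsTo (cutoffPoint d j) (domCutoff d q) (halfSpace d) := fun _ hy => hy.2.2 j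

theorem mapsTo_cutoffShift {q : ℕ} (j : Fin q) :
    MapsTo (cutoffShift d j) (domCutoff d q) (halfSpace d) := fun _ hy => hy.2.2 j

/-- The cutoff is φ(x', Y) ψ(x' - z'). At (z', Y) = 0 both factors are evaluated over the same
boundary point (x', 0), where the supports do not meet. -/
theorem poissonHasKernel {φ : EuclideanSpace ℝ (Fin d) × ℝ → ℂ} {ψ : EuclideanSpace ℝ (Fin d) → ℂ}
    (hτ : 0 < τ) (hφ : IsCbInfty (halfSpace d) φ) (hψ : IsCbInfty univ ψ)
    (hd : suppOn (halfSpace d) φ ∩ (suppOn univ ψ ×ˢ {(0 : ℝ)}) = ∅)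
    {k : EuclideanSpace ℝ (Fin d) × ℝ → EuclideanSpace ℝ (Fin d) × (Fin 1 → ℝ) → ℂ}
    (hk : IsSymbolKernel τ m (halfSpace d) k) :
    PoissonHasKernel τ (fun v x => φ x * poissonOp k (fun y' => ψ y' * v y') x) := by
  have hU := IsCornerDomain.halfSpace d
  have hW : IsCutoff fun y => φ (cutoffPoint d (0 : Fin 1) y) * ψ (cutoffDiff d 1 y) := by
    refine IsCutoff.of_mul hU IsCornerDomain.univ hφ hψ _ _ (mapsTo_cutoffPoint _)
      (mapsTo_univ _ _) fun x' hx => ?_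
    have : (x', (0 : ℝ)) ∈ suppOn (halfSpace d) φ ∩ (suppOn univ ψ ×ˢ {(0 : ℝ)}) :=
      ⟨hx.1, by simpa [cutoffDiff_apply] using hx.2, rfl⟩
    rw [hd] at this
    exact this
  obtain ⟨K, hK, e⟩ := exists_smoothingKernel hU hasPointFormula_one hk
    (ContinuousLinearMap.fst ℝ _ _) hW
  have hKk := hK.isCtauCinftyKernel hU hτ.le hasPointFormula_one hk
  obtain ⟨D, hD⟩ := hKk.exists_norm_le
  obtain ⟨C, hC, hb⟩ := SymClass.self.exists_norm_le hU hasPointFormula_one hk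
  refine ⟨K, hKk, fun v x hx => ?_⟩
  have hm : ∀ w : ℝ, 0 ≤ w → (![w] : Fin 1 → ℝ) ∈ orthant 1 := fun w hw j => by
    fin_cases j; exact hw
  have hpos : ∀ w : ℝ, 0 < w → (![w] : Fin 1 → ℝ) ≠ 0 := fun w hw h =>
    hw.ne' (by simpa using congrFun h 0)
  exact mul_invFourierHat_eq_integral (x' := x.1) (c := fun w => φ (x.1, w)) (θ := ψ)
    (a := fun p => k x (p.1, ![p.2])) (κ := fun p => K x (x.1 - p.1, ![p.2]))
    ((hk.smooth x hx).continuousOn.comp (by fun_prop) fun p hp => ⟨mem_univ _, hm p.2 hp.2⟩)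
    (fun ξ w hw => hb x hx (ξ, ![w]) ⟨mem_univ _, hm w hw⟩)
    (fun w hw => SymClass.self.integrable hU hasPointFormula_one hk hx (hm w hw.le)
      (Or.inr (hpos w hw)))
    (hφ.1.continuousOn.comp (by fun_prop) fun w hw => hw) v.isSchwartzOn.integrable
    (v.isSchwartzOn.cb_mul uniqueDiffOn_univ hψ)
    ((hKk.smooth x hx).continuousOn.comp (by fun_prop) fun p hp => ⟨mem_univ _, hm p.2 hp.2⟩)
    (fun y w hw => hD x hx _ ⟨mem_univ _, hm w hw⟩)
    (fun y w hw => by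
      simp only []
      rw [e x hx _ ⟨mem_univ _, hm w hw.le⟩ (hpos w hw), cutoffPoint_apply, cutoffDiff_apply]
      simp only [ContinuousLinearMap.coe_fst', sub_sub_cancel]
      rfl) hx

/-- The roles are exchanged: φ acts on the argument of the operator, which gives the cutoff φ(x' -
z', Y) ψ(x'). -/
theorem traceHasKernel {φ : EuclideanSpace ℝ (Fin d) × ℝ → ℂ} {ψ : EuclideanSpace ℝ (Fin d) → ℂ}
    (hτ : 0 < τ) (hφ : IsCbInfty (halfSpace d) φ) (hψ : IsCbInfty univ ψ)
    (hd : suppOn (halfSpace d) φ ∩ (suppOn univ ψ ×ˢ {(0 : ℝ)}) = ∅)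
    {t : EuclideanSpace ℝ (Fin d) → EuclideanSpace ℝ (Fin d) × (Fin 1 → ℝ) → ℂ}
    (ht : IsSymbolKernel τ m univ t) :
    TraceHasKernel τ (fun u x' => ψ x' * traceOp t (fun y => φ y * u y) x') := by
  have hU : IsCornerDomain (univ : Set (EuclideanSpace ℝ (Fin d))) := IsCornerDomain.univ
  have hW : IsCutoff fun y => φ (cutoffShift d (0 : Fin 1) y) *
      ψ (ContinuousLinearMap.fst ℝ _ _ y) := by
    refine IsCutoff.of_mul (IsCornerDomain.halfSpace d) hU hφ hψ _ _ (mapsTo_cutoffShift _)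
      (mapsTo_univ _ _) fun x' hx => ?_
    have : (x', (0 : ℝ)) ∈ suppOn (halfSpace d) φ ∩ (suppOn univ ψ ×ˢ {(0 : ℝ)}) :=
      ⟨by simpa [cutoffShift_apply] using hx.1, hx.2, rfl⟩
    rw [hd] at this
    exact this
  obtain ⟨K, hK, e⟩ := exists_smoothingKernel hU hasPointFormula_one ht
    (ContinuousLinearMap.id ℝ _) hW
  have hKk := hK.isCtauCinftyKernel hU hτ.le hasPointFormula_one ht
  obtain ⟨D, hD⟩ := hKk.exists_norm_le
  obtain ⟨C, hC, hb⟩ := SymClass.self.exists_norm_le hU hasPointFormula_one ht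
  refine ⟨K, hKk, fun u hu x' => ?_⟩
  have hx := mem_univ x'
  have hm : ∀ w : ℝ, 0 < w → (![w] : Fin 1 → ℝ) ∈ orthant 1 := fun w hw j => by
    fin_cases j; exact hw.le
  have hpos : ∀ w : ℝ, 0 < w → (![w] : Fin 1 → ℝ) ≠ 0 := fun w hw h =>
    hw.ne' (by simpa using congrFun h 0)
  exact mul_invFourierHat_integral_eq_integral (x' := x') (c := ψ x') (θ := φ) (u := u)
    (a := fun p => t x' (p.1, ![p.2])) (κ := fun p => K x' (x' - p.1, ![p.2]))
    ((ht.smooth x' hx).continuousOn.comp (by fun_prop) fun p hp => ⟨mem_univ _, hm p.2 hp.2⟩)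
    (fun ξ w hw => hb x' hx (ξ, ![w]) ⟨mem_univ _, hm w hw⟩)
    (fun w hw => SymClass.self.integrable hU hasPointFormula_one ht hx (hm w hw)
      (Or.inr (hpos w hw))) hu (hu.cb_mul (IsCornerDomain.halfSpace d).2 hφ)
    ((hKk.smooth x' hx).continuousOn.comp (by fun_prop) fun p hp => ⟨mem_univ _, hm p.2 hp.2⟩)
    (fun y w hw => hD x' hx _ ⟨mem_univ _, hm w hw⟩)
    (fun y w hw => by
      simp only []
      rw [e x' hx _ ⟨mem_univ _, hm w hw⟩ (hpos w hw), cutoffShift_apply]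
      simp only [ContinuousLinearMap.coe_fst', ContinuousLinearMap.coe_id', id, sub_sub_cancel]
      rw [mul_comm (φ _)]
      rfl)

/-- The cutoff is φ(x', Y_0) ψ(x' - z', Y_1). Both normal variables vanish at (z', Y) = 0, so
disjointness of the supports on the boundary is enough. -/
theorem singularGreenHasKernel {φ ψ : EuclideanSpace ℝ (Fin d) × ℝ → ℂ}
    (hτ : 0 < τ) (hφ : IsCbInfty (halfSpace d) φ) (hψ : IsCbInfty (halfSpace d) ψ)
    (hd : suppOn (halfSpace d) φ ∩ suppOn (halfSpace d) ψ ∩ (univ ×ˢ {(0 : ℝ)}) = ∅)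
    {g : EuclideanSpace ℝ (Fin d) × ℝ → EuclideanSpace ℝ (Fin d) × (Fin 2 → ℝ) → ℂ}
    (hg : IsSymbolKernel τ m (halfSpace d) g) :
    SingularGreenHasKernel τ (fun u x => φ x * singularGreenOp g (fun w => ψ w * u w) x) := by
  have hU := IsCornerDomain.halfSpace d
  have hW : IsCutoff fun y => φ (cutoffPoint d (0 : Fin 2) y) * ψ (cutoffShift d (1 : Fin 2) y) := by
    refine IsCutoff.of_mul hU hU hφ hψ _ _ (mapsTo_cutoffPoint _)
      (mapsTo_cutoffShift _) fun x' hx => ?_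
    have : (x', (0 : ℝ)) ∈ suppOn (halfSpace d) φ ∩ suppOn (halfSpace d) ψ ∩
        (univ ×ˢ {(0 : ℝ)}) :=
      ⟨⟨hx.1, by simpa [cutoffShift_apply] using hx.2⟩, mem_univ _, rfl⟩
    rw [hd] at this
    exact this
  obtain ⟨K, hK, e⟩ := exists_smoothingKernel hU hasPointFormula_two hg
    (ContinuousLinearMap.fst ℝ _ _) hW
  have hKk := hK.isCtauCinftyKernel hU hτ.le hasPointFormula_two hg
  obtain ⟨D, hD⟩ := hKk.exists_norm_le
  obtain ⟨C, hC, hb⟩ := SymClass.self.exists_norm_le hU hasPointFormula_two hg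
  refine ⟨K, hKk, fun u hu x hx => ?_⟩
  have hm : ∀ w : ℝ, 0 < w → (![x.2, w] : Fin 2 → ℝ) ∈ orthant 2 := fun w hw j => by
    fin_cases j
    · exact hx
    · exact hw.le
  have hpos : ∀ w : ℝ, 0 < w → (![x.2, w] : Fin 2 → ℝ) ≠ 0 := fun w hw h =>
    hw.ne' (by simpa using congrFun h 1)
  exact mul_invFourierHat_integral_eq_integral (x' := x.1) (c := φ x) (θ := ψ) (u := u)
    (a := fun p => g x (p.1, ![x.2, p.2])) (κ := fun p => K x (x.1 - p.1, ![x.2, p.2]))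
    ((hg.smooth x hx).continuousOn.comp (by fun_prop) fun p hp => ⟨mem_univ _, hm p.2 hp.2⟩)
    (fun ξ w hw => hb x hx (ξ, ![x.2, w]) ⟨mem_univ _, hm w hw⟩)
    (fun w hw => SymClass.self.integrable hU hasPointFormula_two hg hx (hm w hw)
      (Or.inr (hpos w hw))) hu (hu.cb_mul hU.2 hψ)
    ((hKk.smooth x hx).continuousOn.comp (by fun_prop) fun p hp => ⟨mem_univ _, hm p.2 hp.2⟩)
    (fun y w hw => hD x hx _ ⟨mem_univ _, hm w hw⟩)
    (fun y w hw => by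
      simp only []
      rw [e x hx _ ⟨mem_univ _, hm w hw⟩ (hpos w hw), cutoffPoint_apply, cutoffShift_apply]
      simp only [ContinuousLinearMap.coe_fst', sub_sub_cancel]
      rfl)

end Operators

end NonsmoothGreen

end

theorem mainTheorem10 (d : ℕ) (τ m : ℝ) (hτ : 0 < τ) :
    -- Poisson operators
    (∀ (φ : EuclideanSpace ℝ (Fin d) × ℝ → ℂ) (ψ : EuclideanSpace ℝ (Fin d) → ℂ),
      IsCbInfty (halfSpace d) φ → IsCbInfty Set.univ ψ →
      suppOn (halfSpace d) φ ∩ (suppOn Set.univ ψ ×ˢ {(0 : ℝ)}) = ∅ →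
      ∀ k : EuclideanSpace ℝ (Fin d) × ℝ → EuclideanSpace ℝ (Fin d) × (Fin 1 → ℝ) → ℂ,
        IsSymbolKernel τ (m - 1) (halfSpace d) k →
        PoissonHasKernel τ (fun v x => φ x * poissonOp k (fun y' => ψ y' * v y') x)) ∧
    -- trace operators
    (∀ (φ : EuclideanSpace ℝ (Fin d) × ℝ → ℂ) (ψ : EuclideanSpace ℝ (Fin d) → ℂ),
      IsCbInfty (halfSpace d) φ → IsCbInfty Set.univ ψ →
      suppOn (halfSpace d) φ ∩ (suppOn Set.univ ψ ×ˢ {(0 : ℝ)}) = ∅ →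
      ∀ t : EuclideanSpace ℝ (Fin d) → EuclideanSpace ℝ (Fin d) × (Fin 1 → ℝ) → ℂ,
        IsSymbolKernel τ m Set.univ t →
        TraceHasKernel τ (fun u x' => ψ x' * traceOp t (fun y => φ y * u y) x')) ∧
    -- singular Green operators
    (∀ φ ψ : EuclideanSpace ℝ (Fin d) × ℝ → ℂ,
      IsCbInfty (halfSpace d) φ → IsCbInfty (halfSpace d) ψ →
      suppOn (halfSpace d) φ ∩ suppOn (halfSpace d) ψ ∩ (Set.univ ×ˢ {(0 : ℝ)}) = ∅ →
      ∀ g : EuclideanSpace ℝ (Fin d) × ℝ → EuclideanSpace ℝ (Fin d) × (Fin 2 → ℝ) → ℂ,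
        IsSymbolKernel τ m (halfSpace d) g →
        SingularGreenHasKernel τ
          (fun u x => φ x * singularGreenOp g (fun w => ψ w * u w) x)) := by
  exact ⟨fun φ ψ hφ hψ hd k hk => poissonHasKernel hτ hφ hψ hd hk,
    fun φ ψ hφ hψ hd t ht => traceHasKernel hτ hφ hψ hd ht,
    fun φ ψ hφ hψ hd g hg => singularGreenHasKernel hτ hφ hψ hd hg⟩
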